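/- Let $\mathbb{K}=\mathbb{F}_q(C)$ be the function field of a smooth projective geometrically connected curve $C$ over a finite field $\mathbb{F}_q$, let $\infty$ be a closed point of $C$, and let $\mathbf{A}\subset\mathbb{K}$ be the ring of functions regular outside $\infty$. Let $\mathbb{K}_\infty$ be the completion of $\mathbb{K}$ at $\infty$ and $\mathbf{C}_\infty$ the completion of an algebraic closure of $\mathbb{K}_\infty$. Let $\mathbb{A}_{\mathbb{K},f}=\prod'_{v\ne\infty}\mathbb{K}_v$ be the ring of finite adeles and $R=\prod_{v\neq\infty}\mathbf{A}_v$ its subring of integral adeles. Let $n\ge 0$. Matrices act from the right on row vectors. An $n$-dimensional $\mathbb{K}$-rational lattice is a pair $(\Lambda,\phi)$ of a finitely generated $\mathbf{A}$-submodule $\Lambda\subset\mathbb{K}^n$ with $\Lambda\otimes_{\mathbf{A}}\mathbb{K}_\infty\simeq\mathbb{K}_\infty^n$ and a homomorphism of $\mathbf{A}$-modules $\phi:(\mathbb{K}/\mathbf{A})^n\to\mathbb{K}\Lambda/\Lambda$; two of them are isomorphic if an element of $\mathrm{GL}_n(\mathbb{K})$ carries one to the other. An $n$-dimensional $\mathbb{K}$-rational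 $\mathbf{C}_\infty$-lattice is a pair $(\Lambda,\phi)$ of a finitely generated discrete $\mathbf{A}$-submodule $\Lambda\subset\mathbf{C}_\infty$ with $\dim_{\mathbb{K}_\infty}\mathbb{K}_\infty\Lambda=n$ and a homomorphism of $\mathbf{A}$-modules $\phi:(\mathbb{K}/\mathbf{A})^n\to\mathbb{K}\Lambda/\Lambda$; two of them are isomorphic if multiplication by an element of $\mathbf{C}_\infty^*$ carries one to the other. Let $\mathcal{K}_{\mathbb{K},n}$ and $\mathcal{K}_{\mathbb{K},n}^{\mathbf{C}_\infty}$ be the sets of isomorphism classes. Let $\Omega^n$ be the set of column vectors $\omega\in\mathbf{C}_\infty^n$ with $\mathbb{K}_\infty$-linearly independent coordinates, modulo scaling by $\mathbf{C}_\infty^*$; $\mathrm{GL}_n(\mathbb{K})$ acts on it by matrix multiplication. For $z\in\Omega^n$ represented by $\omega$, let $\iota_z:\mathbb{K}_\infty^n\to\mathbf{C}_\infty$, $x\mapsto\sum_i x_i\omega_i$ (well defined up to $\mathbf{C}_\infty^*$). Let $\mathrm{GL}_n(\mathbb{K})\backslash\mathrm{GL}_n(\mathbb{A}_{\mathbb{K},f})\times_{\mathrm{GL}_n(R)}M_n(R)$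 be the quotient of $\mathrm{GL}_n(\mathbb{A}_{\mathbb{K},f})\times M_n(R)$ by $(g,\rho)\sim(\gamma gm,\rho m)$, and let $\mathrm{GL}_n(\mathbb{K})\backslash\mathrm{GL}_n(\mathbb{A}_{\mathbb{K},f})\times\Omega^n\times_{\mathrm{GL}_n(R)}M_n(R)$ be the quotient of $\mathrm{GL}_n(\mathbb{A}_{\mathbb{K},f})\times\Omega^n\times M_n(R)$ by $(g,z,\rho)\sim(\gamma gm,\gamma z,\rho m)$, for $\gamma\in\mathrm{GL}_n(\mathbb{K})$, $m\in\mathrm{GL}_n(R)$. Then there are well-defined bijections $$\mathrm{GL}_n(\mathbb{K})\backslash\mathrm{GL}_n(\mathbb{A}_{\mathbb{K},f})\times_{\mathrm{GL}_n(R)}M_n(R)\xrightarrow{\ \simeq\ }\mathcal{K}_{\mathbb{K},n},\qquad (g,\rho)\mapsto(R^ng^{-1}\cap\mathbb{K}^n,\ \rho g^{-1}),$$ $$\mathrm{GL}_n(\mathbb{K})\backslash\mathrm{GL}_n(\mathbb{A}_{\mathbb{K},f})\times\Omega^n\times_{\mathrm{GL}_n(R)}M_n(R)\xrightarrow{\ \simeq\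 }\mathcal{K}_{\mathbb{K},n}^{\mathbf{C}_\infty},\qquad (g,z,\rho)\mapsto\big(\iota_z(R^ng^{-1}\cap\mathbb{K}^n),\ \iota_z(\rho g^{-1})\big).$$ Here $\rho g^{-1}$ denotes the unique homomorphism $\phi:(\mathbb{K}/\mathbf{A})^n\to\mathbb{K}^n/\Lambda$, $\Lambda=R^ng^{-1}\cap\mathbb{K}^n$, such that for $x,y\in\mathbb{K}^n$ one has $\phi(x\bmod\mathbf{A}^n)=y\bmod\Lambda$ if and only if $x\rho g^{-1}-y\in R^ng^{-1}$, and $\iota_z(\rho g^{-1})$ is its composition with the map $\mathbb{K}^n/\Lambda\to\mathbb{K}\iota_z(\Lambda)/\iota_z(\Lambda)$ induced by $\iota_z$. -/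

import Mathlib

noncomputable section
open scoped WithZero NNReal RatFunc RestrictedProduct

/-- `K` is a global function field: a function field in one variable over a finite field `F`, that
is, a finite extension of `F(X)`. These are exactly the fields `𝔽_q(C)` of rational functions on a
smooth projective geometrically connected curve `C` over a finite field `𝔽_q`, where `𝔽_q` is the
algebraic closure of the prime field in `K`. -/
class IsGlobalFunctionField (K : Type*) [Field K] : Prop where
  exists_functionField : ∃ (F : Type) (_ : Field F) (_ : Finite F) (_ : Algebra F⟮X⟯ K),
    FunctionField F K

/-- A place of `K` (a closed point of the curve), given by its normalized discrete valuation,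
written multiplicatively: `val x = exp (-ord_v x)`. On a global function field such a valuation is
automatically trivial on the constants, and every nontrivial valuation is equivalent to exactly one
of these. -/
structure Place (K : Type*) [Field K] where
  val : Valuation K ℤᵐ⁰
  surjective : Function.Surjective val

namespace Place
variable {K : Type*} [Field K] (v : Place K)

/-- The completion `K_v`. -/
abbrev completion : Type _ := v.val.Completion

/-- The ring `A_v` of integers of `K_v`, i.e. the completion of the local ring at `v`. -/
abbrev integers : ValuationSubring v.completion := Valued.v.valuationSubring

instance : UniformContinuousConstSMul K (WithVal v.val) :=
  ⟨fun c => uniformContinuous_const_smul (WithVal.toVal v.val c)⟩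

theorem valued_algebraMap (x : K) : Valued.v (algebraMap K v.completion x) = v.val x :=
  Valued.extensionValuation_apply_coe (WithVal.toVal v.val x)

/-- The absolute value `|x|_v = 2 ^ (-ord_v x)` on `K_v`. The basis `2` plays no role: only the
topology defined by the absolute value, and by its extensions, is used. -/
instance rankOne : (Valued.v : Valuation v.completion ℤᵐ⁰).RankOne where
  hom' := (WithZeroMulInt.toNNReal (e := 2) two_ne_zero).comp
    MonoidWithZeroHom.ValueGroup₀.embedding
  strictMono' := (WithZeroMulInt.toNNReal_strictMono one_lt_two).comp
    MonoidWithZeroHom.ValueGroup₀.embedding_strictMono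
  exists_val_nontrivial := by
    obtain ⟨x, hx⟩ := v.surjective (WithZero.exp 1)
    refine ⟨algebraMap K v.completion x, ?_⟩
    rw [valued_algebraMap, hx]
    simp [← WithZero.exp_zero]

instance : NontriviallyNormedField v.completion :=
  Valued.toNontriviallyNormedField v.completion ℤᵐ⁰
instance : IsUltrametricDist v.completion :=
  IsUltrametricDist.isUltrametricDist_of_forall_norm_add_le_max_norm
    (Valuation.norm_add_le (v := (Valued.v : Valuation v.completion ℤᵐ⁰)))

end Place
section poles
/-! ### An element of a global function field has finitely many zeros and poles -/

variable {K : Type*} [Field K]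

theorem Place.eq_of_forall_le_iff (v w : Place K)
    (h : ∀ x y : K, v.val x ≤ v.val y ↔ w.val x ≤ w.val y) : v = w := by
  have heq (x y : K) (hxy : v.val x = v.val y) : w.val x = w.val y :=
    le_antisymm ((h x y).1 hxy.le) ((h y x).1 hxy.ge)
  obtain ⟨π, hπ⟩ := v.surjective (WithZero.exp 1)
  have hπ0 : π ≠ 0 := by
    rintro rfl
    exact WithZero.exp_ne_zero (a := (1 : ℤ)) (by rw [← hπ, map_zero])
  have hval (u : Place K) (x : K) (hx : x ≠ 0) : ∃ n : ℤ, u.val x = WithZero.exp n :=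
    ⟨_, (WithZero.exp_log ((u.val.ne_zero_iff).2 hx)).symm⟩
  obtain ⟨a, ha⟩ := hval w π hπ0
  have hpow (x : K) (n : ℤ) (hx : v.val x = WithZero.exp n) :
      w.val x = WithZero.exp (n * a) := by
    rw [heq x (π ^ n) (by rw [hx, map_zpow₀, hπ, ← WithZero.exp_zsmul]; simp), map_zpow₀, ha,
      ← WithZero.exp_zsmul, smul_eq_mul]
  obtain ⟨y, hy⟩ := w.surjective (WithZero.exp 1)
  have hy0 : y ≠ 0 := by
    rintro rfl
    exact WithZero.exp_ne_zero (a := (1 : ℤ)) (by rw [← hy, map_zero])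
  obtain ⟨n, hn⟩ := hval v y hy0
  have hna : n * a = 1 := by
    have := (hpow y n hn).symm.trans hy
    simpa using this
  have ha1 : 0 ≤ a := by
    have h1 := (h 1 π).1 (by rw [map_one, hπ, ← WithZero.exp_zero, WithZero.exp_le_exp]; simp)
    rwa [map_one, ha, ← WithZero.exp_zero, WithZero.exp_le_exp] at h1
  have ha2 : a = 1 := by
    rcases Int.eq_one_or_neg_one_of_mul_eq_one' hna with h | h <;> omega
  have hvw : v.val = w.val := by
    ext x
    rcases eq_or_ne x 0 with rfl | hx
    · simp
    · obtain ⟨m, hm⟩ := hval v x hx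
      rw [hpow x m hm, hm, ha2, mul_one]
  cases v; cases w; cases hvw; rfl

theorem Place.exists_one_lt_lt_one {ι : Type*} [Finite ι] (v : ι → Place K)
    (hv : Function.Injective v) (i : ι) :
    ∃ a : K, 1 < (v i).val a ∧ ∀ j ≠ i, (v j).val a < 1 := by
  let f : ℤᵐ⁰ →*₀ ℝ≥0 := WithZeroMulInt.toNNReal (e := 2) two_ne_zero
  have hf : StrictMono f := WithZeroMulInt.toNNReal_strictMono one_lt_two
  let abv (w : Place K) : AbsoluteValue K ℝ :=
    { toFun x := f (w.val x)
      map_mul' x y := by simp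
      nonneg' x := by simp
      eq_zero' x := by simp
      add_le' x y := by
        rw [← NNReal.coe_add, NNReal.coe_le_coe]
        exact (hf.monotone (w.val.map_add x y)).trans
          ((hf.monotone.map_max).le.trans (max_le_add_of_nonneg zero_le zero_le)) }
  have habv (w : Place K) (x : K) : abv w x = f (w.val x) := rfl
  have hlt (w : Place K) (x : K) : abv w x < 1 ↔ w.val x < 1 := by
    rw [habv, ← NNReal.coe_one, NNReal.coe_lt_coe, ← map_one f, hf.lt_iff_lt]
  have hgt (w : Place K) (x : K) : 1 < abv w x ↔ 1 < w.val x := by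
    rw [habv, ← NNReal.coe_one, NNReal.coe_lt_coe, ← map_one f, hf.lt_iff_lt]
  have hnt (w : Place K) : (abv w).IsNontrivial := by
    obtain ⟨x, hx⟩ := w.surjective (WithZero.exp 1)
    refine ⟨x, ?_, ?_⟩
    · rintro rfl
      exact WithZero.exp_ne_zero (a := (1 : ℤ)) (by rw [← hx, map_zero])
    · refine ((hgt w x).2 ?_).ne'
      rw [hx, ← WithZero.exp_zero, WithZero.exp_lt_exp]
      exact one_pos
  have hne : Pairwise fun i j => ¬ (abv (v i)).IsEquiv (abv (v j)) := by
    intro i j hij h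
    refine hij (hv ?_)
    refine Place.eq_of_forall_le_iff _ _ fun x y => ?_
    simpa only [habv, NNReal.coe_le_coe, hf.le_iff_le] using h.le_iff_le (x := x) (y := y)
  simpa only [hlt, hgt] using
    AbsoluteValue.exists_one_lt_lt_one_pi_of_not_isEquiv (v := fun i => abv (v i))
      (fun i => hnt _) hne i

theorem Place.val_constant {F : Type*} [Field F] [Finite F] [Algebra F K]
    (v : Valuation K ℤᵐ⁰) (c : F) (hc : c ≠ 0) :
    v (algebraMap F K c) = 1 := by
  have := Fintype.ofFinite F
  have h1 := congrArg (fun x => v (algebraMap F K x)) (FiniteField.pow_card_sub_one_eq_one c hc)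
  simp only [map_pow, map_one] at h1
  exact (pow_eq_one_iff.1 h1).resolve_right (Nat.sub_ne_zero_of_lt Fintype.one_lt_card)

open Polynomial in
theorem Place.val_aeval {F : Type*} [Field F] [Finite F] [Algebra F K] (v : Valuation K ℤᵐ⁰) {y : K}
    (hy : v y < 1) (p : F[X]) (hp : p ≠ 0) : v (aeval y p) = v y ^ p.natTrailingDegree := by
  have hint (q : F[X]) : v (aeval y q) ≤ 1 := by
    rw [aeval_eq_sum_range]
    refine v.map_sum_le fun i _ => ?_
    rw [Algebra.smul_def, map_mul, map_pow]
    refine mul_le_one' ?_ (pow_le_one' hy.le _)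
    rcases eq_or_ne (q.coeff i) 0 with h | h
    · simp [h]
    · exact (Place.val_constant v _ h).le
  obtain ⟨q, hq⟩ := X_pow_dvd_iff.2 fun d hd => coeff_eq_zero_of_lt_natTrailingDegree (p := p) hd
  have hq0 : q.coeff 0 ≠ 0 := by
    have h1 : p.coeff (0 + p.natTrailingDegree) = q.coeff 0 := by
      conv_lhs => rw [congrArg (fun r => r.coeff (0 + p.natTrailingDegree)) hq]
      rw [mul_comm, coeff_mul_X_pow]
    rw [← h1, zero_add]
    exact trailingCoeff_nonzero_iff_nonzero.2 hp
  have hq1 : v (aeval y q) = 1 := by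
    rw [← divX_mul_X_add q]
    simp only [map_add, map_mul, aeval_X, aeval_C]
    rw [Valuation.map_add_eq_of_lt_right, Place.val_constant v _ hq0]
    rw [Place.val_constant v _ hq0, map_mul]
    exact (mul_le_of_le_one_left' (hint _)).trans_lt hy
  rw [congrArg (aeval y) hq, map_mul, map_mul, hq1, mul_one, map_pow, aeval_X, map_pow]

open Polynomial in
theorem Place.finiteDimensional_adjoin {F : Type*} [Field F] [Algebra F⟮X⟯ K] [FunctionField F K]
    [Algebra F K] [IsScalarTower F F⟮X⟯ K] (y : K) (hy : Transcendental F y) :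
    FiniteDimensional (IntermediateField.adjoin F {y}) K := by
  have htr : Algebra.trdeg F K = 1 := by
    have := IsLocalization.isAlgebraic F⟮X⟯ (nonZeroDivisors F[X])
    have h1 := lift_trdeg_add_eq F F⟮X⟯ K
    have h2 := trdeg_add_eq F F[X] (A := F⟮X⟯)
    rw [Polynomial.trdeg_of_isDomain, trdeg_eq_zero (R := F[X]) (A := F⟮X⟯), add_zero] at h2
    rw [← h2, trdeg_eq_zero (R := F⟮X⟯) (A := K)] at h1
    simpa using h1.symm
  have hind : AlgebraicIndependent F (fun _ : Unit => y) :=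
    (algebraicIndependent_unique_type_iff (x := fun _ : Unit => y)).2 hy
  have hb := hind.isTranscendenceBasis_of_lift_trdeg_le_of_finite (by rw [htr]; simp)
  have halg := hb.isAlgebraic_field
  rw [Set.range_const] at halg
  have : Algebra.EssFiniteType F F⟮X⟯ :=
    have := Algebra.EssFiniteType.of_isLocalization F⟮X⟯ (nonZeroDivisors F[X])
    Algebra.EssFiniteType.comp F F[X] F⟮X⟯
  have : Algebra.EssFiniteType F K := Algebra.EssFiniteType.comp F F⟮X⟯ K
  have : Algebra.EssFiniteType (IntermediateField.adjoin F {y}) K :=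
    Algebra.EssFiniteType.of_comp F _ K
  exact Algebra.finite_of_essFiniteType_of_isAlgebraic

open Polynomial IntermediateField.algebraAdjoinAdjoin in
theorem Place.finite_zeros [IsGlobalFunctionField K] (y : K) (hy0 : y ≠ 0) :
    {v : Place K | v.val y < 1}.Finite := by
  classical
  obtain ⟨F, _, _, _, hFK⟩ := IsGlobalFunctionField.exists_functionField (K := K)
  let : Algebra F K := Algebra.compHom K (algebraMap F F⟮X⟯)
  have : IsScalarTower F F⟮X⟯ K := IsScalarTower.of_algebraMap_eq fun _ => rfl
  by_cases hy : Transcendental F y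
  · have := Place.finiteDimensional_adjoin y hy
    by_contra hinf
    obtain ⟨s, hs, hcard⟩ := (Set.not_finite.1 hinf).exists_subset_card_eq
      (Module.finrank (IntermediateField.adjoin F {y}) K + 1)
    choose a ha1 ha2 using Place.exists_one_lt_lt_one (fun v : s => (v : Place K))
      Subtype.val_injective
    have hx1 (v : s) : (v : Place K).val (a v / (1 + a v)) = 1 := by
      rw [map_div₀, Valuation.map_add_eq_of_lt_right, div_self]
      · exact (zero_lt_one.trans (ha1 v)).ne'
      · simpa using ha1 v
    have hx2 (v w : s) (h : w ≠ v) : (w : Place K).val (a v / (1 + a v)) < 1 := by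
      rw [map_div₀, Valuation.map_add_eq_of_lt_left, map_one, div_one]
      · exact ha2 v w h
      · simpa using ha2 v w h
    have hli : LinearIndependent (Algebra.adjoin F {y}) (fun v : s => a v / (1 + a v)) := by
      rw [Fintype.linearIndependent_iff]
      intro g hg
      have hg' (v : s) : ∃ p : F[X], aeval y p = (g v : K) := by
        have h := (g v).2
        exact (Algebra.adjoin_singleton_eq_range_aeval F y).le h
      choose p hp using hg'
      by_contra! hne
      obtain ⟨v₀, hv₀⟩ := hne
      have hpne (v : s) : g v ≠ 0 ↔ p v ≠ 0 := by
        rw [not_iff_not, ← (injective_iff_map_eq_zero' (aeval (R := F) y)).1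
          (transcendental_iff_injective.1 hy) (p v), hp]
        simp
      obtain ⟨v, hv, hmin⟩ := Finset.exists_min_image (Finset.univ.filter fun v : s => p v ≠ 0)
        (fun v => (p v).natTrailingDegree) ⟨v₀, by simpa [hpne] using hv₀⟩
      have hv' : p v ≠ 0 := by simpa using hv
      have hvy : (v : Place K).val y < 1 := hs v.2
      have hvy0 : 0 < (v : Place K).val y := by simpa [zero_lt_iff] using hy0
      rw [← Finset.add_sum_erase _ _ (Finset.mem_univ v), add_eq_zero_iff_eq_neg] at hg
      have h1 := congrArg (v : Place K).val hg
      have h2 : (v : Place K).val (g v • (a v / (1 + a v))) =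
          (v : Place K).val y ^ (p v).natTrailingDegree := by
        rw [Algebra.smul_def, map_mul, hx1, mul_one, ← Place.val_aeval _ hvy _ hv', hp]
        rfl
      rw [h2, Valuation.map_neg] at h1
      refine absurd h1 (ne_of_gt ?_)
      refine Valuation.map_sum_lt _ (pow_pos hvy0 _).ne' fun w hw => ?_
      rw [Algebra.smul_def, map_mul]
      rcases eq_or_ne (g w) 0 with h0 | h0
      · rw [h0, map_zero, map_zero, zero_mul]
        exact pow_pos hvy0 _
      · have h3 : (v : Place K).val (algebraMap (Algebra.adjoin F {y}) K (g w)) =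
            (v : Place K).val y ^ (p w).natTrailingDegree := by
          rw [← Place.val_aeval _ hvy _ ((hpne w).1 h0), hp]
          rfl
        rw [h3]
        refine (mul_lt_of_lt_one_right (pow_pos hvy0 _)
          (hx2 w v (Finset.ne_of_mem_erase hw).symm)).trans_le ?_
        exact pow_le_pow_right_of_le_one' hvy.le (hmin w (by simpa using (hpne w).1 h0))
    have hli' := (LinearIndependent.iff_fractionRing (Algebra.adjoin F {y})
      (IntermediateField.adjoin F {y})).1 hli
    have := hli'.fintype_card_le_finrank
    simp [hcard] at this
  · have halg : IsAlgebraic F y := not_not.1 hy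
    refine Set.Finite.subset Set.finite_empty fun v hv => ?_
    obtain ⟨p, hp, hpy⟩ := halg
    have := Place.val_aeval v.val hv p hp
    rw [hpy, map_zero] at this
    exact hy0 ((map_eq_zero v.val).1 (eq_zero_of_pow_eq_zero this.symm))

end poles

section adeles
variable {K : Type*} [Field K] (P : Place K)

/-- The ring `A ⊂ K` of functions that are regular outside the place `P = ∞`. -/
def Place.regularRing : Subring K where
  carrier := {x | ∀ v : Place K, v ≠ P → v.val x ≤ 1}
  mul_mem' hx hy v hv := by
    rw [map_mul]
    exact mul_le_one' (hx v hv) (hy v hv)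
  one_mem' _ _ := by simp
  add_mem' hx hy v hv := (v.val.map_add _ _).trans (max_le (hx v hv) (hy v hv))
  zero_mem' _ _ := by simp
  neg_mem' hx v hv := by
    rw [Valuation.map_neg]
    exact hx v hv

/-- The ring `𝔸_{K,f}` of finite adeles: the restricted product of the `K_v`, `v ≠ ∞`, with respect
to the `A_v`. -/
def Place.FiniteAdele : Type _ :=
  Πʳ v : {v : Place K // v ≠ P}, [v.1.completion, v.1.integers]

instance : CommRing P.FiniteAdele := inferInstanceAs <|
  CommRing <| Πʳ v : {v : Place K // v ≠ P}, [v.1.completion, v.1.integers]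

instance : DFunLike P.FiniteAdele {v : Place K // v ≠ P} (fun v => v.1.completion) where
  coe a := a.1
  coe_injective _ _ := Subtype.ext

/-- The ring `R = ∏_{v ≠ ∞} A_v` of finite integral adeles, as a subring of `𝔸_{K,f}`. -/
def Place.integralAdeles : Subring P.FiniteAdele where
  carrier := {a | ∀ v, a v ∈ v.1.integers}
  mul_mem' ha hb v := mul_mem (ha v) (hb v)
  one_mem' v := one_mem _
  add_mem' ha hb v := add_mem (ha v) (hb v)
  zero_mem' v := zero_mem _
  neg_mem' ha v := neg_mem (ha v)

/-- The diagonal embedding `K → 𝔸_{K,f}`. -/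
def Place.diagonal [IsGlobalFunctionField K] : K →+* P.FiniteAdele where
  toFun x := ⟨fun v => algebraMap K v.1.completion x, by
    rcases eq_or_ne x 0 with rfl | hx
    · simp
    · rw [Filter.eventually_cofinite]
      refine ((Place.finite_zeros x⁻¹ (inv_ne_zero hx)).preimage
        Subtype.val_injective.injOn).subset fun v hv => ?_
      have h : ¬ Valued.v (algebraMap K v.1.completion x) ≤ 1 := hv
      rw [Place.valued_algebraMap, not_le] at h
      have : v.1.val x⁻¹ < 1 := by
        rw [map_inv₀]
        exact inv_lt_one_of_one_lt₀ h
      exact this⟩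
  map_one' := DFunLike.ext _ _ fun v => map_one (algebraMap K v.1.completion)
  map_mul' x y := DFunLike.ext _ _ fun v => map_mul (algebraMap K v.1.completion) x y
  map_zero' := DFunLike.ext _ _ fun v => map_zero (algebraMap K v.1.completion)
  map_add' x y := DFunLike.ext _ _ fun v => map_add (algebraMap K v.1.completion) x y

instance [IsGlobalFunctionField K] : Algebra K P.FiniteAdele := P.diagonal.toAlgebra

variable {P} in
theorem Place.algebraMap_mem_integralAdeles [IsGlobalFunctionField K] (a : P.regularRing) :
    algebraMap K P.FiniteAdele a ∈ P.integralAdeles := by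
  intro v
  change Valued.v (algebraMap K v.1.completion a) ≤ 1
  rw [Place.valued_algebraMap]
  exact a.2 v.1 v.2

end adeles

section CInfty
/-! ### The field `C_∞` -/

variable {K : Type*} [Field K] (P : Place K)

/-- The algebraic closure of `K_∞`, with the unique extension of the absolute value of `K_∞`. -/
instance : NormedField (AlgebraicClosure P.completion) := spectralNorm.normedField P.completion _
instance : NormedAlgebra P.completion (AlgebraicClosure P.completion) :=
  spectralNorm.normedAlgebra _ _
instance : UniformContinuousConstSMul P.completion (AlgebraicClosure P.completion) :=
  uniformContinuousConstSMul_of_continuousConstSMul _ _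

/-- `C_∞`: the completion of the algebraic closure of `K_∞` for the extension of the absolute
value. -/
def Place.CInfty : Type _ := UniformSpace.Completion (AlgebraicClosure P.completion)
instance : NormedField P.CInfty :=
  inferInstanceAs (NormedField (UniformSpace.Completion (AlgebraicClosure P.completion)))
instance : CompleteSpace P.CInfty :=
  inferInstanceAs (CompleteSpace (UniformSpace.Completion (AlgebraicClosure P.completion)))
instance : NormedAlgebra P.completion P.CInfty :=
  inferInstanceAs
    (NormedAlgebra P.completion (UniformSpace.Completion (AlgebraicClosure P.completion)))
instance : Algebra K P.CInfty := Algebra.compHom _ (algebraMap K P.completion)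
instance : IsScalarTower K P.completion P.CInfty :=
  IsScalarTower.of_algebraMap_eq (R := K) (S := P.completion) (A := P.CInfty) fun _ => rfl
end CInfty

section lattices
/-! ### Lattices with torsion data -/

open scoped TensorProduct Matrix MatrixGroups

variable {K : Type*} [Field K] (P : Place K)

/-- The `A`-module `K/A`. -/
abbrev Place.KModA : Type _ := K ⧸ LinearMap.range (Algebra.linearMap P.regularRing K)

section generic
variable {V V' V'' : Type*} [AddCommGroup V] [Module K V] [AddCommGroup V'] [Module K V']
  [AddCommGroup V''] [Module K V'']

variable {P}

/-- `KΛ`, the `K`-span of an `A`-submodule `Λ` of a `K`-vector space. -/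
def ratSpan (Λ : Submodule P.regularRing V) : Submodule P.regularRing V :=
  (Submodule.span K (Λ : Set V)).restrictScalars P.regularRing

/-- `KΛ/Λ`. -/
abbrev RatQuotient (Λ : Submodule P.regularRing V) : Type _ :=
  ratSpan Λ ⧸ Λ.submoduleOf (ratSpan Λ)

/-- The map `KΛ/Λ → KΛ'/Λ'` induced by a `K`-linear map `f` with `f(Λ) ⊆ Λ'`. -/
def ratQuotientMap {Λ : Submodule P.regularRing V} {Λ' : Submodule P.regularRing V'}
    (f : V →ₗ[K] V') (h : Λ.map (f.restrictScalars P.regularRing) ≤ Λ') :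
    RatQuotient Λ →ₗ[P.regularRing] RatQuotient Λ' :=
  Submodule.mapQ _ _
    ((f.restrictScalars P.regularRing).restrict (p := ratSpan Λ) (q := ratSpan Λ') (by
      intro x hx
      have h1 : Submodule.span K (Λ : Set V) ≤ (Submodule.span K (Λ' : Set V')).comap f :=
        Submodule.span_le.2 fun y hy =>
          Submodule.subset_span (h (Submodule.mem_map_of_mem hy))
      exact h1 hx))
    (fun x hx => h (Submodule.mem_map_of_mem hx))

variable (P) in
/-- A pair of an `A`-submodule `Λ` of a `K`-vector space `V` and a homomorphism of `A`-modules
`φ : (K/A)ⁿ → KΛ/Λ`. -/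
structure RatPair (n : ℕ) (V : Type*) [AddCommGroup V] [Module K V] where
  Λ : Submodule P.regularRing V
  φ : (Fin n → P.KModA) →ₗ[P.regularRing] RatQuotient Λ

/-- The `K`-linear map `f` carries `(Λ, φ)` to `(Λ', φ')`: `Λ' = f(Λ)` and `φ' = f ∘ φ`. -/
def RatPair.MapsTo {n : ℕ} (f : V →ₗ[K] V') (L : RatPair P n V) (L' : RatPair P n V') : Prop :=
  ∃ h : L.Λ.map (f.restrictScalars P.regularRing) = L'.Λ,
    L'.φ = (ratQuotientMap f h.le).comp L.φ

theorem ratQuotientMap_mk {Λ : Submodule P.regularRing V} {Λ' : Submodule P.regularRing V'}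
    (f : V →ₗ[K] V') (h : Λ.map (f.restrictScalars P.regularRing) ≤ Λ') (y : ratSpan Λ)
    (y' : ratSpan Λ') (hy : (y' : V') = f y) :
    ratQuotientMap f h (Submodule.Quotient.mk y) = Submodule.Quotient.mk y' := by
  refine congrArg _ (Subtype.ext ?_)
  exact hy.symm

theorem RatPair.MapsTo.id {n : ℕ} (L : RatPair P n V) : MapsTo LinearMap.id L L := by
  have h : L.Λ.map ((LinearMap.id : V →ₗ[K] V).restrictScalars P.regularRing) = L.Λ :=
    Submodule.map_id _
  refine ⟨h, LinearMap.ext fun x => ?_⟩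
  obtain ⟨y, hy⟩ := Submodule.Quotient.mk_surjective _ (L.φ x)
  rw [LinearMap.comp_apply, ← hy, ratQuotientMap_mk _ _ y y rfl]

theorem RatPair.MapsTo.comp {n : ℕ} {f : V →ₗ[K] V'} {f' : V' →ₗ[K] V''}
    {L : RatPair P n V} {L' : RatPair P n V'} {L'' : RatPair P n V''}
    (h' : MapsTo f' L' L'') (h : MapsTo f L L') : MapsTo (f'.comp f) L L'' := by
  obtain ⟨h1, h2⟩ := h
  obtain ⟨h1', h2'⟩ := h'
  have h3 : L.Λ.map ((f'.comp f).restrictScalars P.regularRing) = L''.Λ := by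
    rw [← h1', ← h1, ← Submodule.map_comp]
    rfl
  refine ⟨h3, LinearMap.ext fun x => ?_⟩
  rw [h2', h2]
  obtain ⟨y, hy⟩ := Submodule.Quotient.mk_surjective _ (L.φ x)
  simp only [LinearMap.comp_apply]
  rw [← hy]
  rfl

theorem RatPair.MapsTo.symm {n : ℕ} {e : V ≃ₗ[K] V'} {L : RatPair P n V} {L' : RatPair P n V'}
    (h : MapsTo (e : V →ₗ[K] V') L L') : MapsTo (e.symm : V' →ₗ[K] V) L' L := by
  obtain ⟨h1, h2⟩ := h
  have h3 : L'.Λ.map ((e.symm : V' →ₗ[K] V).restrictScalars P.regularRing) = L.Λ := by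
    rw [← h1, ← Submodule.map_comp]
    convert Submodule.map_id L.Λ
    ext x
    exact e.symm_apply_apply x
  refine ⟨h3, LinearMap.ext fun x => ?_⟩
  rw [h2]
  obtain ⟨y, hy⟩ := Submodule.Quotient.mk_surjective _ (L.φ x)
  simp only [LinearMap.comp_apply]
  rw [← hy]
  refine congrArg _ (Subtype.ext ?_)
  exact (e.symm_apply_apply (y : V)).symm

end generic

/-- An `n`-dimensional `K`-rational lattice: a lattice of rank `n`, i.e. a finitely generated
`A`-submodule `Λ` of `Kⁿ` with `Λ ⊗_A K_∞ ≃ K_∞ⁿ`, together with a homomorphism of `A`-modules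
`φ : (K/A)ⁿ → KΛ/Λ`. -/
structure KRationalLattice (n : ℕ) extends RatPair P n (Fin n → K) where
  fg : Λ.FG
  rank : Nonempty ((P.completion ⊗[P.regularRing] Λ) ≃ₗ[P.completion] (Fin n → P.completion))

/-- An `n`-dimensional `K`-rational `C_∞`-lattice: a finitely generated discrete `A`-submodule `Λ`
of `C_∞` of rank `n`, i.e. with `K_∞Λ` of dimension `n` over `K_∞`, together with a homomorphism of
`A`-modules `φ : (K/A)ⁿ → KΛ/Λ`. (For lattices over a smaller complete field `L` one also asks that
`Λ` lies in the separable closure of `L` and is Galois stable; for `L = C_∞` this is void.) -/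
structure KRationalCLattice (n : ℕ) extends RatPair P n P.CInfty where
  fg : Λ.FG
  discrete : DiscreteTopology Λ
  rank : Module.finrank P.completion (Submodule.span P.completion (Λ : Set P.CInfty)) = n

variable {P} {n : ℕ}

/-- Two `K`-rational lattices are isomorphic if an element of `GL_n(K)` carries one to the other. -/
instance KRationalLattice.isoSetoid : Setoid (KRationalLattice P n) where
  r L L' := ∃ e : (Fin n → K) ≃ₗ[K] (Fin n → K),
    RatPair.MapsTo (e : (Fin n → K) →ₗ[K] (Fin n → K)) L.toRatPair L'.toRatPair
  iseqv :=
    { refl := fun _ => ⟨LinearEquiv.refl K _, RatPair.MapsTo.id _⟩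
      symm := fun ⟨e, h⟩ => ⟨e.symm, h.symm⟩
      trans := fun ⟨e, h⟩ ⟨e', h'⟩ => ⟨e.trans e', h'.comp h⟩ }

theorem CInfty.mulLeft_comp (a b : P.CInfty) :
    (LinearMap.mulLeft K a).comp (LinearMap.mulLeft K b) = LinearMap.mulLeft K (a * b) := by
  ext x
  simp [mul_assoc]

/-- Two `K`-rational `C_∞`-lattices are isomorphic if multiplication by some `c ∈ C_∞^*` carries one
to the other. -/
instance KRationalCLattice.isoSetoid : Setoid (KRationalCLattice P n) where
  r L L' := ∃ c : P.CInftyˣ,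
    RatPair.MapsTo (LinearMap.mulLeft K (c : P.CInfty)) L.toRatPair L'.toRatPair
  iseqv :=
    { refl := fun L => ⟨1, by simpa using! RatPair.MapsTo.id L.toRatPair⟩
      symm := fun {L L'} ⟨c, h⟩ => ⟨c⁻¹, RatPair.MapsTo.symm
        (e := LinearEquiv.ofLinearMap (LinearMap.mulLeft K (c : P.CInfty))
          (LinearMap.mulLeft K ((c⁻¹ : P.CInftyˣ) : P.CInfty))
          (by rw [CInfty.mulLeft_comp]; simp) (by rw [CInfty.mulLeft_comp]; simp)) h⟩
      trans := fun ⟨c, h⟩ ⟨c', h'⟩ => ⟨c' * c, by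
        have := h'.comp h
        rwa [CInfty.mulLeft_comp] at this⟩ }

variable (P n) in
/-- The set of isomorphism classes of `n`-dimensional `K`-rational lattices. -/
abbrev KRationalLatticeClasses : Type _ := Quotient (KRationalLattice.isoSetoid (P := P) (n := n))
variable (P n) in
/-- The set of isomorphism classes of `n`-dimensional `K`-rational `C_∞`-lattices. -/
abbrev KRationalCLatticeClasses : Type _ :=
  Quotient (KRationalCLattice.isoSetoid (P := P) (n := n))

variable (P n) in
/-- The set of `ω ∈ C_∞ⁿ` whose coordinates are linearly independent over `K_∞`. -/
def OmegaTilde : Type _ := {ω : Fin n → P.CInfty // LinearIndependent P.completion ω}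

/-- Scaling by `C_∞^*`. -/
instance OmegaTilde.scaleSetoid : Setoid (OmegaTilde P n) where
  r ω ω' := ∃ c : P.CInftyˣ, ω'.1 = fun i => c * ω.1 i
  iseqv :=
    { refl := fun _ => ⟨1, by simp⟩
      symm := fun ⟨c, h⟩ => ⟨c⁻¹, by simp [h]⟩
      trans := fun ⟨c, h⟩ ⟨c', h'⟩ => ⟨c' * c, by simp [h, h', mul_assoc]⟩ }

variable (P n) in
/-- `Ωⁿ`, the quotient of `OmegaTilde` by `C_∞^*`. -/
abbrev Omega : Type _ := Quotient (OmegaTilde.scaleSetoid (P := P) (n := n))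

/-- The restriction to `Kⁿ` of the `K_∞`-monomorphism `ι_ω : K_∞ⁿ → C_∞`, `x ↦ ∑ i, x_i ω_i`. -/
def OmegaTilde.iota (ω : OmegaTilde P n) : (Fin n → K) →ₗ[K] P.CInfty :=
  Fintype.linearCombination K ω.1

theorem OmegaTilde.smul_aux (γ : GL (Fin n) K) (ω : OmegaTilde P n) :
    LinearIndependent P.completion fun i => ∑ j, (γ : Matrix (Fin n) (Fin n) K) i j • ω.1 j := by
  rw [Fintype.linearIndependent_iff]
  intro c hc
  let γ' : GL (Fin n) P.completion := Matrix.GeneralLinearGroup.map (algebraMap K P.completion) γ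
  have h1 : c ᵥ* (γ' : Matrix (Fin n) (Fin n) P.completion) = 0 := by
    funext j
    refine Fintype.linearIndependent_iff.1 ω.2 _ ?_ j
    rw [← hc]
    simp only [Finset.smul_sum, Matrix.vecMul, dotProduct, Finset.sum_smul]
    rw [Finset.sum_comm]
    refine Finset.sum_congr rfl fun i _ => Finset.sum_congr rfl fun k _ => ?_
    change (c i * algebraMap K P.completion (γ.1 i k)) • _ = _
    rw [mul_smul, algebraMap_smul]
  have h2 : c = 0 := by
    have := congrArg (fun d => d ᵥ* ((γ'⁻¹).val : Matrix (Fin n) (Fin n) P.completion)) h1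
    simpa [Matrix.vecMul_vecMul, ← Units.val_mul] using this
  exact fun i => congrFun h2 i

/-- `GL_n(K)` acts by matrix multiplication on column vectors `ω`. -/
instance : MulAction (GL (Fin n) K) (OmegaTilde P n) where
  smul γ ω := ⟨_, OmegaTilde.smul_aux γ ω⟩
  one_smul ω := Subtype.ext <| funext fun i => by
    change ∑ j, ((1 : GL (Fin n) K) : Matrix (Fin n) (Fin n) K) i j • ω.1 j = ω.1 i
    simp [Matrix.one_apply]
  mul_smul γ γ' ω := Subtype.ext <| funext fun i => by
    change ∑ j, ((γ * γ' : GL (Fin n) K) : Matrix (Fin n) (Fin n) K) i j • ω.1 j =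
      ∑ k, γ.1 i k • ∑ j, γ'.1 k j • ω.1 j
    simp only [Units.val_mul, Matrix.mul_apply, Finset.sum_smul, Finset.smul_sum, mul_smul]
    exact Finset.sum_comm

theorem OmegaTilde.smul_apply (γ : GL (Fin n) K) (ω : OmegaTilde P n) (i : Fin n) :
    (γ • ω).1 i = ∑ j, (γ : Matrix (Fin n) (Fin n) K) i j • ω.1 j := rfl

/-- The induced action of `GL_n(K)` on `Ωⁿ`. -/
instance : MulAction (GL (Fin n) K) (Omega P n) where
  smul γ := Quotient.map (fun ω => γ • ω) fun ω ω' ⟨c, h⟩ => ⟨c, funext fun i => by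
    simp only [OmegaTilde.smul_apply, h, Finset.mul_sum, mul_smul_comm]⟩
  one_smul z := Quotient.inductionOn z fun ω => congrArg _ (one_smul _ ω)
  mul_smul γ γ' z := Quotient.inductionOn z fun ω => congrArg _ (mul_smul γ γ' ω)

variable [IsGlobalFunctionField K]

/-- The diagonal embedding `Kⁿ → 𝔸_{K,f}ⁿ`. -/
def Place.embVec (P : Place K) (x : Fin n → K) : Fin n → P.FiniteAdele :=
  fun i => algebraMap K P.FiniteAdele (x i)

/-- `Rⁿ g⁻¹ ⊂ 𝔸_{K,f}ⁿ`; matrices act from the right on row vectors. -/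
def adelicLattice (g : GL (Fin n) P.FiniteAdele) :
    Submodule P.integralAdeles (Fin n → P.FiniteAdele) where
  carrier := {y | ∃ r : Fin n → P.integralAdeles,
    y = (fun i => (r i : P.FiniteAdele)) ᵥ* (g⁻¹ : GL (Fin n) P.FiniteAdele).val}
  add_mem' := by
    rintro _ _ ⟨r, rfl⟩ ⟨s, rfl⟩
    exact ⟨r + s, (Matrix.add_vecMul _ _ _).symm⟩
  zero_mem' := ⟨0, (Matrix.zero_vecMul _).symm⟩
  smul_mem' := by
    rintro a _ ⟨r, rfl⟩
    exact ⟨fun i => a * r i,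
      (Matrix.smul_vecMul (a : P.FiniteAdele) (fun i => (r i : P.FiniteAdele)) _).symm⟩

/-- `Λ(g) = Rⁿ g⁻¹ ∩ Kⁿ`. -/
def latticeOf (g : GL (Fin n) P.FiniteAdele) : Submodule P.regularRing (Fin n → K) where
  carrier := {x | P.embVec x ∈ adelicLattice g}
  add_mem' {x y} hx hy := by
    have : P.embVec (x + y) = P.embVec x + P.embVec y := funext fun i => map_add _ _ _
    rw [Set.mem_ofPred_eq, this]
    exact add_mem hx hy
  zero_mem' := by
    have : P.embVec (0 : Fin n → K) = 0 := funext fun i => map_zero _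
    rw [Set.mem_ofPred_eq, this]
    exact zero_mem _
  smul_mem' a x hx := by
    have : P.embVec (a • x) =
        (⟨algebraMap K P.FiniteAdele a, Place.algebraMap_mem_integralAdeles a⟩ : P.integralAdeles) • P.embVec x :=
      funext fun i => map_mul (algebraMap K P.FiniteAdele) (a : K) (x i)
    rw [Set.mem_ofPred_eq, this]
    exact Submodule.smul_mem _ _ hx

/-- `(Λ, φ) = (Rⁿ g⁻¹ ∩ Kⁿ, ρ g⁻¹)`. Here `φ = ρ g⁻¹` means that `φ` is induced by right
multiplication by `ρ g⁻¹` through the maps `(K/A)ⁿ → (𝔸_{K,f}/R)ⁿ` and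
`Kⁿ/Λ → 𝔸_{K,f}ⁿ/Rⁿ g⁻¹`: for `x ∈ Kⁿ` and `y ∈ KΛ`, the class of `x` is sent to the class of `y`
exactly if `x ρ g⁻¹` and `y` agree modulo `Rⁿ g⁻¹`. Since every element of `KΛ/Λ` is the class of
some `y`, there is at most one such pair for given `g` and `ρ`. -/
def RatPair.IsAttachedTo (L : RatPair P n (Fin n → K)) (g : GL (Fin n) P.FiniteAdele)
    (ρ : Matrix (Fin n) (Fin n) P.integralAdeles) : Prop :=
  L.Λ = latticeOf g ∧
    ∀ (x : Fin n → K) (y : ratSpan L.Λ),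
      L.φ (fun i => Submodule.Quotient.mk (x i)) = Submodule.Quotient.mk y ↔
        P.embVec x ᵥ* (ρ.map P.integralAdeles.subtype * (g⁻¹ : GL (Fin n) P.FiniteAdele).val) -
          P.embVec y ∈ adelicLattice g

variable (P n) in
/-- `(g, ρ) ∼ (γ g m, ρ m)` for `γ ∈ GL_n(K)` and `m ∈ GL_n(R)`. -/
def adelicSetoid :
    Setoid (GL (Fin n) P.FiniteAdele × Matrix (Fin n) (Fin n) P.integralAdeles) where
  r p q := ∃ (γ : GL (Fin n) K) (m : GL (Fin n) P.integralAdeles),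
    q.1 = Matrix.GeneralLinearGroup.map (algebraMap K P.FiniteAdele) γ * p.1 *
      Matrix.GeneralLinearGroup.map P.integralAdeles.subtype m ∧
    q.2 = p.2 * m.val
  iseqv :=
    { refl := fun p => ⟨1, 1, by simp, by simp⟩
      symm := fun {p q} ⟨γ, m, h1, h2⟩ => ⟨γ⁻¹, m⁻¹, by rw [h1]; simp [mul_assoc],
        by rw [h2, mul_assoc, ← Units.val_mul]; simp⟩
      trans := fun {p q r} ⟨γ, m, h1, h2⟩ ⟨γ', m', h1', h2'⟩ => ⟨γ' * γ, m * m',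
        by rw [h1', h1]; simp [mul_assoc], by rw [h2', h2]; simp [mul_assoc]⟩ }

variable (P n) in
/-- `GL_n(K) \ GL_n(𝔸_{K,f}) ×_{GL_n(R)} M_n(R)`. -/
abbrev AdelicClasses : Type _ := Quotient (adelicSetoid P n)

variable (P n) in
/-- `(g, z, ρ) ∼ (γ g m, γ z, ρ m)` for `γ ∈ GL_n(K)` and `m ∈ GL_n(R)`. -/
def adelicOmegaSetoid :
    Setoid (GL (Fin n) P.FiniteAdele × Omega P n × Matrix (Fin n) (Fin n) P.integralAdeles) where
  r p q := ∃ (γ : GL (Fin n) K) (m : GL (Fin n) P.integralAdeles),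
    q.1 = Matrix.GeneralLinearGroup.map (algebraMap K P.FiniteAdele) γ * p.1 *
      Matrix.GeneralLinearGroup.map P.integralAdeles.subtype m ∧
    q.2.1 = γ • p.2.1 ∧
    q.2.2 = p.2.2 * m.val
  iseqv :=
    { refl := fun p => ⟨1, 1, by simp, by simp, by simp⟩
      symm := fun {p q} ⟨γ, m, h1, h3, h2⟩ => ⟨γ⁻¹, m⁻¹, by rw [h1]; simp [mul_assoc],
        by rw [h3, inv_smul_smul], by rw [h2, mul_assoc, ← Units.val_mul]; simp⟩
      trans := fun {p q r} ⟨γ, m, h1, h3, h2⟩ ⟨γ', m', h1', h3', h2'⟩ => ⟨γ' * γ, m * m',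
        by rw [h1', h1]; simp [mul_assoc], by rw [h3', h3, mul_smul],
        by rw [h2', h2]; simp [mul_assoc]⟩ }

variable (P n) in
/-- `GL_n(K) \ GL_n(𝔸_{K,f}) × Ωⁿ ×_{GL_n(R)} M_n(R)`. -/
abbrev AdelicOmegaClasses : Type _ := Quotient (adelicOmegaSetoid P n)

end lattices

end

/-! A lattice `Λ ⊂ Kⁿ` is determined by its completions. Each completion is free over the discrete
valuation ring `A_v`, and almost all of them are standard, so together they form `Rⁿ g⁻¹` with `g ∈
GL_n(𝔸_f)`, unique up to right multiplication by `GL_n(R)` (`exists_latticeOf_eq`,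
`exists_eq_mul_map_of_latticeOf_eq`). Strong approximation `𝔸_f = K + R` and `K ∩ R = A` give `K/A =
𝔸_f/R` and `Kⁿ/Λ = 𝔸_fⁿ/Rⁿ g⁻¹`. Since `Hom_A(K/A, 𝔸_f/R) = R` (`exists_multiplier`), the
homomorphisms `φ` are exactly the right multiplications by `ρ g⁻¹`, with a unique `ρ ∈ M_n(R)`. So
`GL_n(𝔸_f) ×_{GL_n(R)} M_n(R)` parametrizes the pairs themselves, and because `Rⁿ (γ g)⁻¹ = Rⁿ g⁻¹
γ⁻¹`, the isomorphism `x ↦ x γ⁻¹` corresponds to `g ↦ γ g`.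

For `C_∞`-lattices, discreteness forces a `K`-basis of `KΛ` to stay independent over `K_∞`
(`linearIndependent_completion`). Hence `Λ = ι_ω(Λ₀)` for a lattice `Λ₀ ⊂ Kⁿ`, where `ω` is unique
up to `GL_n(K)`, and homotheties of `Λ` are scalings of `ω`. Conversely `ι_ω(Λ₀)` is discrete
because a nonzero element of `A` has absolute value at least `1` at `∞`.

The arithmetic of `K` rests on the finite extensions `K/F(y)`, `y` transcendental over a finite
constant field `F`. As `K` is spanned over `F(y)` by elements integral over `F[y]`, division with
remainder, partial fractions and pigeonhole arguments over finite residue fields can replace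
Riemann-Roch. Chevalley's extension theorem shows that every transcendental element has a zero, so
that an element of `A` vanishing at `∞` is `0`. -/

noncomputable section
open scoped WithZero NNReal RatFunc RestrictedProduct
open scoped TensorProduct Matrix MatrixGroups

namespace Place
-- Valuations of polynomial expressions in one element
section transcendental
open Polynomial
variable {K : Type*} [Field K] {F : Type*} [Field F] [Finite F] [Algebra F K]

theorem val_algebraMap_le_one (v : Valuation K ℤᵐ⁰) (c : F) : v (algebraMap F K c) ≤ 1 := by
  rcases eq_or_ne c 0 with rfl | h
  · simp
  · exact (val_constant v c h).le

theorem val_aeval_le_one (v : Valuation K ℤᵐ⁰) {x : K} (hx : v x ≤ 1) (p : F[X]) :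
    v (aeval x p) ≤ 1 := by
  rw [aeval_eq_sum_range]
  refine v.map_sum_le fun i _ => ?_
  rw [Algebra.smul_def, map_mul, map_pow]
  exact mul_le_one' (val_algebraMap_le_one v _) (pow_le_one' hx _)

theorem transcendental_of_val_lt_one (v : Valuation K ℤᵐ⁰) {x : K} (hx0 : x ≠ 0) (hx : v x < 1) :
    Transcendental F x := by
  rintro ⟨p, hp, hpx⟩
  have := val_aeval v hx p hp
  rw [hpx, map_zero] at this
  exact hx0 ((map_eq_zero v).1 (eq_zero_of_pow_eq_zero this.symm))

theorem transcendental_of_one_lt_val (v : Valuation K ℤᵐ⁰) {x : K} (hx : 1 < v x) :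
    Transcendental F x := by
  have hx0 : x ≠ 0 := by
    rintro rfl
    simp at hx
  intro h
  refine transcendental_of_val_lt_one (F := F) v (inv_ne_zero hx0) ?_ h.inv
  rw [map_inv₀]
  exact inv_lt_one_of_one_lt₀ hx

/-- At a pole of `x` the leading term strictly dominates, as the trailing term does at a zero in
`val_aeval`. -/
theorem val_aeval_of_one_lt (v : Valuation K ℤᵐ⁰) {x : K} (hx : 1 < v x) (p : F[X]) (hp : p ≠ 0) :
    v (aeval x p) = v x ^ p.natDegree := by
  have hx0 : 0 < v x := zero_lt_one.trans hx
  rw [aeval_eq_sum_range, Finset.sum_range_succ]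
  have hlead : v (p.coeff p.natDegree • x ^ p.natDegree) = v x ^ p.natDegree := by
    have h0 : p.coeff p.natDegree ≠ 0 := leadingCoeff_ne_zero.2 hp
    rw [Algebra.smul_def, map_mul, map_pow, val_constant v _ h0, one_mul]
  rw [Valuation.map_add_eq_of_lt_right, hlead]
  rw [hlead]
  refine Valuation.map_sum_lt _ (pow_pos hx0 _).ne' fun i hi => ?_
  rw [Algebra.smul_def, map_mul, map_pow]
  refine (mul_le_of_le_one_left' (val_algebraMap_le_one v _)).trans_lt ?_
  exact pow_lt_pow_right₀ hx (Finset.mem_range.1 hi)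

theorem val_aeval_div_le_one (v : Valuation K ℤᵐ⁰) {x : K} (hx : 1 < v x) (r q : F[X])
    (h : r.degree < q.degree) : v (aeval x r / aeval x q) ≤ 1 := by
  rcases eq_or_ne r 0 with rfl | hr
  · simp
  have hq : q ≠ 0 := by
    rintro rfl
    simp at h
  rw [map_div₀, val_aeval_of_one_lt v hx r hr, val_aeval_of_one_lt v hx q hq]
  refine div_le_one_of_le₀ ?_ zero_le
  exact pow_le_pow_right₀ hx.le (natDegree_le_natDegree h.le)

/-- Over `F(x)`, the field `K` is generated by elements that are integral over `F[x]`. -/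
theorem exists_integral_generators (x : K)
    [FiniteDimensional (IntermediateField.adjoin F {x}) K] :
    ∃ s : Finset K, (∀ v : Valuation K ℤᵐ⁰, v x ≤ 1 → ∀ b ∈ s, v b ≤ 1) ∧
      ∀ z : K, ∃ (q : F[X]) (p : K → F[X]), q ≠ 0 ∧
        aeval x q * z = ∑ b ∈ s, aeval x (p b) * b := by
  classical
  open IntermediateField.algebraAdjoinAdjoin in
  obtain ⟨s, B, hB⟩ := FiniteDimensional.exists_is_basis_integral (L := K)
    (Algebra.adjoin F {x}) (IntermediateField.adjoin F {x})
  have hpoly (c : Algebra.adjoin F {x}) : ∃ p : F[X], aeval x p = (c : K) :=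
    (Algebra.adjoin_singleton_eq_range_aeval F x).le c.2
  refine ⟨Finset.univ.image B, fun v hv b hb => ?_, fun z => ?_⟩
  · obtain ⟨i, -, rfl⟩ := Finset.mem_image.1 hb
    have hle (c : Algebra.adjoin F {x}) : v (c : K) ≤ 1 := by
      obtain ⟨p, hp⟩ := hpoly c
      rw [← hp]
      exact val_aeval_le_one v hv p
    -- `F[x]` lies in the valuation ring of `v`, which is integrally closed.
    let f : Algebra.adjoin F {x} →+* v.integer :=
      (algebraMap (Algebra.adjoin F {x}) K).codRestrict v.integer hle
    have hint : IsIntegral v.integer (B i) :=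
      (hB i).map_of_comp_eq f (RingHom.id K) (by ext; rfl)
    exact (Valuation.integer.integers v).mem_of_integral hint
  · open IntermediateField.algebraAdjoinAdjoin in
    obtain ⟨d, hd⟩ := IsLocalization.exist_integer_multiples_of_finset
      (nonZeroDivisors (Algebra.adjoin F {x})) (Finset.univ.image fun i => B.repr z i)
    have hd' (i) : ∃ p : F[X], aeval x p = (d : K) * (B.repr z i : K) := by
      obtain ⟨c, hc⟩ := hd (B.repr z i) (Finset.mem_image_of_mem _ (Finset.mem_univ i))
      obtain ⟨p, hp⟩ := hpoly c
      refine ⟨p, hp.trans ?_⟩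
      have := congrArg (algebraMap (IntermediateField.adjoin F {x}) K) hc
      rw [Algebra.smul_def, map_mul] at this
      exact this
    choose p hp using hd'
    obtain ⟨q, hq⟩ := hpoly d
    -- The coefficients move from basis indices to basis vectors; the value `0` elsewhere is never
    -- used.
    refine ⟨q, Function.extend B p 0, ?_, ?_⟩
    · rintro rfl
      refine nonZeroDivisors.ne_zero d.2 (Subtype.ext ?_)
      rw [← hq, map_zero]
      rfl
    · rw [Finset.sum_image fun i _ j _ h => B.injective h]
      simp only [B.injective.extend_apply, hp, hq, mul_assoc, ← Finset.mul_sum]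
      congr 1
      conv_lhs => rw [← B.sum_repr z]
      rfl

/-- Approximation at the poles of `x` by elements that are regular elsewhere. -/
theorem exists_bounded_remainder {x : K} (hx : Transcendental F x)
    [FiniteDimensional (IntermediateField.adjoin F {x}) K] :
    ∃ s : Finset K, (∀ v : Valuation K ℤᵐ⁰, v x ≤ 1 → ∀ b ∈ s, v b ≤ 1) ∧
      ∀ a : K, ∃ p : K → F[X], ∀ v : Valuation K ℤᵐ⁰, 1 < v x →
        ∀ C, (∀ b ∈ s, v b ≤ C) → v (a - ∑ b ∈ s, aeval x (p b) * b) ≤ C := by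
  obtain ⟨s, hs, hgen⟩ := exists_integral_generators (F := F) x
  refine ⟨s, hs, fun a => ?_⟩
  obtain ⟨q, p, hq, h⟩ := hgen a
  -- Only the polynomial parts of the coefficients `p b / q` are kept. What remains has numerator of
  -- smaller degree than `q`, hence is integral at every pole of `x`.
  refine ⟨fun b => p b / q, fun v hv C hC => ?_⟩
  have hq' : aeval x q ≠ 0 := fun h0 =>
    hq ((injective_iff_map_eq_zero (aeval (R := F) x)).1 (transcendental_iff_injective.1 hx) q h0)
  have hp (b : K) : aeval x (p b) = aeval x q * aeval x (p b / q) + aeval x (p b % q) := by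
    rw [← map_mul, ← map_add, EuclideanDomain.div_add_mod]
  have : a - ∑ b ∈ s, aeval x (p b / q) * b =
      ∑ b ∈ s, aeval x (p b % q) / aeval x q * b := by
    apply mul_left_cancel₀ hq'
    rw [mul_sub, h, Finset.mul_sum, Finset.mul_sum, ← Finset.sum_sub_distrib]
    refine Finset.sum_congr rfl fun b _ => ?_
    rw [hp b]
    field_simp
    ring
  rw [this]
  refine v.map_sum_le fun b hb => ?_
  rw [map_mul]
  exact (mul_le_of_le_one_left' (val_aeval_div_le_one v hv _ _
    (EuclideanDomain.mod_lt _ hq))).trans (hC b hb)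

end transcendental

/-! ### Weak approximation -/

section weak
variable {K : Type*} [Field K]

theorem eventually_mul_pow_le (D r C : ℤᵐ⁰) (hr : r < 1) (hC : C ≠ 0) :
    ∀ᶠ m : ℕ in Filter.atTop, D * r ^ m ≤ C := by
  rcases eq_or_ne D 0 with rfl | hD
  · simp
  obtain ⟨m, hm⟩ := exists_pow_lt₀ hr (Units.mk0 (C / D) (div_ne_zero hC hD))
  filter_upwards [Filter.eventually_ge_atTop m] with k hk
  have h1 : r ^ k ≤ C / D := (pow_le_pow_right_of_le_one' hr.le hk).trans hm.le
  calc D * r ^ k ≤ D * (C / D) := by gcongr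
    _ = C := mul_div_cancel₀ _ hD

/-- Weak approximation. -/
theorem exists_val_sub_le (S : Finset (Place K)) (a : Place K → K) (C : ℤᵐ⁰) (hC : C ≠ 0) :
    ∃ x : K, ∀ v ∈ S, v.val (x - a v) ≤ C := by
  classical
  choose c hc1 hc2 using exists_one_lt_lt_one (fun v : S => (v : Place K)) Subtype.val_injective
  -- `c w ^ m / (1 + c w ^ m)` tends to `1` at `w` and to `0` at the other places of `S`.
  have h1 (v w : S) : ∀ᶠ m : ℕ in Filter.atTop,
      v.1.val (a w * (c w ^ m / (1 + c w ^ m)) - if w = v then a v else 0) ≤ C := by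
    rcases eq_or_ne w v with rfl | hwv
    · have hlt : w.1.val (c w)⁻¹ < 1 := by
        rw [map_inv₀]
        exact inv_lt_one_of_one_lt₀ (hc1 w)
      filter_upwards [eventually_mul_pow_le (w.1.val (a w)) _ C hlt hC,
        Filter.eventually_gt_atTop 0] with m hm hm0
      have hgt : 1 < w.1.val (c w ^ m) := by
        rw [map_pow]
        exact one_lt_pow' (hc1 w) hm0.ne'
      have hval : w.1.val (1 + c w ^ m) = w.1.val (c w ^ m) :=
        Valuation.map_add_eq_of_lt_right _ (by simpa using hgt)
      have hne : 1 + c w ^ m ≠ 0 := by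
        rw [← w.1.val.ne_zero_iff, hval]
        exact (zero_lt_one.trans hgt).ne'
      have : a w * (c w ^ m / (1 + c w ^ m)) - (if w = w then a w else 0) =
          -(a w * (1 + c w ^ m)⁻¹) := by
        rw [if_pos rfl]
        field_simp
        ring
      rw [this, Valuation.map_neg, map_mul, map_inv₀, hval, ← map_inv₀, ← inv_pow, map_pow]
      exact hm
    · have hlt : v.1.val (c w) < 1 := hc2 w v hwv.symm
      filter_upwards [eventually_mul_pow_le (v.1.val (a w)) _ C hlt hC,
        Filter.eventually_gt_atTop 0] with m hm hm0
      have hlt' : v.1.val (c w ^ m) < 1 := by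
        rw [map_pow]
        exact pow_lt_one' hlt hm0.ne'
      rw [if_neg hwv, sub_zero, map_mul, map_div₀,
        Valuation.map_add_eq_of_lt_left _ (by simpa using hlt'), map_one, div_one, map_pow]
      exact hm
  obtain ⟨m, hm⟩ := (Filter.eventually_all.2 fun v => Filter.eventually_all.2 (h1 v)).exists
  refine ⟨∑ w : S, a w * (c w ^ m / (1 + c w ^ m)), fun v hv => ?_⟩
  have : ∑ w : S, a w * (c w ^ m / (1 + c w ^ m)) - a v =
      ∑ w : S, (a w * (c w ^ m / (1 + c w ^ m)) - if w = ⟨v, hv⟩ then a v else 0) := by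
    rw [Finset.sum_sub_distrib, Finset.sum_ite_eq' Finset.univ, if_pos (Finset.mem_univ _)]
  rw [this]
  exact v.val.map_sum_le fun w _ => hm ⟨v, hv⟩ w

end weak
end Place

namespace Place

/-! ### Existence of zeros by Chevalley's extension theorem -/

section chevalley
open Polynomial
variable {K : Type*} [Field K] {F : Type*} [Field F] [Algebra F K]

/-- Counterpart of `val_aeval` for a valuation ring whose value group is not yet known to be
infinite cyclic. -/
theorem valuationSubring_val_aeval (V : ValuationSubring K) (hF : ∀ c : F, algebraMap F K c ∈ V)
    {y : K} (hy : V.valuation y < 1) (p : F[X]) (hp : p ≠ 0) :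
    V.valuation (aeval y p) = V.valuation y ^ p.natTrailingDegree := by
  have hyV : y ∈ V := V.mem_of_valuation_le_one _ hy.le
  have hint (q : F[X]) : V.valuation (aeval y q) ≤ 1 := by
    rw [V.valuation_le_one_iff, aeval_eq_sum_range]
    refine sum_mem fun i _ => ?_
    rw [Algebra.smul_def]
    exact mul_mem (hF _) (pow_mem hyV _)
  have hconst (c : F) (hc : c ≠ 0) : V.valuation (algebraMap F K c) = 1 := by
    refine le_antisymm ((V.valuation_le_one_iff _).2 (hF c)) ?_
    have h1 := (V.valuation_le_one_iff _).2 (hF c⁻¹)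
    rw [map_inv₀, map_inv₀] at h1
    refine (inv_le_one₀ ?_).1 h1
    rw [zero_lt_iff, V.valuation.ne_zero_iff]
    simpa using hc
  obtain ⟨q, hq⟩ := X_pow_dvd_iff.2 fun d hd => coeff_eq_zero_of_lt_natTrailingDegree (p := p) hd
  have hq0 : q.coeff 0 ≠ 0 := by
    have h1 : p.coeff (0 + p.natTrailingDegree) = q.coeff 0 := by
      conv_lhs => rw [congrArg (fun r => r.coeff (0 + p.natTrailingDegree)) hq]
      rw [mul_comm, coeff_mul_X_pow]
    rw [← h1, zero_add]
    exact trailingCoeff_nonzero_iff_nonzero.2 hp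
  have hq1 : V.valuation (aeval y q) = 1 := by
    rw [← divX_mul_X_add q]
    simp only [map_add, map_mul, aeval_X, aeval_C]
    rw [Valuation.map_add_eq_of_lt_right, hconst _ hq0]
    rw [hconst _ hq0, map_mul]
    exact (mul_le_of_le_one_left' (hint _)).trans_lt hy
  rw [congrArg (aeval y) hq, map_mul, map_mul, hq1, mul_one, map_pow, aeval_X, map_pow]

/-- A nontrivial relation of linear dependence over `F(y)` has coefficients in `F[y]`. -/
theorem exists_polynomial_relation (y : K) {ι : Type*} [Fintype ι] (u : ι → K)
    (h : ¬ LinearIndependent (IntermediateField.adjoin F {y}) u) :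
    ∃ p : ι → F[X], (∃ i, p i ≠ 0) ∧ ∑ i, aeval y (p i) * u i = 0 := by
  open IntermediateField.algebraAdjoinAdjoin in
  rw [← LinearIndependent.iff_fractionRing (Algebra.adjoin F {y})
      (IntermediateField.adjoin F {y}), Fintype.not_linearIndependent_iff] at h
  obtain ⟨g, hg, i, hi⟩ := h
  have hpoly (c : Algebra.adjoin F {y}) : ∃ p : F[X], aeval y p = (c : K) :=
    (Algebra.adjoin_singleton_eq_range_aeval F y).le c.2
  choose p hp using fun i => hpoly (g i)
  refine ⟨p, ⟨i, fun h0 => hi (Subtype.ext ?_)⟩, ?_⟩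
  · rw [← hp, h0, map_zero]
    rfl
  · simp only [hp]
    exact hg

/-- Every transcendental element of a function field in one variable has a zero. -/
theorem exists_val_lt_one {y : K} (hy : Transcendental F y)
    [FiniteDimensional (IntermediateField.adjoin F {y}) K] :
    ∃ v : Place K, v.val y < 1 := by
  have hinj := transcendental_iff_injective.1 hy
  have hy0 : y ≠ 0 := by
    rintro rfl
    exact hy isAlgebraic_zero
  -- As `y` is not a unit of `F[y]`, some valuation ring of `K` contains `F[y]` and has `y` as a
  -- nonunit. It remains to show that its value group is infinite cyclic.
  let A₀ : Subring K := (Algebra.adjoin F {y}).toSubring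
  let y₀ : A₀ := ⟨y, Algebra.self_mem_adjoin_singleton F y⟩
  have hI : Ideal.span {y₀} ≠ ⊤ := by
    rw [Ne, Ideal.span_singleton_eq_top, isUnit_iff_exists_inv]
    rintro ⟨b, hb⟩
    obtain ⟨p, hp⟩ : ∃ p : F[X], aeval y p = (b : K) :=
      (Algebra.adjoin_singleton_eq_range_aeval F y).le b.2
    have h1 : aeval y (X * p) = aeval y (1 : F[X]) := by
      rw [map_mul, aeval_X, hp, map_one]
      exact congrArg Subtype.val hb
    have := congrArg (fun q => q.coeff 0) (hinj h1)
    simp at this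
  obtain ⟨V, hV1, hV2⟩ := Ideal.image_subset_nonunits_valuationSubring _ hI
  have hF (c : F) : algebraMap F K c ∈ V := hV1 ((Algebra.adjoin F {y}).algebraMap_mem c)
  have hyV : V.valuation y < 1 :=
    V.mem_nonunits_iff.1 (hV2 ⟨y₀, Ideal.mem_span_singleton_self _, rfl⟩)
  set w := V.valuation with hw
  have hwy : w y ≠ 0 := w.ne_zero_iff.2 hy0
  set n := Module.finrank (IntermediateField.adjoin F {y}) K with hn
  -- The powers `1, x, …, x ^ n` are dependent over `F(y)`. In a relation with coefficients in
  -- `F[y]` the maximal value is attained twice; comparing the two terms shows that `w x` is torsion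
  -- modulo the powers of `w y`.
  have hpow (x : K) (hx : x ≠ 0) : ∃ k, 0 < k ∧ k ≤ n ∧ ∃ j : ℤ, w x ^ k = w y ^ j := by
    have hdep : ¬ LinearIndependent (IntermediateField.adjoin F {y})
        (fun i : Fin (n + 1) => x ^ (i : ℕ)) := by
      intro h
      have := h.fintype_card_le_finrank
      simp [← hn] at this
    obtain ⟨p, ⟨i₀, hi₀⟩, hp⟩ := exists_polynomial_relation y _ hdep
    have hval (i : Fin (n + 1)) (hi : p i ≠ 0) : w (aeval y (p i) * x ^ (i : ℕ)) =
        w y ^ (p i).natTrailingDegree * w x ^ (i : ℕ) := by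
      rw [map_mul, map_pow, hw, valuationSubring_val_aeval V hF hyV _ hi]
    obtain ⟨i, -, hmax⟩ := Finset.exists_max_image Finset.univ
      (fun i : Fin (n + 1) => w (aeval y (p i) * x ^ (i : ℕ))) ⟨i₀, Finset.mem_univ _⟩
    have hpos (i) (hi : p i ≠ 0) : w (aeval y (p i) * x ^ (i : ℕ)) ≠ 0 := by
      rw [hval i hi]
      exact mul_ne_zero (pow_ne_zero _ hwy) (pow_ne_zero _ (w.ne_zero_iff.2 hx))
    have hi : w (aeval y (p i) * x ^ (i : ℕ)) ≠ 0 := fun h0 =>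
      hpos i₀ hi₀ (le_zero_iff.1 ((hmax i₀ (Finset.mem_univ _)).trans h0.le))
    have hpi : p i ≠ 0 := by
      intro h0
      rw [h0, map_zero, zero_mul, map_zero] at hi
      exact hi rfl
    obtain ⟨j, hji, hj⟩ : ∃ j ≠ i, w (aeval y (p j) * x ^ (j : ℕ)) =
        w (aeval y (p i) * x ^ (i : ℕ)) := by
      by_contra! hne
      rw [← Finset.add_sum_erase _ _ (Finset.mem_univ i), add_eq_zero_iff_eq_neg] at hp
      have h1 := congrArg w hp
      rw [Valuation.map_neg] at h1
      refine absurd h1 (ne_of_gt (w.map_sum_lt hi fun j hj => ?_))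
      exact lt_of_le_of_ne (hmax j (Finset.mem_univ _)) (hne j (Finset.ne_of_mem_erase hj))
    have hpj : p j ≠ 0 := by
      intro h0
      rw [← hj, h0, map_zero, zero_mul, map_zero] at hi
      exact hi rfl
    rw [hval i hpi, hval j hpj] at hj
    have key (a b : Fin (n + 1)) (d e : ℕ) (hab : a < b)
        (h : w y ^ d * w x ^ (a : ℕ) = w y ^ e * w x ^ (b : ℕ)) :
        ∃ k, 0 < k ∧ k ≤ n ∧ ∃ j : ℤ, w x ^ k = w y ^ j := by
      refine ⟨b - a, Nat.sub_pos_of_lt hab, by omega, (d : ℤ) - e, ?_⟩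
      have hx' : w x ≠ 0 := w.ne_zero_iff.2 hx
      rw [zpow_sub₀ hwy, zpow_natCast, zpow_natCast, pow_sub₀ _ hx' hab.le]
      rw [← div_eq_mul_inv, div_eq_div_iff (pow_ne_zero _ hx')
        (pow_ne_zero _ hwy), h, mul_comm]
    rcases lt_or_gt_of_ne hji with h | h
    · exact key _ _ _ _ h hj
    · exact key _ _ _ _ h hj.symm
  have hpow' (g : V.ValueGroupˣ) : ∃ j : ℤ, (g : V.ValueGroup) ^ n.factorial = w y ^ j := by
    obtain ⟨x, hx⟩ := V.valuation_surjective g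
    have hx0 : x ≠ 0 := by
      rintro rfl
      exact g.ne_zero (by rw [← hx, map_zero])
    obtain ⟨k, hk, hkn, j, hj⟩ := hpow x hx0
    obtain ⟨m, hm⟩ := Nat.dvd_factorial hk hkn
    refine ⟨j * m, ?_⟩
    rw [← hx, hm, pow_mul, zpow_mul, zpow_natCast, ← hj]
  let g₀ : V.ValueGroupˣ := Units.mk0 (w y) hwy
  have hg₀ : g₀ ≠ 1 := fun h => hyV.ne (congrArg Units.val h)
  have : Nontrivial V.ValueGroupˣ := ⟨g₀, 1, hg₀⟩
  -- The `n!`-th power maps the value group into the powers of `w y`, injectively because an ordered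
  -- group is torsion-free.
  have hcyc : IsCyclic V.ValueGroupˣ := by
    let f : V.ValueGroupˣ →* Subgroup.zpowers g₀ := (powMonoidHom n.factorial).codRestrict _
      fun g => by
        obtain ⟨j, hj⟩ := hpow' g
        refine ⟨j, Units.ext ?_⟩
        simpa [g₀] using hj.symm
    refine isCyclic_of_injective f fun a b hab => ?_
    exact pow_left_injective n.factorial_ne_zero (congrArg Subtype.val hab)
  obtain ⟨e⟩ := LinearOrderedCommGroup.isCyclic_iff_nonempty_equiv_int.1 hcyc
  let e' : V.ValueGroup ≃*o ℤᵐ⁰ := OrderMonoidIso.withZeroUnits.symm.trans e.withZero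
  have he' : StrictMono e' := e'.strictMono
  have he0 : e' 0 = 0 := map_zero e'
  refine ⟨⟨w.map (.ofClass e') he'.monotone, ?_⟩, ?_⟩
  · exact e'.surjective.comp V.valuation_surjective
  · have := he' hyV
    rw [map_one] at this
    exact this

end chevalley
end Place

namespace Place

/-! ### Finiteness of residue fields -/

section residue
open Polynomial
variable {K : Type*} [Field K]

/-- Lifts of elements that are independent over `F` are independent over `F(y)`, so `[κ : F] ≤ [K :
F(y)]`. Leaving `κ` general makes this applicable to the residue field of the completion. -/
theorem finite_of_residue_map {F : Type*} [Field F] [Finite F] [Algebra F K]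
    (v : Valuation K ℤᵐ⁰) {κ : Type*} [Field κ] (ψ : v.integer →+* κ)
    (hψ : Function.Surjective ψ) (hψ0 : ∀ x : v.integer, v x < 1 → ψ x = 0)
    {y : K} (hy0 : y ≠ 0) (hy : v y < 1) [FiniteDimensional (IntermediateField.adjoin F {y}) K] :
    Finite κ := by
  classical
  let c₀ : F →+* v.integer := (algebraMap F K).codRestrict v.integer
    fun c => val_algebraMap_le_one v c
  let : Algebra F κ := (ψ.comp c₀).toAlgebra
  let Y : v.integer := ⟨y, hy.le⟩
  have hY : ψ Y = 0 := hψ0 _ hy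
  have htr : Transcendental F y := transcendental_of_val_lt_one v hy0 hy
  have heval (q : F[X]) : ((eval₂ c₀ Y q : v.integer) : K) = aeval y q := by
    rw [aeval_def]
    exact hom_eval₂ q c₀ v.integer.subtype Y
  have hrank : Module.rank F κ ≤ Module.finrank (IntermediateField.adjoin F {y}) K := by
    refine rank_le fun s hs => ?_
    choose u hu using fun i : s => hψ i
    have hli : LinearIndependent (IntermediateField.adjoin F {y}) (fun i : s => (u i : K)) := by
      by_contra hdep
      obtain ⟨p, ⟨i₀, hi₀⟩, hp⟩ := exists_polynomial_relation y _ hdep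
      obtain ⟨i, hi, hmin⟩ := Finset.exists_min_image (Finset.univ.filter fun i : s => p i ≠ 0)
        (fun i => (p i).natTrailingDegree) ⟨i₀, by simpa using hi₀⟩
      have hpi : p i ≠ 0 := by simpa using hi
      -- Dividing the relation by the largest common power of `y` leaves a coefficient with nonzero
      -- constant term. Applying `ψ`, which kills `y`, then gives a nontrivial relation over `F`.
      have hdvd (j : s) : X ^ (p i).natTrailingDegree ∣ p j := by
        rcases eq_or_ne (p j) 0 with h | h
        · rw [h]
          exact dvd_zero _
        · exact X_pow_dvd_iff.2 fun d hd => coeff_eq_zero_of_lt_natTrailingDegree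
            (hd.trans_le (hmin j (by simpa using h)))
      choose q hq using hdvd
      have hqi : (q i).coeff 0 ≠ 0 := by
        have h1 : (p i).coeff (0 + (p i).natTrailingDegree) = (q i).coeff 0 := by
          conv_lhs => rw [congrArg (fun r => r.coeff (0 + (p i).natTrailingDegree)) (hq i)]
          rw [mul_comm, coeff_mul_X_pow]
        rw [← h1, zero_add]
        exact trailingCoeff_nonzero_iff_nonzero.2 hpi
      have h2 : ∑ j : s, aeval y (q j) * u j = (0 : K) := by
        have h3 : y ^ (p i).natTrailingDegree ≠ 0 := pow_ne_zero _ hy0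
        apply mul_left_cancel₀ h3
        rw [mul_zero, ← hp, Finset.mul_sum]
        refine Finset.sum_congr rfl fun j _ => ?_
        conv_rhs => rw [hq j]
        rw [map_mul, map_pow, aeval_X, mul_assoc]
      have h4 : ∑ j : s, eval₂ c₀ Y (q j) * u j = 0 := by
        refine Subtype.ext ?_
        rw [← v.integer.coe_subtype, map_sum, map_zero, ← h2]
        refine Finset.sum_congr rfl fun j _ => ?_
        rw [map_mul, v.integer.coe_subtype, heval]
      have h5 := congrArg ψ h4
      simp only [map_sum, map_mul, map_zero, hom_eval₂, hY, eval₂_at_zero, hu] at h5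
      exact hqi (Fintype.linearIndependent_iff.1 hs (fun j => (q j).coeff 0) h5 i)
    have := hli.fintype_card_le_finrank
    simpa using this
  have : Module.Finite F κ := Module.rank_lt_aleph0_iff.1
    (hrank.trans_lt (Cardinal.natCast_lt_aleph0))
  exact Module.finite_of_finite F

/-- Any transcendental `y` can replace the given coordinate of `F(X)`; the arguments below choose
`y` according to its zeros or poles. -/
theorem exists_constants [IsGlobalFunctionField K] :
    ∃ (F : Type) (_ : Field F) (_ : Finite F) (_ : Algebra F K), ∀ y : K, Transcendental F y →
      FiniteDimensional (IntermediateField.adjoin F {y}) K := by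
  obtain ⟨F, _, _, _, hFK⟩ := IsGlobalFunctionField.exists_functionField (K := K)
  let : Algebra F K := Algebra.compHom K (algebraMap F F⟮X⟯)
  have : IsScalarTower F F⟮X⟯ K := IsScalarTower.of_algebraMap_eq fun _ => rfl
  exact ⟨F, inferInstance, inferInstance, inferInstance, finiteDimensional_adjoin⟩

end residue

/-! ### Completions: density of `K` and compactness of balls -/

section completion
open scoped Valued
variable {K : Type*} [Field K] (v : Place K)

/-- `K` is dense in `K_v`. -/
theorem exists_valued_sub_lt (a : v.completion) (C : ℤᵐ⁰) (hC : C ≠ 0) :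
    ∃ x : K, Valued.v (a - algebraMap K v.completion x) < C := by
  obtain ⟨c, hc⟩ := v.surjective C
  have hc0 : algebraMap K v.completion c ≠ 0 := by
    rw [← (Valued.v : Valuation v.completion ℤᵐ⁰).ne_zero_iff, valued_algebraMap, hc]
    exact hC
  obtain ⟨x, hx⟩ := Metric.denseRange_iff.1
    (UniformSpace.Completion.denseRange_coe (α := WithVal v.val)) a
    ‖algebraMap K v.completion c‖ (norm_pos_iff.2 hc0)
  refine ⟨WithVal.ofVal x, ?_⟩
  rw [dist_eq_norm, Valued.toNormedField.norm_lt_iff, valued_algebraMap, hc] at hx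
  exact hx

theorem residue_eq_zero_iff (a : 𝒪[v.completion]) :
    IsLocalRing.residue 𝒪[v.completion] a = 0 ↔ Valued.v (a : v.completion) < 1 := by
  rw [IsLocalRing.residue_eq_zero_iff, IsLocalRing.mem_maximalIdeal, mem_nonunits_iff,
    (Valuation.integer.integers Valued.v).isUnit_iff_valuation_eq_one]
  exact (lt_iff_le_and_ne.trans (and_iff_right a.2)).symm

/-- By density, the elements of `K` integral at `v` already surject onto the residue field of the
completion. -/
instance finite_residueField [IsGlobalFunctionField K] : Finite 𝓀[v.completion] := by
  obtain ⟨F, _, _, _, hF⟩ := exists_constants (K := K)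
  obtain ⟨y, hy⟩ := v.surjective (WithZero.exp (-1))
  have hy0 : y ≠ 0 := by
    rw [← v.val.ne_zero_iff, hy]
    exact WithZero.exp_ne_zero
  have hy1 : v.val y < 1 := by
    rw [hy, ← WithZero.exp_zero, WithZero.exp_lt_exp]
    simp
  have := hF y (transcendental_of_val_lt_one v.val hy0 hy1)
  let f : v.val.integer →+* 𝒪[v.completion] :=
    ((algebraMap K v.completion).comp v.val.integer.subtype).codRestrict _ fun x => by
      rw [Valuation.mem_integer_iff]
      exact (v.valued_algebraMap _).trans_le x.2
  refine finite_of_residue_map (F := F) v.val ((IsLocalRing.residue 𝒪[v.completion]).comp f)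
    ?_ ?_ hy0 hy1
  · intro r
    obtain ⟨a, rfl⟩ := IsLocalRing.residue_surjective r
    obtain ⟨x, hx⟩ := v.exists_valued_sub_lt a 1 one_ne_zero
    have hx1 : v.val x ≤ 1 := by
      have h1 : algebraMap K v.completion x = a - (a - algebraMap K v.completion x) := by ring
      rw [← valued_algebraMap, h1]
      exact (Valuation.map_sub _ _ _).trans (max_le a.2 hx.le)
    refine ⟨⟨x, hx1⟩, ?_⟩
    rw [RingHom.comp_apply, ← sub_eq_zero, ← map_sub, residue_eq_zero_iff,
      ← neg_sub, NegMemClass.coe_neg, Valuation.map_neg]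
    exact hx
  · intro x hx
    rw [RingHom.comp_apply, residue_eq_zero_iff]
    exact (v.valued_algebraMap _).trans_lt hx

instance [IsGlobalFunctionField K] : ProperSpace v.completion :=
  Valued.integer.properSpace_iff_completeSpace_and_isDiscreteValuationRing_integer_and_finite_residueField.2
    ⟨inferInstance, inferInstanceAs (IsDiscreteValuationRing v.integers), inferInstance⟩

/-- The ball of radius `C` is a finite union of translates of the unit ball. -/
theorem exists_finite_partition [IsGlobalFunctionField K] (C : ℤᵐ⁰) :
    ∃ (T : Set v.completion) (_ : T.Finite) (f : K → T), ∀ a b : K, v.val a ≤ C → v.val b ≤ C →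
      f a = f b → v.val (a - b) ≤ 1 := by
  obtain ⟨c, hc⟩ := v.surjective C
  obtain ⟨T, -, hT, hcov⟩ := (isCompact_closedBall (0 : v.completion)
    ‖algebraMap K v.completion c‖).finite_cover_balls one_pos
  have h0 : (0 : v.completion) ∈ Metric.closedBall 0 ‖algebraMap K v.completion c‖ := by simp
  -- A default value for the elements outside the ball, about which nothing is claimed.
  obtain ⟨t₀, ht₀, -⟩ := Set.mem_iUnion₂.1 (hcov h0)
  have h1 (a : K) : ∃ t : T, v.val a ≤ C → ‖algebraMap K v.completion a - t‖ < 1 := by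
    by_cases ha : v.val a ≤ C
    · have : algebraMap K v.completion a ∈ Metric.closedBall 0 ‖algebraMap K v.completion c‖ := by
        rw [mem_closedBall_zero_iff, Valued.toNormedField.norm_le_iff, valued_algebraMap,
          valued_algebraMap, hc]
        exact ha
      obtain ⟨t, ht, hat⟩ := Set.mem_iUnion₂.1 (hcov this)
      exact ⟨⟨t, ht⟩, fun _ => by simpa [dist_eq_norm] using hat⟩
    · exact ⟨⟨t₀, ht₀⟩, fun h => absurd h ha⟩
  choose f hf using h1
  refine ⟨T, hT, f, fun a b ha hb hab => ?_⟩
  have h2 := hf a ha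
  have h3 := hf b hb
  rw [← hab] at h3
  rw [Valued.toNormedField.norm_lt_one_iff] at h2 h3
  rw [← valued_algebraMap, map_sub, ← sub_sub_sub_cancel_right _ _ (f a : v.completion)]
  exact (Valuation.map_sub _ _ _).trans (max_le h2.le h3.le)

end completion
end Place

namespace Place

/-! ### Functions with prescribed poles and strong approximation -/

section approximation
open Polynomial
open scoped Valued
variable {K : Type*} [Field K]

theorem val_sum_aeval_mul_le_one {F : Type*} [Field F] [Finite F] [Algebra F K]
    (v : Valuation K ℤᵐ⁰) {x : K} (hx : v x ≤ 1) {s : Finset K} (hs : ∀ b ∈ s, v b ≤ 1)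
    (p : K → F[X]) : v (∑ b ∈ s, aeval x (p b) * b) ≤ 1 := by
  refine v.map_sum_le fun b hb => ?_
  rw [map_mul]
  exact mul_le_one' (val_aeval_le_one v hx _) (hs b hb)

theorem exists_uniform_bound {T : Set (Place K)} (hT : T.Finite) (s : Finset K) :
    ∃ C : ℤᵐ⁰, 1 ≤ C ∧ ∀ v ∈ T, ∀ b ∈ s, v.val b ≤ C := by
  obtain ⟨C, hC⟩ := ((hT.prod s.finite_toSet).image fun q => q.1.val q.2).bddAbove
  exact ⟨max 1 C, le_max_left _ _, fun v hv b hb =>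
    (hC ⟨(v, b), ⟨hv, hb⟩, rfl⟩).trans (le_max_right _ _)⟩

variable [IsGlobalFunctionField K]

theorem finite_poles (x : K) : {v : Place K | 1 < v.val x}.Finite := by
  rcases eq_or_ne x 0 with rfl | hx
  · simp
  · refine (finite_zeros x⁻¹ (inv_ne_zero hx)).subset fun v hv => ?_
    rw [Set.mem_ofPred_eq, map_inv₀]
    exact inv_lt_one_of_one_lt₀ hv

/-- For each place there is a function whose only pole is at that place. -/
theorem exists_unique_pole (P : Place K) : ∃ t : K, 1 < P.val t ∧ ∀ v ≠ P, v.val t ≤ 1 := by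
  classical
  obtain ⟨F, _, _, _, hF⟩ := exists_constants (K := K)
  obtain ⟨y, hy⟩ := P.surjective (WithZero.exp 1)
  have hPy : 1 < P.val y := by
    rw [hy, ← WithZero.exp_zero, WithZero.exp_lt_exp]
    exact one_pos
  have htr : Transcendental F y := transcendental_of_one_lt_val P.val hPy
  have := hF y htr
  obtain ⟨s, hs, hrem⟩ := exists_bounded_remainder htr
  have hT := finite_poles y
  set T : Set (Place K) := {v | 1 < v.val y}
  obtain ⟨C, hC1, hC⟩ := exists_uniform_bound hT s
  have hC0 : 0 < C := zero_lt_one.trans_le hC1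
  -- The value prescribed at `P` exceeds `C`, so an error of size `C` does not change it, and it is
  -- different for each `m`.
  choose d hd using fun m : ℕ => P.surjective (WithZero.exp ((m : ℤ) + 1) * C)
  have hdC (m : ℕ) : C < P.val (d m) := by
    rw [hd]
    refine lt_mul_of_one_lt_left hC0 ?_
    rw [← WithZero.exp_zero, WithZero.exp_lt_exp]
    positivity
  choose x hx using fun m => exists_val_sub_le hT.toFinset (fun v => if v = P then d m else 0) 1
    one_ne_zero
  choose p hp using fun m => hrem (x m)
  -- `z m` is integral off the poles of `y`, has the value of `d m` at `P`, and is bounded by `C` at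
  -- the other poles of `y`.
  let z (m : ℕ) : K := ∑ b ∈ s, aeval y (p m b) * b
  have hz0 (m : ℕ) (v : Place K) (hv : v ∉ T) : v.val (z m) ≤ 1 :=
    val_sum_aeval_mul_le_one _ (not_lt.1 hv) (hs v.val (not_lt.1 hv)) _
  have hz1 (m : ℕ) (v : Place K) (hv : v ∈ T) :
      v.val (z m - if v = P then d m else 0) ≤ C := by
    have h1 := hp m v.val hv C (hC v hv)
    have h2 := hx m v (hT.mem_toFinset.2 hv)
    rw [← sub_sub_sub_cancel_left _ _ (x m)]
    exact (Valuation.map_sub _ _ _).trans (max_le (h2.trans hC1) h1)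
  have hzP (m : ℕ) : P.val (z m) = P.val (d m) := by
    have h1 := hz1 m P hPy
    rw [if_pos rfl] at h1
    have h2 : z m = d m + (z m - d m) := by ring
    rw [h2]
    exact Valuation.map_add_eq_of_lt_left _ (h1.trans_lt (hdC m))
  have hzC (m : ℕ) (v : Place K) (hv : v ∈ T) (hvP : v ≠ P) : v.val (z m) ≤ C := by
    simpa [hvP] using hz1 m v hv
  choose U hU f hf using fun v : Place K => v.exists_finite_partition C
  have (v : Place K) : Finite (U v) := hU v
  have : Finite T := hT
  -- Two of the `z m` lie in the same cell at each pole of `y`. Their difference is integral off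
  -- `P`, and it keeps a pole at `P` because the two values there are distinct.
  obtain ⟨m, m', hne, heq⟩ := Finite.exists_ne_map_eq_of_infinite
    (fun m : ℕ => fun v : T => f v (z m))
  refine ⟨z m - z m', ?_, fun v hv => ?_⟩
  · have h1 : P.val (z m) ≠ P.val (z m') := by
      rw [hzP, hzP, hd, hd]
      intro h
      have := WithZero.exp_injective (mul_right_cancel₀ hC0.ne' h)
      omega
    have hlt (k : ℕ) : 1 < P.val (z k) := by
      rw [hzP]
      exact hC1.trans_lt (hdC k)
    rcases lt_or_gt_of_ne h1 with h | h
    · rw [Valuation.map_sub_swap, Valuation.map_sub_eq_of_lt_left _ h]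
      exact hlt m'
    · rw [Valuation.map_sub_eq_of_lt_left _ h]
      exact hlt m
  · by_cases hvT : v ∈ T
    · exact hf v _ _ (hzC m v hvT hv) (hzC m' v hvT hv) (congrFun heq ⟨v, hvT⟩)
    · exact (Valuation.map_sub _ _ _).trans (max_le (hz0 m v hvT) (hz0 m' v hvT))

/-- Every `x ∈ K` that is integral at `v` is a zero modulo `v` of a nonzero polynomial with constant
coefficients. -/
theorem exists_val_aeval_lt_one (F : Type*) [Field F] [Algebra F K] (v : Place K)
    {x : K} (hx : v.val x ≤ 1) : ∃ p : F[X], p ≠ 0 ∧ v.val (aeval x p) < 1 := by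
  have := Fintype.ofFinite 𝓀[v.completion]
  let a : 𝒪[v.completion] := ⟨algebraMap K v.completion x, (v.valued_algebraMap x).trans_le hx⟩
  -- Every element of the residue field with `q` elements is a root of `X ^ q - X`.
  refine ⟨X ^ Fintype.card 𝓀[v.completion] - X,
    FiniteField.X_pow_card_sub_X_ne_zero F Fintype.one_lt_card, ?_⟩
  have h1 : IsLocalRing.residue 𝒪[v.completion] (a ^ Fintype.card 𝓀[v.completion] - a) = 0 := by
    rw [map_sub, map_pow, FiniteField.pow_card, sub_self]
  rw [residue_eq_zero_iff] at h1
  rw [← valued_algebraMap]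
  simpa [a] using h1

/-- Removing `gcd s q` from `q` lowers the degree until the rest is coprime to `s`. This prepares
the partial fractions in `exists_strong_approx`. -/
theorem exists_coprime_dvd {F : Type*} [Field F] (s q : F[X]) (hq : q ≠ 0) :
    ∃ (k : ℕ) (e : F[X]), IsCoprime s e ∧ q ∣ s ^ k * e ∧ e ≠ 0 := by
  classical
  induction h : q.natDegree using Nat.strong_induction_on generalizing q with
  | _ n ih =>
    by_cases hsq : IsCoprime s q
    · exact ⟨0, q, hsq, by simp, hq⟩
    · have hd : ¬ IsUnit (EuclideanDomain.gcd s q) := by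
        rwa [EuclideanDomain.gcd_isUnit_iff]
      obtain ⟨q', hq'⟩ := EuclideanDomain.gcd_dvd_right s q
      have hd0 : EuclideanDomain.gcd s q ≠ 0 := fun h0 => hq (by rw [hq', h0, zero_mul])
      have hq'0 : q' ≠ 0 := fun h0 => hq (by rw [hq', h0, mul_zero])
      have hdeg : 0 < (EuclideanDomain.gcd s q).natDegree := by
        rw [Nat.pos_iff_ne_zero]
        intro h0
        exact hd (isUnit_iff_degree_eq_zero.2 (by rw [degree_eq_natDegree hd0, h0]; rfl))
      have hlt : q'.natDegree < n := by
        rw [← h]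
        conv_rhs => rw [hq']
        rw [natDegree_mul hd0 hq'0]
        omega
      obtain ⟨k, e, h1, h2, h3⟩ := ih _ hlt q' hq'0 rfl
      refine ⟨k + 1, e, h1, ?_, h3⟩
      rw [hq', pow_succ', mul_assoc]
      exact mul_dvd_mul (EuclideanDomain.gcd_dvd_left s q) h2

/-- Strong approximation: an element of `K` can be approximated at finitely many places by elements
that are regular at all other places except one. -/
theorem exists_strong_approx (P : Place K) (S : Finset (Place K)) (hS : P ∉ S)
    (a : Place K → K) :
    ∃ x : K, (∀ v ∈ S, v.val (x - a v) ≤ 1) ∧ ∀ v ∉ S, v ≠ P → v.val x ≤ 1 := by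
  classical
  obtain ⟨F, _, _, _, hF⟩ := exists_constants (K := K)
  obtain ⟨t, htP, ht⟩ := exists_unique_pole P
  have htr : Transcendental F t := transcendental_of_one_lt_val P.val htP
  have hinj := transcendental_iff_injective.1 htr
  have := hF t htr
  obtain ⟨B, hB, hgen⟩ := exists_integral_generators (F := F) t
  have hSP (v) (hv : v ∈ S) : v ≠ P := fun h => hS (h ▸ hv)
  choose! f hf0 hf using fun (v : Place K) (hv : v ∈ S) =>
    exists_val_aeval_lt_one F v (ht v (hSP v hv))
  -- `s(t)` vanishes on `S` but may have further zeros. `S'` contains all its zeros other than `P`,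
  -- and `c` is taken to be integral at those outside `S`.
  set s : F[X] := ∏ v ∈ S, f v with hs
  have hs0 : s ≠ 0 := Finset.prod_ne_zero_iff.2 hf0
  have hne (q : F[X]) (hq : q ≠ 0) : aeval t q ≠ 0 := fun h =>
    hq (hinj (h.trans (map_zero _).symm))
  have hsS (v) (hv : v ∈ S) : v.val (aeval t s) < 1 := by
    rw [hs, ← Finset.mul_prod_erase _ _ hv, map_mul, map_mul]
    exact (mul_le_of_le_one_right' (val_aeval_le_one _ (ht v (hSP v hv)) _)).trans_lt (hf v hv)
  have hfin := finite_zeros (aeval t s) (hne s hs0)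
  set S' := hfin.toFinset.erase P with hS'
  obtain ⟨c, hc⟩ := exists_val_sub_le S' (fun v => if v ∈ S then a v else 0) 1 one_ne_zero
  obtain ⟨q, p, hq, hqp⟩ := hgen c
  obtain ⟨k, e, hse, ⟨g, hg⟩, he⟩ := exists_coprime_dvd s q hq
  obtain ⟨u, w, huw⟩ := hse.pow_left (m := k)
  -- Partial fractions. The first summand has poles at most in `S'` and at `P`. The second is
  -- integral on `S'`, where `e(t)` is a unit because `e` is coprime to `s`. Hence the first summand
  -- approximates `c` on `S'` and is the element sought.
  have hsplit : c = ∑ b ∈ B, aeval t (p b * g * w) * b / aeval t (s ^ k) +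
      ∑ b ∈ B, aeval t (p b * g * u) * b / aeval t e := by
    have h1 : aeval t (s ^ k) ≠ 0 := hne _ (pow_ne_zero _ hs0)
    have h2 := hne e he
    have h3 : aeval t q * aeval t g = aeval t (s ^ k) * aeval t e := by
      rw [← map_mul, ← map_mul, hg]
    have h4 : aeval t u * aeval t (s ^ k) + aeval t w * aeval t e = 1 := by
      rw [← map_mul, ← map_mul, ← map_add, huw, map_one]
    rw [← Finset.sum_div, ← Finset.sum_div, div_add_div _ _ h1 h2, eq_div_iff (mul_ne_zero h1 h2),
      ← h3, mul_comm, mul_right_comm, hqp, Finset.sum_mul, Finset.sum_mul, Finset.mul_sum,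
      ← Finset.sum_add_distrib]
    refine Finset.sum_congr rfl fun b _ => ?_
    simp only [map_mul]
    linear_combination (-(aeval t (p b) * b * aeval t g)) * h4
  have hint (v : Place K) (hv : v ≠ P) (f : K → F[X]) (d : F[X]) (hd : v.val (aeval t d) = 1) :
      v.val (∑ b ∈ B, aeval t (f b) * b / aeval t d) ≤ 1 := by
    rw [← Finset.sum_div, map_div₀, hd, div_one]
    exact val_sum_aeval_mul_le_one _ (ht v hv) (hB v.val (ht v hv)) _
  have hS'S (v) (hv : v ∈ S') : v ≠ P ∧ v.val (aeval t s) < 1 := by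
    simpa [hS'] using hv
  refine ⟨∑ b ∈ B, aeval t (p b * g * w) * b / aeval t (s ^ k), ?_⟩
  have hz (v) (hv : v ∈ S') : v.val (∑ b ∈ B, aeval t (p b * g * w) * b / aeval t (s ^ k) -
      if v ∈ S then a v else 0) ≤ 1 := by
    obtain ⟨hvP, hvs⟩ := hS'S v hv
    have h1 := hc v hv
    have hve : v.val (aeval t e) = 1 := by
      refine le_antisymm (val_aeval_le_one _ (ht v hvP) _) ?_
      by_contra! hlt
      obtain ⟨u', w', h'⟩ := hse
      have h2 := congrArg (fun r => v.val (aeval t r)) h'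
      simp only [map_add, map_mul, map_one] at h2
      refine absurd h2 (ne_of_lt (Valuation.map_add_lt _ ?_ ?_))
      · rw [map_mul]
        exact (mul_le_of_le_one_left' (val_aeval_le_one _ (ht v hvP) _)).trans_lt hvs
      · rw [map_mul]
        exact (mul_le_of_le_one_left' (val_aeval_le_one _ (ht v hvP) _)).trans_lt hlt
    have h2 := hint v hvP (fun b => p b * g * u) e hve
    rw [hsplit, add_sub_right_comm] at h1
    have h3 := (Valuation.map_sub v.val _ _).trans (max_le h1 h2)
    rwa [add_sub_cancel_right] at h3
  refine ⟨fun v hv => ?_, fun v hv hvP => ?_⟩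
  · have hvS' : v ∈ S' := by simpa [hS'] using ⟨hSP v hv, hsS v hv⟩
    simpa [hv] using hz v hvS'
  · by_cases hvS' : v ∈ S'
    · simpa [hv] using hz v hvS'
    · refine hint v hvP _ _ ?_
      rw [map_pow, map_pow]
      have : ¬ v.val (aeval t s) < 1 := by simpa [hS', hvP] using hvS'
      rw [le_antisymm (val_aeval_le_one _ (ht v hvP) _) (not_lt.1 this), one_pow]

/-- The field `K` is the sum of `A` and a bounded subset of `K_∞`. -/
theorem exists_regular_sub_le (P : Place K) :
    ∃ C : ℤᵐ⁰, ∀ a : K, ∃ x ∈ P.regularRing, P.val (a - x) ≤ C := by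
  obtain ⟨F, _, _, _, hF⟩ := exists_constants (K := K)
  obtain ⟨t, htP, ht⟩ := exists_unique_pole P
  have htr : Transcendental F t := transcendental_of_one_lt_val P.val htP
  have := hF t htr
  obtain ⟨s, hs, hrem⟩ := exists_bounded_remainder htr
  obtain ⟨C, -, hC⟩ := exists_uniform_bound (Set.finite_singleton P) s
  refine ⟨C, fun a => ?_⟩
  obtain ⟨p, hp⟩ := hrem a
  exact ⟨_, fun v hv => val_sum_aeval_mul_le_one _ (ht v hv) (hs v.val (ht v hv)) p,
    hp P.val htP C (hC P rfl)⟩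

/-- A regular function that vanishes at `∞` is zero. -/
theorem eq_zero_of_mem_regularRing {P : Place K} {a : K} (ha : a ∈ P.regularRing)
    (haP : P.val a < 1) : a = 0 := by
  by_contra h0
  obtain ⟨F, _, _, _, hF⟩ := exists_constants (K := K)
  have htr : Transcendental F a := transcendental_of_val_lt_one P.val h0 haP
  have htr' : Transcendental F a⁻¹ := fun h => htr (by simpa using h.inv)
  have := hF _ htr'
  -- A zero of `a⁻¹` is a pole of `a`, which `haP` excludes at `∞` and `ha` everywhere else.
  obtain ⟨v, hv⟩ := exists_val_lt_one htr'
  have hv' : 1 < v.val a := by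
    have h1 : v.val a ≠ 0 := v.val.ne_zero_iff.2 h0
    rw [map_inv₀] at hv
    exact (inv_lt_one₀ (zero_lt_iff.2 h1)).1 hv
  by_cases hvP : v = P
  · rw [hvP] at hv'
    exact absurd haP hv'.le.not_gt
  · exact absurd (ha v hvP) hv'.not_ge

end approximation
end Place

/-! ### The ring `A` and the finite adeles -/

namespace Place
variable {K : Type*} [Field K] {P : Place K}

namespace FiniteAdele

theorem mul_apply (a b : P.FiniteAdele) (v : {v : Place K // v ≠ P}) : (a * b) v = a v * b v := rfl
theorem add_apply (a b : P.FiniteAdele) (v : {v : Place K // v ≠ P}) : (a + b) v = a v + b v := rfl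
theorem sub_apply (a b : P.FiniteAdele) (v : {v : Place K // v ≠ P}) : (a - b) v = a v - b v := rfl

@[ext] theorem ext {a b : P.FiniteAdele} (h : ∀ v, a v = b v) : a = b := DFunLike.ext _ _ h

/-- The `v`-component of a finite adele, as a ring homomorphism. -/
def component (v : {v : Place K // v ≠ P}) : P.FiniteAdele →+* v.1.completion where
  toFun a := a v
  map_one' := rfl
  map_mul' _ _ := rfl
  map_zero' := rfl
  map_add' _ _ := rfl

theorem component_apply (v : {v : Place K // v ≠ P}) (a : P.FiniteAdele) :
    component v a = a v := rfl

theorem finite_not_integral (a : P.FiniteAdele) :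
    {v : {v : Place K // v ≠ P} | ¬ Valued.v (a v) ≤ 1}.Finite :=
  Filter.eventually_cofinite.1 a.2

end FiniteAdele

variable [IsGlobalFunctionField K]

section regular

/-- After scaling by `c` with a pole at `∞`, two elements in the same translate of the unit ball
have a difference that vanishes at `∞`, hence coincide. -/
theorem finite_regular_ball (P : Place K) (C : ℤᵐ⁰) :
    {x : K | x ∈ P.regularRing ∧ P.val x ≤ C}.Finite := by
  obtain ⟨c, hc⟩ := P.surjective (WithZero.exp 1)
  have hc1 : 1 < P.val c := by
    rw [hc, ← WithZero.exp_zero, WithZero.exp_lt_exp]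
    exact one_pos
  obtain ⟨U, hU, f, hf⟩ := P.exists_finite_partition (C * P.val c)
  have : Finite U := hU
  refine Set.Finite.of_injOn (f := fun x => f (x * c)) (fun _ _ => Set.mem_univ _) ?_
    Set.finite_univ
  intro x hx y hy hxy
  have hle (z : K) (hz : P.val z ≤ C) : P.val (z * c) ≤ C * P.val c := by
    rw [map_mul]
    gcongr
  have h := hf _ _ (hle x hx.2) (hle y hy.2) hxy
  rw [← sub_mul, map_mul] at h
  refine sub_eq_zero.1 (eq_zero_of_mem_regularRing (sub_mem hx.1 hy.1) ?_)
  by_contra! h1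
  exact absurd h (lt_mul_of_one_le_of_lt h1 hc1).not_ge

/-- Division by a nonzero `a ∈ I` has remainders bounded at `∞`, so `a` and the finitely many
elements of `I` below that bound generate `I`. -/
instance isNoetherianRing_regularRing : IsNoetherianRing P.regularRing := by
  refine ⟨fun I => ?_⟩
  rcases eq_or_ne I ⊥ with rfl | hI
  · exact Submodule.fg_bot
  obtain ⟨a, ha, ha0⟩ := Submodule.exists_mem_ne_zero_of_ne_bot hI
  have ha0' : (a : K) ≠ 0 := fun h => ha0 (Subtype.ext h)
  obtain ⟨C, hC⟩ := exists_regular_sub_le P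
  have hfin : {x : P.regularRing | x ∈ I ∧ P.val x ≤ P.val a * C}.Finite :=
    ((finite_regular_ball P (P.val a * C)).preimage Subtype.val_injective.injOn).subset
      fun x hx => ⟨x.2, hx.2⟩
  classical
  refine ⟨insert a hfin.toFinset, le_antisymm (Submodule.span_le.2 ?_) fun x hx => ?_⟩
  · intro x hx
    rw [Finset.coe_insert, Set.Finite.coe_toFinset] at hx
    rcases hx with rfl | hx
    · exact ha
    · exact hx.1
  · obtain ⟨y, hy, hle⟩ := hC (x / a)
    have h1 : x - ⟨y, hy⟩ * a ∈ I := I.sub_mem hx (I.smul_mem _ ha)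
    have h2 : P.val ((x - ⟨y, hy⟩ * a : P.regularRing) : K) ≤ P.val a * C := by
      have : ((x - ⟨y, hy⟩ * a : P.regularRing) : K) = a * (x / a - y) := by
        push_cast
        field_simp
      rw [this, map_mul]
      gcongr
    have h3 : x = (x - ⟨y, hy⟩ * a) + ⟨y, hy⟩ * a := by ring
    rw [h3, Finset.coe_insert, Set.Finite.coe_toFinset]
    refine Submodule.add_mem _ (Submodule.subset_span (Or.inr ⟨h1, h2⟩)) ?_
    exact Submodule.smul_mem _ _ (Submodule.subset_span (Or.inl rfl))

/-- Infinitely many powers of a function `t` with its only pole at `P` meet finitely many classes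
modulo the required precision at `S`; `d` is the difference of two powers in one class. -/
theorem exists_regular_val_le (P : Place K) (S : Finset (Place K)) (hS : P ∉ S) (C : ℤᵐ⁰)
    (hC : C ≠ 0) : ∃ d ∈ P.regularRing, d ≠ 0 ∧ ∀ v ∈ S, v.val d ≤ C := by
  obtain ⟨t, htP, ht⟩ := exists_unique_pole P
  choose c hc using fun v : Place K => v.surjective C
  choose U hU f hf using fun v : Place K => v.exists_finite_partition C⁻¹
  have (v : Place K) : Finite (U v) := hU v
  obtain ⟨m, m', hne, heq⟩ := Finite.exists_ne_map_eq_of_infinite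
    (fun m : ℕ => fun v : S => f v (t ^ m / c v))
  have hreg (m : ℕ) : t ^ m ∈ P.regularRing := pow_mem (show t ∈ P.regularRing from ht) m
  refine ⟨t ^ m - t ^ m', sub_mem (hreg m) (hreg m'), ?_, fun v hv => ?_⟩
  · rw [sub_ne_zero]
    intro h
    have h1 := congrArg P.val h
    rw [map_pow, map_pow] at h1
    exact hne (pow_right_injective₀ (zero_lt_one.trans htP) htP.ne' h1)
  · have hvP : v ≠ P := fun h => hS (h ▸ hv)
    have hle (k : ℕ) : v.val (t ^ k / c v) ≤ C⁻¹ := by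
      rw [map_div₀, hc, div_eq_mul_inv]
      exact mul_le_of_le_one_left' (hreg k v hvP)
    have h := hf v _ _ (hle m) (hle m') (congrFun heq ⟨v, hv⟩)
    rw [← sub_div, map_div₀, hc] at h
    exact (div_le_one₀ (zero_lt_iff.2 hC)).1 h

end regular

namespace FiniteAdele

theorem algebraMap_apply (x : K) (v : {v : Place K // v ≠ P}) :
    algebraMap K P.FiniteAdele x v = algebraMap K v.1.completion x := rfl

theorem algebraMap_mem_integralAdeles_iff {x : K} :
    algebraMap K P.FiniteAdele x ∈ P.integralAdeles ↔ x ∈ P.regularRing := by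
  refine ⟨fun h v hv => ?_, fun h => algebraMap_mem_integralAdeles ⟨x, h⟩⟩
  have := h ⟨v, hv⟩
  rwa [algebraMap_apply, Valuation.mem_valuationSubring_iff, valued_algebraMap] at this

/-- Strong approximation: `𝔸_{K,f} = K + R`. -/
theorem exists_sub_mem_integralAdeles (a : P.FiniteAdele) :
    ∃ x : K, a - algebraMap K P.FiniteAdele x ∈ P.integralAdeles := by
  classical
  choose b hb using fun v : {v : Place K // v ≠ P} => v.1.exists_valued_sub_lt (a v) 1 one_ne_zero
  have hfin := a.finite_not_integral
  obtain ⟨x, hx1, hx2⟩ := exists_strong_approx P (hfin.toFinset.image Subtype.val)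
    (fun h => by
      obtain ⟨v, -, hv⟩ := Finset.mem_image.1 h
      exact v.2 hv)
    (fun v => if h : v ≠ P then b ⟨v, h⟩ else 0)
  refine ⟨x, fun v => ?_⟩
  rw [Valuation.mem_valuationSubring_iff, sub_apply, algebraMap_apply]
  by_cases hv : Valued.v (a v) ≤ 1
  · have hv' : v.1 ∉ hfin.toFinset.image Subtype.val := by
      intro h
      obtain ⟨w, hw, hwv⟩ := Finset.mem_image.1 h
      rw [← Subtype.ext hwv] at hv
      exact (hfin.mem_toFinset.1 hw) hv
    refine (Valuation.map_sub _ _ _).trans (max_le hv ?_)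
    rw [valued_algebraMap]
    exact hx2 v.1 hv' v.2
  · have h1 := hx1 v.1 (Finset.mem_image_of_mem _ (hfin.mem_toFinset.2 hv))
    rw [dif_pos v.2, ← valued_algebraMap, map_sub] at h1
    rw [← sub_sub_sub_cancel_right _ _ (algebraMap K v.1.completion (b v))]
    exact (Valuation.map_sub _ _ _).trans (max_le (hb v).le h1)

theorem exists_eq_add_mul (a : P.FiniteAdele) {d : K} (hd : d ≠ 0) :
    ∃ (x : K) (r : P.integralAdeles), a = algebraMap K _ x + algebraMap K _ d * r := by
  obtain ⟨x, hx⟩ := exists_sub_mem_integralAdeles (algebraMap K _ d⁻¹ * a)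
  refine ⟨d * x, ⟨_, hx⟩, ?_⟩
  have h : algebraMap K P.FiniteAdele d * algebraMap K _ d⁻¹ = 1 := by
    rw [← map_mul, mul_inv_cancel₀ hd, map_one]
  rw [map_mul]
  linear_combination (-a) * h

/-- Integral adeles are congruent to elements of `A` modulo every nonzero element of `K`. -/
theorem exists_regular_eq_add_mul (a : P.integralAdeles) {d : K} (hdA : d ∈ P.regularRing)
    (hd : d ≠ 0) : ∃ (x : P.regularRing) (r : P.integralAdeles),
      (a : P.FiniteAdele) = algebraMap K _ x + algebraMap K _ d * r := by
  obtain ⟨x, r, h⟩ := exists_eq_add_mul (a : P.FiniteAdele) hd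
  refine ⟨⟨x, algebraMap_mem_integralAdeles_iff.1 ?_⟩, r, h⟩
  rw [eq_sub_of_add_eq h.symm]
  exact sub_mem a.2 (mul_mem (algebraMap_mem_integralAdeles ⟨d, hdA⟩) r.2)

/-- A finite family of finite adeles has a common denominator. -/
theorem exists_denominator {ι : Type*} [Finite ι] (a : ι → P.FiniteAdele) :
    ∃ d ∈ P.regularRing, d ≠ 0 ∧ ∀ i, algebraMap K _ d * a i ∈ P.integralAdeles := by
  classical
  have := Fintype.ofFinite ι
  have key (a : P.FiniteAdele) :
      ∃ d ∈ P.regularRing, d ≠ 0 ∧ algebraMap K _ d * a ∈ P.integralAdeles := by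
    have hfin := a.finite_not_integral
    obtain ⟨C, hC⟩ := (hfin.image fun v => Valued.v (a v)).bddAbove
    -- `max C 1` is invertible even when no place is bad and `C` carries no information.
    obtain ⟨d, hdA, hd, hdle⟩ := exists_regular_val_le P (hfin.toFinset.image Subtype.val)
      (fun h => by
        obtain ⟨v, -, hv⟩ := Finset.mem_image.1 h
        exact v.2 hv) (max C 1)⁻¹ (inv_ne_zero (zero_lt_one.trans_le (le_max_right C 1)).ne')
    refine ⟨d, hdA, hd, fun v => ?_⟩
    rw [Valuation.mem_valuationSubring_iff, mul_apply, map_mul, algebraMap_apply,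
      valued_algebraMap]
    by_cases hv : Valued.v (a v) ≤ 1
    · exact mul_le_one' (hdA v.1 v.2) hv
    · have h1 := hdle v.1 (Finset.mem_image_of_mem _ (hfin.mem_toFinset.2 hv))
      have h2 : Valued.v (a v) ≤ max C 1 := (hC ⟨v, hv, rfl⟩).trans (le_max_left _ _)
      calc _ ≤ (max C 1)⁻¹ * max C 1 := by gcongr
        _ = 1 := inv_mul_cancel₀ (zero_lt_one.trans_le (le_max_right C 1)).ne'
  choose d hdA hd hda using fun i => key (a i)
  refine ⟨∏ i, d i, prod_mem fun i _ => hdA i, Finset.prod_ne_zero_iff.2 fun i _ => hd i,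
    fun i => ?_⟩
  rw [← Finset.prod_erase_mul _ _ (Finset.mem_univ i), map_mul, mul_assoc]
  exact mul_mem (algebraMap_mem_integralAdeles ⟨_, prod_mem fun i _ => hdA i⟩) (hda i)

/-- A nonzero component can be given a pole by a factor from `K`. This is why a homomorphism on
`K/A` determines its multiplier in `R`. -/
theorem eq_zero_of_forall_mul_mem (a : P.FiniteAdele)
    (h : ∀ x : K, algebraMap K _ x * a ∈ P.integralAdeles) : a = 0 := by
  ext v
  by_contra hv
  have hv' : Valued.v (a v) ≠ 0 := (Valuation.ne_zero_iff _).2 hv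
  obtain ⟨x, hx⟩ := v.1.surjective (WithZero.exp 1 * (Valued.v (a v))⁻¹)
  have h1 := h x v
  rw [Valuation.mem_valuationSubring_iff, mul_apply, map_mul, algebraMap_apply,
    valued_algebraMap, hx, inv_mul_cancel_right₀ hv', ← WithZero.exp_zero,
    WithZero.exp_le_exp] at h1
  exact absurd h1 (by simp)

end FiniteAdele

instance : IsFractionRing P.regularRing K := by
  refine IsFractionRing.of_field _ _ fun z => ?_
  obtain ⟨d, hdA, hd, h⟩ := FiniteAdele.exists_denominator
    fun _ : Unit => algebraMap K P.FiniteAdele z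
  refine ⟨⟨d * z, FiniteAdele.algebraMap_mem_integralAdeles_iff.1 ?_⟩, ⟨d, hdA⟩, ?_⟩
  · rw [map_mul]
    exact h ()
  · exact (mul_div_cancel_left₀ z hd).symm

end Place

open Place

/-! ### The rank condition as a spanning condition -/

section rank
variable {K : Type*} [Field K] {P : Place K}

theorem exists_smul_mem_of_mem_span [IsGlobalFunctionField K] {V : Type*} [AddCommGroup V]
    [Module K V] (Λ : Submodule P.regularRing V) {x : V} (hx : x ∈ Submodule.span K (Λ : Set V)) :
    ∃ d : P.regularRing, d ≠ 0 ∧ d • x ∈ Λ := by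
  have hid := isLocalizedModule_id (nonZeroDivisors P.regularRing) V K
  have h := Submodule.localized'_eq_span K (nonZeroDivisors P.regularRing)
    (LinearMap.id : V →ₗ[P.regularRing] V) Λ
  rw [LinearMap.id_coe, Set.image_id] at h
  rw [← h] at hx
  obtain ⟨m, hm, s, rfl⟩ := (Submodule.mem_localized' ..).1 hx
  refine ⟨s, nonZeroDivisors.ne_zero s.2, ?_⟩
  have h1 := IsLocalizedModule.mk'_cancel' (LinearMap.id : V →ₗ[P.regularRing] V) m s
  rw [LinearMap.id_apply] at h1
  rwa [← h1] at hm

/-- `K ⊗ Λ` is the localization `KΛ`, so `K_∞ ⊗_A Λ = K_∞ ⊗_K KΛ` has the dimension of `KΛ`. The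
rank condition thus becomes the one in `Submodule.IsLattice`. -/
theorem nonempty_tensor_equiv_iff [IsGlobalFunctionField K] {n : ℕ}
    (Λ : Submodule P.regularRing (Fin n → K)) :
    Nonempty ((P.completion ⊗[P.regularRing] Λ) ≃ₗ[P.completion] (Fin n → P.completion)) ↔
      Submodule.span K (Λ : Set (Fin n → K)) = ⊤ := by
  have hid := isLocalizedModule_id (nonZeroDivisors P.regularRing) (Fin n → K) K
  let S := Submodule.localized' K (nonZeroDivisors P.regularRing)
    (LinearMap.id : (Fin n → K) →ₗ[P.regularRing] (Fin n → K)) Λ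
  have hS : S = Submodule.span K (Λ : Set (Fin n → K)) := by
    simpa [S] using Submodule.localized'_eq_span K (nonZeroDivisors P.regularRing)
      (LinearMap.id : (Fin n → K) →ₗ[P.regularRing] (Fin n → K)) Λ
  have hbc : IsBaseChange K (Submodule.toLocalized' K (nonZeroDivisors P.regularRing)
    (LinearMap.id : (Fin n → K) →ₗ[P.regularRing] (Fin n → K)) Λ) :=
    (isLocalizedModule_iff_isBaseChange (nonZeroDivisors P.regularRing) K _).1 inferInstance
  let e : (P.completion ⊗[P.regularRing] Λ) ≃ₗ[P.completion] P.completion ⊗[K] S :=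
    (TensorProduct.AlgebraTensorModule.cancelBaseChange P.regularRing K P.completion P.completion Λ).symm
      ≪≫ₗ TensorProduct.AlgebraTensorModule.congr (LinearEquiv.refl _ _) hbc.equiv
  have hrank : Module.finrank P.completion (P.completion ⊗[P.regularRing] Λ) =
      Module.finrank K S := by
    rw [e.finrank_eq, Module.finrank_baseChange]
  have : Module.Finite P.completion (P.completion ⊗[P.regularRing] Λ) :=
    Module.Finite.equiv e.symm
  rw [← hS]
  constructor
  · rintro ⟨f⟩
    refine Submodule.eq_top_of_finrank_eq ?_
    rw [← hrank, f.finrank_eq]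
    simp
  · intro h
    refine ⟨LinearEquiv.ofFinrankEq _ _ ?_⟩
    rw [hrank, h]
    simp
end rank

/-! ### The lattices `Rⁿ g⁻¹ ∩ Kⁿ` -/

section adelic
variable {K : Type*} [Field K] {P : Place K} {n : ℕ}

theorem vecMul_mem_integralAdeles {y : Fin n → P.FiniteAdele} (hy : ∀ i, y i ∈ P.integralAdeles)
    {M : Matrix (Fin n) (Fin n) P.FiniteAdele} (hM : ∀ i j, M i j ∈ P.integralAdeles) (i : Fin n) :
    (y ᵥ* M) i ∈ P.integralAdeles :=
  sum_mem fun j _ => mul_mem (hy j) (hM j i)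

theorem mem_adelicLattice_iff {g : GL (Fin n) P.FiniteAdele} {y : Fin n → P.FiniteAdele} :
    y ∈ adelicLattice g ↔ ∀ i, (y ᵥ* g.val) i ∈ P.integralAdeles := by
  constructor
  · rintro ⟨r, rfl⟩ i
    rw [Matrix.vecMul_vecMul, ← Units.val_mul, inv_mul_cancel, Units.val_one, Matrix.vecMul_one]
    exact (r i).2
  · intro h
    refine ⟨fun i => ⟨_, h i⟩, ?_⟩
    change y = (y ᵥ* g.val) ᵥ* _
    rw [Matrix.vecMul_vecMul, ← Units.val_mul, mul_inv_cancel, Units.val_one, Matrix.vecMul_one]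

theorem vecMul_inv_mem_adelicLattice {g : GL (Fin n) P.FiniteAdele} {r : Fin n → P.FiniteAdele}
    (hr : ∀ i, r i ∈ P.integralAdeles) :
    r ᵥ* (g⁻¹ : GL (Fin n) P.FiniteAdele).val ∈ adelicLattice g :=
  ⟨fun i => ⟨r i, hr i⟩, rfl⟩

variable [IsGlobalFunctionField K]

theorem Place.embVec_add (x y : Fin n → K) : P.embVec (x + y) = P.embVec x + P.embVec y :=
  funext fun _ => map_add _ _ _

theorem Place.embVec_sub (x y : Fin n → K) : P.embVec (x - y) = P.embVec x - P.embVec y :=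
  funext fun _ => map_sub _ _ _

theorem Place.embVec_smul (a : K) (x : Fin n → K) :
    P.embVec (a • x) = algebraMap K P.FiniteAdele a • P.embVec x :=
  funext fun i => map_mul _ a (x i)

theorem Place.embVec_vecMul (x : Fin n → K) (γ : Matrix (Fin n) (Fin n) K) :
    P.embVec (x ᵥ* γ) = P.embVec x ᵥ* γ.map (algebraMap K P.FiniteAdele) :=
  funext fun i => RingHom.map_vecMul _ _ _ i

theorem Place.embVec_mem_iff {x : Fin n → K} :
    (∀ i, P.embVec x i ∈ P.integralAdeles) ↔ ∀ i, x i ∈ P.regularRing :=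
  forall_congr' fun _ => FiniteAdele.algebraMap_mem_integralAdeles_iff

theorem mem_latticeOf_iff {g : GL (Fin n) P.FiniteAdele} {x : Fin n → K} :
    x ∈ latticeOf g ↔ P.embVec x ∈ adelicLattice g := Iff.rfl

/-- `Rⁿ g⁻¹` contains a nonzero multiple of `Rⁿ`. -/
theorem exists_smul_mem_adelicLattice (g : GL (Fin n) P.FiniteAdele) :
    ∃ d ∈ P.regularRing, d ≠ 0 ∧ ∀ r : Fin n → P.FiniteAdele, (∀ i, r i ∈ P.integralAdeles) →
      algebraMap K P.FiniteAdele d • r ∈ adelicLattice g := by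
  obtain ⟨d, hdA, hd, h⟩ := FiniteAdele.exists_denominator
    fun ij : Fin n × Fin n => g.val ij.1 ij.2
  refine ⟨d, hdA, hd, fun r hr => mem_adelicLattice_iff.2 fun i => ?_⟩
  have h1 : (algebraMap K P.FiniteAdele d • r) ᵥ* g.val =
      r ᵥ* (algebraMap K P.FiniteAdele d • g.val) := by
    rw [Matrix.smul_vecMul, Matrix.vecMul_smul]
  rw [h1]
  exact vecMul_mem_integralAdeles hr (fun i j => h (i, j)) i

/-- A nonzero multiple of `Rⁿ g⁻¹` is contained in `Rⁿ`. -/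
theorem exists_smul_mem_integralAdeles (g : GL (Fin n) P.FiniteAdele) :
    ∃ d ∈ P.regularRing, d ≠ 0 ∧ ∀ y ∈ adelicLattice g,
      ∀ i, algebraMap K P.FiniteAdele d * y i ∈ P.integralAdeles := by
  obtain ⟨d, hdA, hd, h⟩ := FiniteAdele.exists_denominator
    fun ij : Fin n × Fin n => (g⁻¹).val ij.1 ij.2
  refine ⟨d, hdA, hd, ?_⟩
  rintro _ ⟨r, rfl⟩ i
  rw [← smul_eq_mul, ← Pi.smul_apply, ← Matrix.vecMul_smul]
  exact vecMul_mem_integralAdeles (fun i => (r i).2) (fun i j => h (i, j)) i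

/-- `𝔸_{K,f}ⁿ = Kⁿ + d Rⁿ`. -/
theorem exists_eq_embVec_add_smul (y : Fin n → P.FiniteAdele) {d : K} (hd : d ≠ 0) :
    ∃ (x : Fin n → K) (r : Fin n → P.FiniteAdele), (∀ i, r i ∈ P.integralAdeles) ∧
      y = P.embVec x + algebraMap K P.FiniteAdele d • r := by
  choose x r h using fun i => FiniteAdele.exists_eq_add_mul (y i) hd
  exact ⟨x, fun i => r i, fun i => (r i).2, funext h⟩

/-- Strong approximation modulo `d Rⁿ ⊂ Rⁿ g⁻¹`. It makes `Kⁿ/Λ → 𝔸_fⁿ/Rⁿ g⁻¹` surjective, so that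
`ρ g⁻¹` is defined on all of `(K/A)ⁿ`. -/
theorem exists_sub_mem_adelicLattice (g : GL (Fin n) P.FiniteAdele) (y : Fin n → P.FiniteAdele) :
    ∃ x : Fin n → K, y - P.embVec x ∈ adelicLattice g := by
  obtain ⟨d, -, hd, h⟩ := exists_smul_mem_adelicLattice g
  obtain ⟨x, r, hr, rfl⟩ := exists_eq_embVec_add_smul y hd
  refine ⟨x, ?_⟩
  rw [add_sub_cancel_left]
  exact h r hr

/-- Finite generation holds inside `d⁻¹ Aⁿ` because `A` is Noetherian; spanning holds because every
vector has a nonzero multiple in `d Aⁿ`, with `d Rⁿ ⊂ Rⁿ g⁻¹`. -/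
instance isLattice_latticeOf (g : GL (Fin n) P.FiniteAdele) :
    Submodule.IsLattice K (latticeOf g) where
  fg := by
    obtain ⟨d, -, hd, h⟩ := exists_smul_mem_integralAdeles g
    let N : Submodule P.regularRing (Fin n → K) :=
      Submodule.span P.regularRing (Set.range fun i => Pi.single i d⁻¹)
    have hN : N.FG := Submodule.fg_span (Set.finite_range _)
    have : IsNoetherian P.regularRing N := isNoetherian_of_fg_of_noetherian _ hN
    refine isNoetherian_submodule.1 this _ fun x hx => ?_
    have hx' (i) : d * x i ∈ P.regularRing := by
      rw [← FiniteAdele.algebraMap_mem_integralAdeles_iff, map_mul]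
      exact h _ hx i
    have : x = ∑ i, (⟨d * x i, hx' i⟩ : P.regularRing) • Pi.single i d⁻¹ := by
      funext j
      rw [Finset.sum_apply, Finset.sum_eq_single j]
      · rw [Pi.smul_apply, Pi.single_eq_same, Subring.smul_def, smul_eq_mul]
        field_simp
      · intro i _ hij
        rw [Pi.smul_apply, Pi.single_eq_of_ne hij.symm, smul_zero]
      · simp
    rw [this]
    exact sum_mem fun i _ => N.smul_mem _ (Submodule.subset_span ⟨i, rfl⟩)
  span_eq_top := by
    obtain ⟨d, hdA, hd, h⟩ := exists_smul_mem_adelicLattice g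
    refine eq_top_iff.2 fun x _ => ?_
    obtain ⟨e, heA, he, h'⟩ := FiniteAdele.exists_denominator (P.embVec x)
    have h1 : (d * e) • x ∈ latticeOf g := by
      rw [mem_latticeOf_iff, mul_smul, embVec_smul, embVec_smul]
      exact h _ h'
    have h2 := Submodule.smul_mem _ (d * e)⁻¹ (Submodule.subset_span (R := K) h1)
    rwa [inv_smul_smul₀ (mul_ne_zero hd he)] at h2

/-- `Rⁿ g⁻¹` is determined by `Λ(g)`. -/
theorem adelicLattice_le_of_latticeOf_le {g g' : GL (Fin n) P.FiniteAdele}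
    (h : latticeOf g ≤ latticeOf g') : adelicLattice g ≤ adelicLattice g' := by
  intro y hy
  obtain ⟨d, hdA, hd, hg⟩ := exists_smul_mem_adelicLattice g
  obtain ⟨d', hdA', hd', hg'⟩ := exists_smul_mem_adelicLattice g'
  -- Modulo `d d' Rⁿ`, contained in both adelic lattices, `y` may be replaced by an element of `Kⁿ`,
  -- to which `h` applies.
  obtain ⟨x, r, hr, rfl⟩ := exists_eq_embVec_add_smul y (mul_ne_zero hd hd')
  have hr' (a : K) (ha : a ∈ P.regularRing) (i) :
      (algebraMap K P.FiniteAdele a • r) i ∈ P.integralAdeles :=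
    mul_mem (algebraMap_mem_integralAdeles ⟨a, ha⟩) (hr i)
  have h1 : algebraMap K P.FiniteAdele (d * d') • r ∈ adelicLattice g := by
    rw [map_mul, mul_smul]
    exact hg _ (hr' d' hdA')
  have h2 : algebraMap K P.FiniteAdele (d * d') • r ∈ adelicLattice g' := by
    rw [mul_comm, map_mul, mul_smul]
    exact hg' _ (hr' d hdA)
  refine add_mem (h ?_) h2
  rw [mem_latticeOf_iff]
  simpa using sub_mem hy h1

/-- The rows of `g⁻¹` lie in `Rⁿ g⁻¹ = Rⁿ g'⁻¹`, so `g⁻¹ g'` has entries in `R`; by symmetry so has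
its inverse. -/
theorem exists_eq_mul_map_of_latticeOf_eq {g g' : GL (Fin n) P.FiniteAdele}
    (h : latticeOf g = latticeOf g') :
    ∃ m : GL (Fin n) P.integralAdeles,
      g' = g * Matrix.GeneralLinearGroup.map P.integralAdeles.subtype m := by
  have key {g g' : GL (Fin n) P.FiniteAdele} (h : latticeOf g = latticeOf g') (i j) :
      (g⁻¹ * g').val i j ∈ P.integralAdeles := by
    have h1 : (Pi.single i 1 : Fin n → P.FiniteAdele) ᵥ* (g⁻¹).val ∈ adelicLattice g := by
      refine vecMul_inv_mem_adelicLattice fun k => ?_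
      rw [Pi.single_apply]
      split_ifs
      exacts [one_mem _, zero_mem _]
    have h2 := mem_adelicLattice_iff.1 (adelicLattice_le_of_latticeOf_le h.le h1) j
    rw [Matrix.vecMul_vecMul, ← Units.val_mul] at h2
    simpa using h2
  let m : Matrix (Fin n) (Fin n) P.integralAdeles := fun i j => ⟨_, key h i j⟩
  let m' : Matrix (Fin n) (Fin n) P.integralAdeles := fun i j => ⟨_, key h.symm i j⟩
  have hm : m.map P.integralAdeles.subtype = (g⁻¹ * g').val := rfl
  have hm' : m'.map P.integralAdeles.subtype = (g'⁻¹ * g).val := rfl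
  have hinj : Function.Injective
      fun M : Matrix (Fin n) (Fin n) P.integralAdeles => M.map P.integralAdeles.subtype :=
    Matrix.map_injective Subtype.val_injective
  refine ⟨⟨m, m', hinj ?_, hinj ?_⟩, ?_⟩
  · simp only [Matrix.map_mul, hm, hm', ← Units.val_mul]
    simp
  · simp only [Matrix.map_mul, hm, hm', ← Units.val_mul]
    simp
  · refine Units.ext ?_
    change g'.val = g.val * m.map P.integralAdeles.subtype
    rw [hm, ← Units.val_mul, mul_inv_cancel_left]

end adelic

/-- A lattice over a principal ideal domain is the row space of an invertible matrix. -/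
theorem Submodule.IsLattice.exists_matrix {R L : Type*} [CommRing R] [IsDomain R]
    [IsPrincipalIdealRing R] [Field L] [Algebra R L] [IsFractionRing R L] {n : ℕ}
    (M : Submodule R (Fin n → L)) [M.IsLattice L] :
    ∃ h : GL (Fin n) L, ∀ y : Fin n → L,
      y ∈ M ↔ ∃ r : Fin n → R, y = (fun i => algebraMap R L (r i)) ᵥ* h.val := by
  have : Module.Free R M := IsLattice.free L M
  let b₀ := Module.Free.chooseBasis R M
  let e := b₀.indexEquiv ((Module.finBasisOfFinrankEq R M
    ((IsLattice.finrank_of_pi L M).trans (Fintype.card_fin n))))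
  let b := b₀.reindex e
  let B := b.extendOfIsLattice L
  have hB (i) : B i = (b i : Fin n → L) := Module.Basis.extendOfIsLattice_apply L b i
  have hu : IsUnit (Matrix.of fun i j => (b i : Fin n → L) j) := by
    rw [← Matrix.linearIndependent_rows_iff_isUnit]
    have := B.linearIndependent
    rwa [show (B : Fin n → Fin n → L) = fun i => (b i : Fin n → L) from funext hB] at this
  obtain ⟨h, hh⟩ := hu
  have hsum (r : Fin n → R) : (fun i => algebraMap R L (r i)) ᵥ* h.val =
      ∑ i, r i • (b i : Fin n → L) := by
    rw [hh]
    funext j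
    simp [Matrix.vecMul, dotProduct, Algebra.smul_def]
  refine ⟨h, fun y => ⟨fun hy => ⟨b.repr ⟨y, hy⟩, ?_⟩, ?_⟩⟩
  · rw [hsum]
    refine (congrArg Subtype.val (b.sum_repr ⟨y, hy⟩)).symm.trans ?_
    rw [AddSubmonoidClass.coe_finsetSum]
    rfl
  · rintro ⟨r, rfl⟩
    rw [hsum]
    exact sum_mem fun i _ => M.smul_mem _ (b i).2

/-! ### Every lattice comes from an adelic matrix -/

section
variable {K : Type*} [Field K] {P : Place K} {n : ℕ}

/-- Being `1` at almost all places puts the entries of both the matrices and their inverses into the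
restricted product. -/
theorem exists_GL_of_components (h : ∀ v : {v : Place K // v ≠ P}, GL (Fin n) v.1.completion)
    (hfin : {v | h v ≠ 1}.Finite) :
    ∃ g : GL (Fin n) P.FiniteAdele, ∀ v i j, g.val i j v = (h v).val i j := by
  have mk (h : ∀ v : {v : Place K // v ≠ P}, GL (Fin n) v.1.completion)
      (hfin : {v | h v ≠ 1}.Finite) (i j : Fin n) :
      ∃ a : P.FiniteAdele, ∀ v, a v = (h v).val i j := by
    refine ⟨⟨fun v => (h v).val i j, ?_⟩, fun v => rfl⟩
    rw [Filter.eventually_cofinite]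
    refine hfin.subset fun v hv hv1 => hv ?_
    change (h v).val i j ∈ v.1.integers
    rw [hv1, Units.val_one, Matrix.one_apply]
    split_ifs
    exacts [one_mem _, zero_mem _]
  choose a ha using mk h hfin
  choose b hb using mk (fun v => (h v)⁻¹) (by simpa using hfin)
  have key (a b : Matrix (Fin n) (Fin n) P.FiniteAdele)
      (h : ∀ v : {v : Place K // v ≠ P}, (a.map (FiniteAdele.component v)) *
        (b.map (FiniteAdele.component v)) = 1) : a * b = 1 := by
    ext i j v
    have h1 := congrFun (congrFun (h v) i) j
    rw [← Matrix.map_mul] at h1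
    refine h1.trans ?_
    rw [Matrix.one_apply, Matrix.one_apply]
    split_ifs <;> rfl
  have ha' (v) : (Matrix.of a).map (FiniteAdele.component v) = (h v).val :=
    Matrix.ext fun i j => ha i j v
  have hb' (v) : (Matrix.of b).map (FiniteAdele.component v) = ((h v)⁻¹).val :=
    Matrix.ext fun i j => hb i j v
  refine ⟨⟨Matrix.of a, Matrix.of b, key _ _ fun v => ?_, key _ _ fun v => ?_⟩,
    fun v i j => ha i j v⟩
  · rw [ha', hb', ← Units.val_mul, mul_inv_cancel, Units.val_one]
  · rw [ha', hb', ← Units.val_mul, inv_mul_cancel, Units.val_one]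

variable [IsGlobalFunctionField K]

/-- Together with `exists_smul_regular_of_isLattice` this places `Λ` between `d₁ Aⁿ` and `d₂⁻¹ Aⁿ`,
so that `Λ` is standard at all places where `d₁` and `d₂` are units. -/
theorem exists_smul_mem_of_isLattice (Λ : Submodule P.regularRing (Fin n → K)) [Λ.IsLattice K] :
    ∃ d ∈ P.regularRing, d ≠ 0 ∧ ∀ x : Fin n → K, (∀ i, x i ∈ P.regularRing) → d • x ∈ Λ := by
  have h (i : Fin n) : ∃ d : P.regularRing, d ≠ 0 ∧ d • (Pi.single i 1 : Fin n → K) ∈ Λ :=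
    exists_smul_mem_of_mem_span Λ (by rw [Submodule.IsLattice.span_eq_top]; trivial)
  choose d hd hdΛ using h
  refine ⟨(∏ i, d i : P.regularRing), (∏ i, d i).2, ?_, fun x hx => ?_⟩
  · rw [Ne, ZeroMemClass.coe_eq_zero]
    exact Finset.prod_ne_zero_iff.2 fun i _ => hd i
  · have h1 : ((∏ i, d i : P.regularRing) : K) • x = ∑ i, ((⟨x i, hx i⟩ : P.regularRing) *
        ∏ j ∈ Finset.univ.erase i, d j) • d i • (Pi.single i 1 : Fin n → K) := by
      conv_lhs => rw [pi_eq_sum_univ' x, Finset.smul_sum]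
      refine Finset.sum_congr rfl fun i _ => ?_
      rw [smul_smul _ (d i), mul_assoc, Finset.prod_erase_mul _ _ (Finset.mem_univ i),
        Subring.smul_def]
      funext j
      simp [Pi.single_apply, mul_comm]
    rw [h1]
    exact sum_mem fun i _ => Λ.smul_mem _ (hdΛ i)

theorem exists_smul_regular_of_isLattice (Λ : Submodule P.regularRing (Fin n → K))
    [Λ.IsLattice K] :
    ∃ d ∈ P.regularRing, d ≠ 0 ∧ ∀ x ∈ Λ, ∀ i, d * x i ∈ P.regularRing := by
  obtain ⟨m, l, hl⟩ := Submodule.fg_iff_exists_fin_generating_family.1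
    (Submodule.IsLattice.fg (M := Λ))
  obtain ⟨d, hdA, hd, h⟩ := FiniteAdele.exists_denominator
    fun ij : Fin m × Fin n => P.embVec (l ij.1) ij.2
  refine ⟨d, hdA, hd, fun x hx => ?_⟩
  rw [← hl] at hx
  induction hx using Submodule.span_induction with
  | mem x hx =>
    obtain ⟨j, rfl⟩ := hx
    intro i
    rw [← FiniteAdele.algebraMap_mem_integralAdeles_iff, map_mul]
    exact h (j, i)
  | zero => simp
  | add x y _ _ hx hy =>
    intro i
    rw [Pi.add_apply, mul_add]
    exact add_mem (hx i) (hy i)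
  | smul a x _ hx =>
    intro i
    have : d * (a • x) i = a * (d * x i) := by
      rw [Pi.smul_apply, Subring.smul_def, smul_eq_mul]
      ring
    rw [this]
    exact mul_mem a.2 (hx i)

/-- An element of `Kⁿ` that lies in the `A_v`-span of `Λ` for all `v ≠ ∞` lies in `Λ`. -/
theorem mem_of_forall_mem_span {m : ℕ} (l : Fin m → Fin n → K)
    [(Submodule.span P.regularRing (Set.range l)).IsLattice K] {x : Fin n → K}
    (hx : ∀ v : {v : Place K // v ≠ P}, (fun j => algebraMap K v.1.completion (x j)) ∈
      Submodule.span v.1.integers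
        (Set.range fun i j => algebraMap K v.1.completion (l i j))) :
    x ∈ Submodule.span P.regularRing (Set.range l) := by
  set Λ := Submodule.span P.regularRing (Set.range l) with hΛ
  obtain ⟨d₁, hA₁, hd₁, h₁⟩ := exists_smul_mem_of_isLattice Λ
  obtain ⟨d₂, hA₂, hd₂, h₂⟩ := exists_smul_regular_of_isLattice Λ
  have hl (i) : l i ∈ Λ := Submodule.subset_span ⟨i, rfl⟩
  choose c hc using fun v => (Submodule.mem_span_range_iff_exists_fun _).1 (hx v)
  have hcR (i) : ∃ a : P.integralAdeles, ∀ v, (a : P.FiniteAdele) v = c v i :=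
    ⟨⟨⟨fun v => c v i, Filter.Eventually.of_forall fun v => (c v i).2⟩, fun v => (c v i).2⟩,
      fun v => rfl⟩
  choose C hC using hcR
  have hsum (j) : algebraMap K P.FiniteAdele (x j) =
      ∑ i, (C i : P.FiniteAdele) * algebraMap K P.FiniteAdele (l i j) := by
    ext v
    have h := congrFun (hc v) j
    rw [← FiniteAdele.component_apply v (Finset.sum _ _), map_sum]
    simp only [map_mul, FiniteAdele.component_apply, hC]
    rw [Finset.sum_apply] at h
    exact h.symm
  -- The coefficients in `R` are replaced by elements of `A` modulo `d₁ d₂`. The error lies in `d₁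
  -- Aⁿ ⊂ Λ`, since `d₂` clears the denominators of the generators.
  choose a r har using fun i => FiniteAdele.exists_regular_eq_add_mul (C i)
    (mul_mem hA₁ hA₂) (mul_ne_zero hd₁ hd₂)
  have hrem : x - ∑ i, a i • l i ∈ Λ := by
    have h (j) : d₁⁻¹ * (x - ∑ i, a i • l i) j ∈ P.regularRing := by
      rw [← FiniteAdele.algebraMap_mem_integralAdeles_iff]
      have h3 : algebraMap K P.FiniteAdele (d₁⁻¹ * (x - ∑ i, a i • l i) j) =
          ∑ i, (r i : P.FiniteAdele) * algebraMap K P.FiniteAdele (d₂ * l i j) := by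
        have h4 : algebraMap K P.FiniteAdele d₁⁻¹ * algebraMap K _ d₁ = 1 := by
          rw [← map_mul, inv_mul_cancel₀ hd₁, map_one]
        rw [Pi.sub_apply, Finset.sum_apply, map_mul, map_sub, hsum, map_sum,
          ← Finset.sum_sub_distrib, Finset.mul_sum]
        refine Finset.sum_congr rfl fun i _ => ?_
        rw [har, Pi.smul_apply, Subring.smul_def, smul_eq_mul, map_mul, map_mul, map_mul]
        linear_combination (algebraMap K P.FiniteAdele d₂ * r i *
          algebraMap K P.FiniteAdele (l i j)) * h4
      rw [h3]
      exact sum_mem fun i _ => mul_mem (r i).2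
        (algebraMap_mem_integralAdeles ⟨_, h₂ _ (hl i) j⟩)
    have h5 := h₁ (d₁⁻¹ • (x - ∑ i, a i • l i)) h
    rwa [smul_inv_smul₀ hd₁] at h5
  have h6 := add_mem hrem (sum_mem (t := Finset.univ) fun i _ => Λ.smul_mem (a i) (hl i))
  rwa [sub_add_cancel] at h6

/-- Every lattice in `Kⁿ` is of the form `Rⁿ g⁻¹ ∩ Kⁿ`. -/
theorem exists_latticeOf_eq (Λ : Submodule P.regularRing (Fin n → K)) [Λ.IsLattice K] :
    ∃ g : GL (Fin n) P.FiniteAdele, latticeOf g = Λ := by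
  classical
  obtain ⟨m, l, hl⟩ := Submodule.fg_iff_exists_fin_generating_family.1
    (Submodule.IsLattice.fg (M := Λ))
  subst hl
  set Λ := Submodule.span P.regularRing (Set.range l) with hΛ
  obtain ⟨d₁, hA₁, hd₁, h₁⟩ := exists_smul_mem_of_isLattice Λ
  obtain ⟨d₂, hA₂, hd₂, h₂⟩ := exists_smul_regular_of_isLattice Λ
  have hlΛ (i) : l i ∈ Λ := Submodule.subset_span ⟨i, rfl⟩
  let emb (v : {v : Place K // v ≠ P}) (x : Fin n → K) : Fin n → v.1.completion :=
    fun j => algebraMap K v.1.completion (x j)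
  let M (v : {v : Place K // v ≠ P}) : Submodule v.1.integers (Fin n → v.1.completion) :=
    Submodule.span v.1.integers (Set.range fun i => emb v (l i))
  have hM (v) (x) (hx : x ∈ Λ) : emb v x ∈ M v := by
    induction hx using Submodule.span_induction with
    | mem x hx =>
      obtain ⟨i, rfl⟩ := hx
      exact Submodule.subset_span ⟨i, rfl⟩
    | zero =>
      have : emb v 0 = 0 := funext fun _ => map_zero _
      rw [this]
      exact zero_mem _
    | add x y _ _ hx hy =>
      have : emb v (x + y) = emb v x + emb v y := funext fun _ => map_add _ _ _
      rw [this]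
      exact add_mem hx hy
    | smul a x _ hx =>
      have ha : algebraMap K v.1.completion a ∈ v.1.integers := by
        rw [Valuation.mem_valuationSubring_iff, valued_algebraMap]
        exact a.2 v.1 v.2
      have : emb v (a • x) = (⟨_, ha⟩ : v.1.integers) • emb v x := funext fun _ => map_mul _ _ _
      rw [this]
      exact (M v).smul_mem _ hx
  have hsingle (v) (i) : emb v (d₁ • Pi.single i 1) =
      algebraMap K v.1.completion d₁ • Pi.single i 1 := by
    funext j
    simp only [emb, Pi.smul_apply, smul_eq_mul, map_mul, Pi.single_apply]
    split_ifs <;> simp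
  have hd₁M (v) (i) : algebraMap K v.1.completion d₁ • (Pi.single i 1 : Fin n → v.1.completion) ∈
      M v := by
    rw [← hsingle]
    refine hM v _ (h₁ _ fun j => ?_)
    rw [Pi.single_apply]
    split_ifs
    exacts [one_mem _, zero_mem _]
  have hlat (v) : (M v).IsLattice v.1.completion := by
    refine ⟨Submodule.fg_span (Set.finite_range _), eq_top_iff.2 ?_⟩
    rw [← (Pi.basisFun v.1.completion (Fin n)).span_eq, Submodule.span_le]
    rintro _ ⟨i, rfl⟩
    have h0 : algebraMap K v.1.completion d₁ ≠ 0 := (map_ne_zero _).2 hd₁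
    have h := Submodule.smul_mem _ (algebraMap K v.1.completion d₁)⁻¹
      (Submodule.subset_span (R := v.1.completion) (hd₁M v i))
    rw [inv_smul_smul₀ h0] at h
    simpa using h
  -- Freeness over the discrete valuation ring gives some `h` at each place; where `d₁` and `d₂` are
  -- units, `h` is chosen to be `1`, which makes the family adelic.
  have hloc (v : {v : Place K // v ≠ P}) : ∃ h : GL (Fin n) v.1.completion,
      (∀ y, y ∈ M v ↔ ∀ i, (y ᵥ* h.val) i ∈ v.1.integers) ∧
        (¬ v.1.val d₁ < 1 → ¬ v.1.val d₂ < 1 → h = 1) := by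
    by_cases hv : ¬ v.1.val d₁ < 1 ∧ ¬ v.1.val d₂ < 1
    · refine ⟨1, fun y => ?_, fun _ _ => rfl⟩
      rw [Units.val_one, Matrix.vecMul_one]
      constructor
      · intro hy
        induction hy using Submodule.span_induction with
        | mem y hy =>
          obtain ⟨i, rfl⟩ := hy
          intro j
          rw [Valuation.mem_valuationSubring_iff, valued_algebraMap]
          have h3 := h₂ _ (hlΛ i) j v.1 v.2
          rw [map_mul, le_antisymm (hA₂ v.1 v.2) (not_lt.1 hv.2), one_mul] at h3
          exact h3
        | zero => exact fun i => zero_mem _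
        | add x y _ _ hx hy => exact fun i => add_mem (hx i) (hy i)
        | smul a x _ hx => exact fun i => mul_mem a.2 (hx i)
      · intro hy
        have hd : (algebraMap K v.1.completion d₁)⁻¹ ∈ v.1.integers := by
          rw [Valuation.mem_valuationSubring_iff, map_inv₀, valued_algebraMap,
            le_antisymm (hA₁ v.1 v.2) (not_lt.1 hv.1), inv_one]
        have h0 : algebraMap K v.1.completion d₁ ≠ 0 := (map_ne_zero _).2 hd₁
        have h4 : y = ∑ i, (⟨y i, hy i⟩ * ⟨_, hd⟩ : v.1.integers) •
            algebraMap K v.1.completion d₁ • (Pi.single i 1 : Fin n → v.1.completion) := by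
          conv_lhs => rw [pi_eq_sum_univ' y]
          refine Finset.sum_congr rfl fun i _ => ?_
          rw [mul_smul]
          congr 1
          exact (inv_smul_smul₀ h0 _).symm
        rw [h4]
        exact sum_mem fun i _ => (M v).smul_mem _ (hd₁M v i)
    · obtain ⟨h, hh⟩ := Submodule.IsLattice.exists_matrix (M v)
      refine ⟨h⁻¹, fun y => (hh y).trans ⟨?_, fun hy => ⟨fun i => ⟨_, hy i⟩, ?_⟩⟩,
        fun a b => absurd ⟨a, b⟩ hv⟩
      · rintro ⟨r, rfl⟩ i
        rw [Matrix.vecMul_vecMul, ← Units.val_mul, mul_inv_cancel, Units.val_one,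
          Matrix.vecMul_one]
        exact (r i).2
      · change y = (y ᵥ* _) ᵥ* _
        rw [Matrix.vecMul_vecMul, ← Units.val_mul, inv_mul_cancel, Units.val_one,
          Matrix.vecMul_one]
  choose h hhM hh1 using hloc
  have hfin : {v | h v ≠ 1}.Finite := by
    refine (((finite_zeros d₁ hd₁).union (finite_zeros d₂ hd₂)).preimage
      Subtype.val_injective.injOn).subset fun v hv => ?_
    by_contra hn
    have hn' : ¬ (v.1.val d₁ < 1 ∨ v.1.val d₂ < 1) := hn
    rw [not_or] at hn'
    exact hv (hh1 v hn'.1 hn'.2)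
  obtain ⟨g, hg⟩ := exists_GL_of_components h hfin
  have hvec (x : Fin n → K) (v) (j) : (P.embVec x ᵥ* g.val) j v = (emb v x ᵥ* (h v).val) j := by
    rw [← FiniteAdele.component_apply v (Matrix.vecMul _ _ _)]
    simp only [Matrix.vecMul, dotProduct, map_sum, map_mul, FiniteAdele.component_apply, hg]
    rfl
  refine ⟨g, le_antisymm (fun x hx => mem_of_forall_mem_span l fun v => ?_) fun x hx => ?_⟩
  · refine (hhM v _).2 fun j => ?_
    rw [← hvec]
    exact mem_adelicLattice_iff.1 hx j v
  · rw [mem_latticeOf_iff, mem_adelicLattice_iff]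
    intro j v
    rw [hvec]
    exact (hhM v _).1 (hM v x hx) j

end

/-! ### `Hom_A(K/A, 𝔸_f/R) = R` -/

section homs
variable {K : Type*} [Field K] [IsGlobalFunctionField K] {P : Place K}

/-- An element of `K` that is integral at `v` has a denominator in `A` that is a unit at `v`. -/
theorem Place.exists_val_eq_one_mul_mem (v : {v : Place K // v ≠ P}) {x : K} (hx : v.1.val x ≤ 1) :
    ∃ s ∈ P.regularRing, v.1.val s = 1 ∧ s * x ∈ P.regularRing := by
  classical
  obtain ⟨d, hdA, hd, h⟩ := FiniteAdele.exists_denominator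
    fun _ : Unit => algebraMap K P.FiniteAdele x
  have hdx : d * x ∈ P.regularRing := by
    rw [← FiniteAdele.algebraMap_mem_integralAdeles_iff, map_mul]
    exact h ()
  obtain ⟨e, heA, he, hev⟩ := exists_regular_val_le P {v.1} (by simpa using v.2.symm)
    (WithZero.exp (-1)) WithZero.exp_ne_zero
  have hev' : v.1.val e < 1 := by
    refine (hev v.1 (Finset.mem_singleton_self _)).trans_lt ?_
    rw [← WithZero.exp_zero, WithZero.exp_lt_exp]
    simp
  -- `u` is the idempotent supported at `v`. An `s ∈ A` congruent to `u` modulo `e d` is a unit at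
  -- `v`, because `e` vanishes there, and is divisible by the denominator `d` at all other places.
  let u : P.integralAdeles := ⟨⟨fun w => if w = v then 1 else 0,
    Filter.Eventually.of_forall fun w => by
      change (if w = v then (1 : w.1.completion) else 0) ∈ w.1.integers
      split_ifs
      exacts [one_mem _, zero_mem _]⟩, fun w => by
      change (if w = v then (1 : w.1.completion) else 0) ∈ w.1.integers
      split_ifs
      exacts [one_mem _, zero_mem _]⟩
  have hu (w) : (u : P.FiniteAdele) w = if w = v then 1 else 0 := rfl
  obtain ⟨s, r, hsr⟩ := FiniteAdele.exists_regular_eq_add_mul u (mul_mem heA hdA) (mul_ne_zero he hd)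
  have hcomp (w) : algebraMap K w.1.completion s =
      (if w = v then 1 else 0) - algebraMap K w.1.completion (e * d) * (r : P.FiniteAdele) w := by
    have := congrArg (fun a : P.FiniteAdele => a w) hsr
    simp only [hu, FiniteAdele.add_apply, FiniteAdele.mul_apply,
      FiniteAdele.algebraMap_apply] at this
    rw [this, add_sub_cancel_right]
  have hsv : v.1.val s = 1 := by
    rw [← valued_algebraMap, hcomp, if_pos rfl]
    refine (Valuation.map_sub_eq_of_lt_left _ ?_).trans (map_one _)
    rw [map_one, map_mul, valued_algebraMap, map_mul]
    refine (mul_le_of_le_one_right' (r.2 v)).trans_lt ?_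
    exact (mul_le_of_le_one_right' (hdA v.1 v.2)).trans_lt hev'
  refine ⟨s, s.2, hsv, fun w hw => ?_⟩
  by_cases hwv : w = v.1
  · subst hwv
    rw [map_mul, hsv, one_mul]
    exact hx
  · have h1 := hcomp ⟨w, hw⟩
    rw [if_neg (fun h => hwv (congrArg Subtype.val h)), zero_sub] at h1
    rw [map_mul, ← valued_algebraMap w (s : K), h1, Valuation.map_neg, map_mul, valued_algebraMap,
      mul_right_comm, ← map_mul, mul_assoc, map_mul]
    exact mul_le_one' (mul_le_one' (heA w hw) (hdx w hw)) (r.2 ⟨w, hw⟩)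

/-- The local case of `Hom_A(K/A, 𝔸_{K,f}/R) = R`. -/
theorem exists_local_multiplier (v : {v : Place K // v ≠ P}) (h : K → v.1.completion)
    (hsmul : ∀ a ∈ P.regularRing, ∀ x, h (a * x) - algebraMap K _ a * h x ∈ v.1.integers)
    (hzero : ∀ a ∈ P.regularRing, h a ∈ v.1.integers) :
    ∃ r ∈ v.1.integers, ∀ x, h x - algebraMap K _ x * r ∈ v.1.integers := by
  -- Homogeneity extends from `A` to all `a` integral at `v`: a denominator of `a` that is a unit at
  -- `v` can be cancelled.
  have hsmul' (a : K) (ha : v.1.val a ≤ 1) (x : K) :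
      h (a * x) - algebraMap K _ a * h x ∈ v.1.integers := by
    obtain ⟨s, hsA, hs, hsa⟩ := exists_val_eq_one_mul_mem v ha
    have h1 := hsmul s hsA (a * x)
    have h2 := hsmul (s * a) hsa x
    rw [← mul_assoc] at h1
    have h3 := sub_mem h2 h1
    have h4 : h (s * a * x) - algebraMap K v.1.completion (s * a) * h x -
        (h (s * a * x) - algebraMap K v.1.completion s * h (a * x)) =
        algebraMap K v.1.completion s * (h (a * x) - algebraMap K _ a * h x) := by
      rw [map_mul]
      ring
    rw [h4, Valuation.mem_valuationSubring_iff, map_mul, valued_algebraMap, hs, one_mul] at h3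
    exact h3
  obtain ⟨π, hπ⟩ := v.1.surjective (WithZero.exp (-1))
  have hπ1 : v.1.val π < 1 := by
    rw [hπ, ← WithZero.exp_zero, WithZero.exp_lt_exp]
    simp
  have hπ0 : π ≠ 0 := by
    rw [← v.1.val.ne_zero_iff, hπ]
    exact WithZero.exp_ne_zero
  set ϖ : v.1.completion := algebraMap K v.1.completion π with hϖ
  have hϖ0 : ϖ ≠ 0 := (map_ne_zero _).2 hπ0
  have hϖ1 : ‖ϖ‖ < 1 := by
    rw [Valued.toNormedField.norm_lt_one_iff, valued_algebraMap]
    exact hπ1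
  -- If `h` is multiplication by `r₀` modulo `A_v`, then `ϖ ^ k * h (π⁻¹ ^ k)` equals `r₀` up to `ϖ
  -- ^ k`; so `r₀` is constructed as the limit.
  let r (k : ℕ) : v.1.completion := ϖ ^ k * h (π⁻¹ ^ k)
  have hstep (k : ℕ) : ‖r k - r (k + 1)‖ ≤ ‖ϖ‖ ^ k := by
    have h1 := hsmul' π hπ1.le (π⁻¹ ^ (k + 1))
    have h2 : π * π⁻¹ ^ (k + 1) = π⁻¹ ^ k := by
      rw [pow_succ']
      exact mul_inv_cancel_left₀ hπ0 _
    rw [h2, Valuation.mem_valuationSubring_iff, ← Valued.toNormedField.norm_le_one_iff] at h1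
    have h3 : r k - r (k + 1) = ϖ ^ k * (h (π⁻¹ ^ k) - ϖ * h (π⁻¹ ^ (k + 1))) := by
      simp only [r]
      ring
    rw [h3, norm_mul, norm_pow]
    exact mul_le_of_le_one_right (by positivity) h1
  have hcauchy : CauchySeq r := by
    refine cauchySeq_of_le_geometric ‖ϖ‖ 1 hϖ1 fun k => ?_
    rw [dist_eq_norm, one_mul]
    exact hstep k
  obtain ⟨r₀, hr₀⟩ := cauchySeq_tendsto_of_complete hcauchy
  have hdiff (k m : ℕ) : ‖r k - r (k + m)‖ ≤ ‖ϖ‖ ^ k := by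
    induction m with
    | zero => simp
    | succ m ih =>
      rw [← sub_add_sub_cancel _ (r (k + m)) _]
      refine (IsUltrametricDist.norm_add_le_max _ _).trans (max_le ih ((hstep _).trans ?_))
      exact pow_le_pow_of_le_one (norm_nonneg _) hϖ1.le (Nat.le_add_right k m)
  have hlim (k : ℕ) : ‖r k - r₀‖ ≤ ‖ϖ‖ ^ k := by
    refine le_of_tendsto ((hr₀.const_sub (r k)).norm) ?_
    filter_upwards [Filter.eventually_ge_atTop k] with m hm
    obtain ⟨j, rfl⟩ := Nat.exists_eq_add_of_le hm
    exact hdiff k j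
  -- Writing `x = (x π ^ k) π⁻¹ ^ k` with `x π ^ k` integral reduces the claim to the element `π⁻¹ ^
  -- k`.
  have key (x : K) : h x - algebraMap K _ x * r₀ ∈ v.1.integers := by
    obtain ⟨k, hk⟩ := (eventually_mul_pow_le (v.1.val x) (v.1.val π) 1 hπ1 one_ne_zero).exists
    rw [← map_pow, ← map_mul] at hk
    have h1 := hsmul' _ hk (π⁻¹ ^ k)
    have h2 : x * π ^ k * π⁻¹ ^ k = x := by
      rw [mul_assoc, ← mul_pow, mul_inv_cancel₀ hπ0, one_pow, mul_one]
    rw [h2] at h1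
    have h3 : h x - algebraMap K _ x * r₀ =
        (h x - algebraMap K v.1.completion (x * π ^ k) * h (π⁻¹ ^ k)) +
        algebraMap K v.1.completion x * (r k - r₀) := by
      simp only [r, map_mul, map_pow, ← hϖ]
      ring
    rw [h3]
    refine add_mem h1 ?_
    rw [Valuation.mem_valuationSubring_iff, ← Valued.toNormedField.norm_le_one_iff, norm_mul]
    refine (mul_le_mul_of_nonneg_left (hlim k) (norm_nonneg _)).trans ?_
    rw [← norm_pow, ← norm_mul, Valued.toNormedField.norm_le_one_iff, hϖ, ← map_pow, ← map_mul,
      valued_algebraMap]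
    exact hk
  refine ⟨r₀, ?_, key⟩
  have h1 := sub_mem (hzero 1 (one_mem _)) (key 1)
  rwa [map_one, one_mul, sub_sub_cancel] at h1

/-- `Hom_A(K/A, 𝔸_{K,f}/R) = R`: a map `K → 𝔸_{K,f}` that is `A`-homogeneous modulo `R` and maps `A` to
`R` is, modulo `R`, the multiplication by an integral adele. -/
theorem exists_multiplier (h : K → P.FiniteAdele)
    (hsmul : ∀ a ∈ P.regularRing, ∀ x,
      h (a * x) - algebraMap K P.FiniteAdele a * h x ∈ P.integralAdeles)
    (hzero : ∀ a ∈ P.regularRing, h a ∈ P.integralAdeles) :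
    ∃ r : P.integralAdeles, ∀ x,
      h x - algebraMap K P.FiniteAdele x * r ∈ P.integralAdeles := by
  choose r hr h1 using fun v : {v : Place K // v ≠ P} =>
    exists_local_multiplier v (fun x => h x v) (fun a ha x => hsmul a ha x v) (fun a ha => hzero a ha v)
  exact ⟨⟨⟨r, Filter.Eventually.of_forall hr⟩, hr⟩, fun x v => h1 v x⟩

end homs

/-! ### Pairs `(Λ, φ)` and their images under linear maps -/

section generic
variable {K : Type*} [Field K] {P : Place K} {n : ℕ}
variable {V V' V'' : Type*} [AddCommGroup V] [Module K V] [AddCommGroup V'] [Module K V']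
  [AddCommGroup V''] [Module K V'']

theorem ratQuotient_mk_eq_iff {Λ : Submodule P.regularRing V} {y y' : ratSpan Λ} :
    (Submodule.Quotient.mk y : RatQuotient Λ) = Submodule.Quotient.mk y' ↔ (y - y' : V) ∈ Λ := by
  rw [Submodule.Quotient.eq]
  rfl

theorem kModA_mk_eq_iff {x x' : K} :
    (Submodule.Quotient.mk x : P.KModA) = Submodule.Quotient.mk x' ↔ x - x' ∈ P.regularRing := by
  rw [Submodule.Quotient.eq]
  exact ⟨fun ⟨a, ha⟩ => ha ▸ a.2, fun h => ⟨⟨_, h⟩, rfl⟩⟩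

theorem exists_kModA_mk_eq (q : Fin n → P.KModA) :
    ∃ x : Fin n → K, (fun i => Submodule.Quotient.mk (x i)) = q := by
  choose x hx using fun i => Submodule.Quotient.mk_surjective _ (q i)
  exact ⟨x, funext hx⟩

theorem RatPair.exists_apply_eq_mk (L : RatPair P n V) (x : Fin n → K) :
    ∃ y : ratSpan L.Λ, L.φ (fun i => Submodule.Quotient.mk (x i)) = Submodule.Quotient.mk y := by
  obtain ⟨y, hy⟩ := Submodule.Quotient.mk_surjective _ (L.φ fun i => Submodule.Quotient.mk (x i))
  exact ⟨y, hy.symm⟩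

theorem RatPair.mapsTo_map (f : V →ₗ[K] V') (L : RatPair P n V) :
    ∃ L' : RatPair P n V', L.MapsTo f L' :=
  ⟨⟨L.Λ.map (f.restrictScalars P.regularRing), (ratQuotientMap f le_rfl).comp L.φ⟩, rfl, rfl⟩

/-- The target of `φ` depends on `Λ`, so the two homomorphisms are compared through representatives
in the common space `V`. -/
theorem RatPair.ext_of_forall {L L' : RatPair P n V} (hΛ : L.Λ = L'.Λ)
    (hφ : ∀ (x : Fin n → K) (y : ratSpan L.Λ) (y' : ratSpan L'.Λ), (y : V) = y' →
      L.φ (fun i => Submodule.Quotient.mk (x i)) = Submodule.Quotient.mk y →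
      L'.φ (fun i => Submodule.Quotient.mk (x i)) = Submodule.Quotient.mk y') : L = L' := by
  obtain ⟨Λ, φ⟩ := L
  obtain ⟨Λ', φ'⟩ := L'
  obtain rfl : Λ = Λ' := hΛ
  congr 1
  refine LinearMap.ext fun q => ?_
  obtain ⟨x, rfl⟩ := exists_kModA_mk_eq q
  obtain ⟨y, hy⟩ := Submodule.Quotient.mk_surjective _ (φ fun i => Submodule.Quotient.mk (x i))
  rw [← hy]
  exact (hφ x y y rfl hy.symm).symm

theorem RatPair.MapsTo.right_unique {f : V →ₗ[K] V'} {L : RatPair P n V} {L₁ L₂ : RatPair P n V'}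
    (h₁ : L.MapsTo f L₁) (h₂ : L.MapsTo f L₂) : L₁ = L₂ := by
  have key : ∀ L' : RatPair P n V', L.MapsTo f L' →
      L' = ⟨L.Λ.map (f.restrictScalars P.regularRing), (ratQuotientMap f le_rfl).comp L.φ⟩ := by
    rintro ⟨Λ, φ⟩ ⟨hΛ, hφ⟩
    dsimp only at hΛ hφ
    subst hΛ
    rw [hφ]
  rw [key _ h₁, key _ h₂]

theorem RatPair.MapsTo.apply_eq_mk {f : V →ₗ[K] V'} {L : RatPair P n V} {L' : RatPair P n V'}
    (h : L.MapsTo f L') {q : Fin n → P.KModA} {y : ratSpan L.Λ} {y' : ratSpan L'.Λ}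
    (hy : (y' : V') = f y) (hq : L.φ q = Submodule.Quotient.mk y) :
    L'.φ q = Submodule.Quotient.mk y' := by
  obtain ⟨hΛ, hφ⟩ := h
  rw [hφ, LinearMap.comp_apply, hq]
  exact ratQuotientMap_mk f hΛ.le y y' hy

theorem RatPair.MapsTo.mem_span {f : V →ₗ[K] V'} {L : RatPair P n V} {L' : RatPair P n V'}
    (h : L.MapsTo f L') (y : ratSpan L.Λ) : f y ∈ ratSpan L'.Λ := by
  obtain ⟨hΛ, -⟩ := h
  have h1 : Submodule.span K (L.Λ : Set V) ≤ (Submodule.span K (L'.Λ : Set V')).comap f :=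
    Submodule.span_le.2 fun y hy =>
      Submodule.subset_span (hΛ.le (Submodule.mem_map_of_mem hy))
  exact h1 y.2

theorem RatPair.mapsTo_of_forall {f : V →ₗ[K] V'} {L : RatPair P n V} {L' : RatPair P n V'}
    (hΛ : L.Λ.map (f.restrictScalars P.regularRing) = L'.Λ)
    (hφ : ∀ (x : Fin n → K) (y : ratSpan L.Λ) (y' : ratSpan L'.Λ), (y' : V') = f y →
      L.φ (fun i => Submodule.Quotient.mk (x i)) = Submodule.Quotient.mk y →
      L'.φ (fun i => Submodule.Quotient.mk (x i)) = Submodule.Quotient.mk y') :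
    L.MapsTo f L' := by
  obtain ⟨L'', h⟩ := L.mapsTo_map f
  have : L'' = L' := by
    refine RatPair.ext_of_forall (h.1.symm.trans hΛ) fun x y y' hy hxy => ?_
    obtain ⟨z, hz⟩ := Submodule.Quotient.mk_surjective _
      (L.φ fun i => Submodule.Quotient.mk (x i))
    have h1 := h.apply_eq_mk (y' := ⟨f z, h.mem_span z⟩) rfl hz.symm
    rw [h1, ratQuotient_mk_eq_iff] at hxy
    have hz' : f z ∈ ratSpan L'.Λ := by
      rw [← hΛ, h.1]
      exact h.mem_span z
    rw [hφ x z ⟨f z, hz'⟩ rfl hz.symm, ratQuotient_mk_eq_iff]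
    change f z - (y' : V') ∈ L'.Λ
    rw [← hy]
    exact (h.1.symm.trans hΛ).le hxy
  rwa [← this]

/-- If `f` is injective and `f ∘ e` and `f` have the same image pair, then `e` carries one source to
the other. -/
theorem RatPair.MapsTo.of_comp {f : V' →ₗ[K] V''} (hf : Function.Injective f) {e : V →ₗ[K] V'}
    {L : RatPair P n V} {L' : RatPair P n V'} {L'' : RatPair P n V''}
    (h : L.MapsTo (f.comp e) L'') (h' : L'.MapsTo f L'') : L.MapsTo e L' := by
  have hinj : Function.Injective (f.restrictScalars P.regularRing) := hf
  have hΛ : L.Λ.map (e.restrictScalars P.regularRing) = L'.Λ := by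
    apply Submodule.map_injective_of_injective hinj
    rw [h'.1, ← h.1, ← Submodule.map_comp]
    rfl
  refine RatPair.mapsTo_of_forall hΛ fun x y y' hy hxy => ?_
  have h1 := h.apply_eq_mk (y' := ⟨f (e y), h.mem_span y⟩) rfl hxy
  obtain ⟨z, hz⟩ := Submodule.Quotient.mk_surjective _ (L'.φ fun i => Submodule.Quotient.mk (x i))
  have h2 := h'.apply_eq_mk (y' := ⟨f z, h'.mem_span z⟩) rfl hz.symm
  rw [h2, ratQuotient_mk_eq_iff] at h1
  change f z - f (e y) ∈ L''.Λ at h1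
  rw [← h'.1] at h1
  rw [← hz, ratQuotient_mk_eq_iff, hy]
  obtain ⟨w, hw, hwz⟩ := h1
  have : w = z - e y := hf (hwz.trans (map_sub f _ _).symm)
  rwa [← this]

/-- A homomorphism `(K/A)ⁿ → Kⁿ/Λ` is the same as an `A`-linear relation. -/
theorem exists_hom_of_relation (Λ : Submodule P.regularRing (Fin n → K))
    (hΛ : Submodule.span K (Λ : Set (Fin n → K)) = ⊤)
    (Rel : Submodule P.regularRing ((Fin n → K) × (Fin n → K)))
    (hex : ∀ x, ∃ y, (x, y) ∈ Rel)
    (hRel : ∀ x y, (∀ i, x i ∈ P.regularRing) → ((x, y) ∈ Rel ↔ y ∈ Λ)) :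
    ∃ φ : (Fin n → P.KModA) →ₗ[P.regularRing] RatQuotient Λ, ∀ (x : Fin n → K) (y : ratSpan Λ),
      φ (fun i => Submodule.Quotient.mk (x i)) = Submodule.Quotient.mk y ↔
        (x, (y : Fin n → K)) ∈ Rel := by
  choose X hX using fun q : Fin n → P.KModA => exists_kModA_mk_eq q
  choose Y hY using hex
  have hspan (y : Fin n → K) : y ∈ ratSpan Λ := by
    change y ∈ Submodule.span K (Λ : Set (Fin n → K))
    rw [hΛ]
    trivial
  -- The partners under `Rel` of any lift of `q` fill exactly one coset of `Λ`; linearity of the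
  -- induced map follows from that of `Rel`.
  have huniq (q : Fin n → P.KModA) (x y : Fin n → K)
      (hx : (fun i => Submodule.Quotient.mk (x i)) = q) :
      (x, y) ∈ Rel ↔ Y (X q) - y ∈ Λ := by
    rw [← hX q] at hx
    have h1 (i) : X q i - x i ∈ P.regularRing := kModA_mk_eq_iff.1 (congrFun hx i).symm
    rw [← hRel _ _ h1]
    exact ⟨fun h => Rel.sub_mem (hY (X q)) h, fun h => by
      have h2 := Rel.sub_mem (hY (X q)) h
      rwa [Prod.mk_sub_mk, sub_sub_cancel,
        show (X q - fun i => X q i - x i) = x from sub_sub_cancel _ _] at h2⟩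
  refine ⟨⟨⟨fun q => Submodule.Quotient.mk ⟨Y (X q), hspan _⟩, fun q q' => ?_⟩,
    fun a q => ?_⟩, fun x y => ?_⟩
  · rw [← Submodule.Quotient.mk_add, ratQuotient_mk_eq_iff]
    refine (huniq _ (X q + X q') _ ?_).1 (Rel.add_mem (hY _) (hY _))
    exact funext fun i => congrArg₂ (· + ·) (congrFun (hX q) i) (congrFun (hX q') i)
  · rw [RingHom.id_apply, ← Submodule.Quotient.mk_smul, ratQuotient_mk_eq_iff]
    refine (huniq _ (a • X q) _ ?_).1 (Rel.smul_mem a (hY _))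
    exact funext fun i => congrArg (a • ·) (congrFun (hX q) i)
  · exact ratQuotient_mk_eq_iff.trans (huniq _ x y rfl).symm

end generic

/-! ### `GL_n(K)` acting on row vectors -/

section vecMulInv
variable {K : Type*} [Field K] {n : ℕ}

/-- Right multiplication by `γ⁻¹` on row vectors. -/
def vecMulInv (γ : GL (Fin n) K) : (Fin n → K) ≃ₗ[K] (Fin n → K) :=
  LinearEquiv.ofLinearMap (Matrix.vecMulLinear (γ⁻¹).val) (Matrix.vecMulLinear γ.val)
    (LinearMap.ext fun x => by
      simp [Matrix.vecMul_vecMul])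
    (LinearMap.ext fun x => by
      simp [Matrix.vecMul_vecMul])

theorem vecMulInv_apply (γ : GL (Fin n) K) (x : Fin n → K) :
    vecMulInv γ x = x ᵥ* (γ⁻¹ : GL (Fin n) K).val := rfl

/-- The inverse matches the left action on `g`, since `Rⁿ (γ g)⁻¹ = Rⁿ g⁻¹ γ⁻¹`. Accordingly `γ` is
the matrix of `e.symm`. -/
theorem exists_vecMulInv_eq (e : (Fin n → K) ≃ₗ[K] (Fin n → K)) :
    ∃ γ : GL (Fin n) K, vecMulInv γ = e := by
  have h (f : (Fin n → K) →ₗ[K] (Fin n → K)) (x : Fin n → K) :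
      x ᵥ* LinearMap.toMatrixRight' f = f x :=
    congrArg (fun f => f x) (LinearMap.toMatrixRight'.symm_apply_apply f)
  have h' (f g : (Fin n → K) ≃ₗ[K] (Fin n → K)) (hfg : ∀ x, g (f x) = x) :
      LinearMap.toMatrixRight' (f : (Fin n → K) →ₗ[K] (Fin n → K)) *
        LinearMap.toMatrixRight' (g : (Fin n → K) →ₗ[K] (Fin n → K)) = 1 := by
    refine Matrix.ext_of_single_vecMul fun i => ?_
    rw [← Matrix.vecMul_vecMul, h, h, Matrix.vecMul_one]
    exact hfg _
  refine ⟨⟨LinearMap.toMatrixRight' e.symm, LinearMap.toMatrixRight' e,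
    h' _ _ e.apply_symm_apply, h' _ _ e.symm_apply_apply⟩, LinearEquiv.ext fun x => h _ x⟩

end vecMulInv

/-! ### The correspondence between pairs `(Λ, φ)` and data `(g, ρ)` -/

section attached
variable {K : Type*} [Field K] [IsGlobalFunctionField K] {P : Place K} {n : ℕ}

theorem sub_embVec_mem_adelicLattice_iff {g : GL (Fin n) P.FiniteAdele}
    {M : Matrix (Fin n) (Fin n) P.FiniteAdele} {x y : Fin n → K} :
    P.embVec x ᵥ* (M * (g⁻¹ : GL (Fin n) P.FiniteAdele).val) - P.embVec y ∈ adelicLattice g ↔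
      ∀ i, (P.embVec x ᵥ* M - P.embVec y ᵥ* g.val) i ∈ P.integralAdeles := by
  rw [mem_adelicLattice_iff, Matrix.sub_vecMul, Matrix.vecMul_vecMul, mul_assoc, ← Units.val_mul,
    inv_mul_cancel, Units.val_one, mul_one]

theorem KRationalLattice.isLattice (L : KRationalLattice P n) : L.Λ.IsLattice K :=
  ⟨L.fg, (nonempty_tensor_equiv_iff L.Λ).1 L.rank⟩

theorem exists_kRationalLattice_of_ratPair (L : RatPair P n (Fin n → K)) [L.Λ.IsLattice K] :
    ∃ L' : KRationalLattice P n, L'.toRatPair = L :=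
  ⟨⟨L, Submodule.IsLattice.fg, (nonempty_tensor_equiv_iff L.Λ).2 Submodule.IsLattice.span_eq_top⟩,
    rfl⟩

namespace RatPair

/-- The pair attached to `(g, ρ)` exists. -/
theorem exists_isAttachedTo (g : GL (Fin n) P.FiniteAdele)
    (ρ : Matrix (Fin n) (Fin n) P.integralAdeles) :
    ∃ L : KRationalLattice P n, L.toRatPair.IsAttachedTo g ρ := by
  -- The graph of `ρ g⁻¹` on representatives. Strong approximation makes it total, and integrality
  -- of `ρ` sends `Aⁿ` to zero.
  let Rel : Submodule P.regularRing ((Fin n → K) × (Fin n → K)) :=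
    { carrier := {q | P.embVec q.1 ᵥ* (ρ.map P.integralAdeles.subtype *
        (g⁻¹ : GL (Fin n) P.FiniteAdele).val) - P.embVec q.2 ∈ adelicLattice g}
      add_mem' := fun {q q'} h h' => by
        have := (adelicLattice g).add_mem h h'
        rwa [sub_add_sub_comm, ← Matrix.add_vecMul, ← embVec_add, ← embVec_add] at this
      zero_mem' := by
        have : P.embVec (0 : Fin n → K) = 0 := funext fun _ => map_zero _
        simp [this]
      smul_mem' := fun a q h => by
        have h1 := (adelicLattice g).smul_mem
          ⟨algebraMap K P.FiniteAdele a, algebraMap_mem_integralAdeles a⟩ h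
        have h2 (x : Fin n → K) : P.embVec (a • x) =
            algebraMap K P.FiniteAdele (a : K) • P.embVec x := embVec_smul _ _
        simp only [Set.mem_ofPred_eq, Prod.smul_fst, Prod.smul_snd, h2, Matrix.smul_vecMul,
          ← smul_sub]
        exact h1 }
  obtain ⟨φ, hφ⟩ := exists_hom_of_relation (latticeOf g) Submodule.IsLattice.span_eq_top Rel
    (fun x => exists_sub_mem_adelicLattice g (P.embVec x ᵥ* (ρ.map P.integralAdeles.subtype *
        (g⁻¹ : GL (Fin n) P.FiniteAdele).val))) fun x y hx => by
      change P.embVec x ᵥ* _ - P.embVec y ∈ adelicLattice g ↔ P.embVec y ∈ adelicLattice g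
      refine Submodule.sub_mem_iff_right _ ?_
      rw [← Matrix.vecMul_vecMul]
      exact vecMul_inv_mem_adelicLattice fun i =>
        vecMul_mem_integralAdeles (embVec_mem_iff.2 hx) (fun i j => (ρ i j).2) i
  obtain ⟨L, hL⟩ := exists_kRationalLattice_of_ratPair (⟨latticeOf g, φ⟩ : RatPair P n (Fin n → K))
  refine ⟨L, ?_⟩
  rw [hL]
  exact ⟨rfl, hφ⟩

namespace IsAttachedTo

theorem left_unique {L L' : RatPair P n (Fin n → K)} {g : GL (Fin n) P.FiniteAdele}
    {ρ : Matrix (Fin n) (Fin n) P.integralAdeles} (h : L.IsAttachedTo g ρ)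
    (h' : L'.IsAttachedTo g ρ) : L = L' := by
  refine RatPair.ext_of_forall (h.1.trans h'.1.symm) fun x y y' hy hxy => ?_
  rw [h'.2, ← hy]
  exact (h.2 x y).1 hxy

/-- On the class of `c` in the `i`-th coordinate, agreement means that `c (ρ i j - ρ' i j)` is
integral; this for all `c ∈ K` forces equality. -/
theorem right_unique {L : RatPair P n (Fin n → K)} {g : GL (Fin n) P.FiniteAdele}
    {ρ ρ' : Matrix (Fin n) (Fin n) P.integralAdeles} (h : L.IsAttachedTo g ρ)
    (h' : L.IsAttachedTo g ρ') : ρ = ρ' := by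
  refine Matrix.ext fun i j => Subtype.ext (sub_eq_zero.1 ?_)
  refine FiniteAdele.eq_zero_of_forall_mul_mem _ fun c => ?_
  obtain ⟨y, hy⟩ := L.exists_apply_eq_mk (Pi.single i c)
  have h1 := sub_embVec_mem_adelicLattice_iff.1 ((h.2 _ y).1 hy) j
  have h2 := sub_embVec_mem_adelicLattice_iff.1 ((h'.2 _ y).1 hy) j
  have h3 (M : Matrix (Fin n) (Fin n) P.FiniteAdele) :
      (P.embVec (Pi.single i c) ᵥ* M) j = algebraMap K P.FiniteAdele c * M i j := by
    have : P.embVec (Pi.single i c) = Pi.single i (algebraMap K P.FiniteAdele c) :=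
      funext fun k => Pi.apply_single (fun _ => algebraMap K P.FiniteAdele) (fun _ => map_zero _) i c k
    rw [this, Matrix.single_vecMul]
    rfl
  have h4 := sub_mem h1 h2
  rw [Pi.sub_apply, Pi.sub_apply, sub_sub_sub_cancel_right, h3, h3, ← mul_sub] at h4
  exact h4

/-- If `Λ = Λ(g)`, then every `φ` is induced by right multiplication by some `ρ g⁻¹`. -/
theorem exists_of_latticeOf_eq {L : RatPair P n (Fin n → K)} {g : GL (Fin n) P.FiniteAdele}
    (hg : L.Λ = latticeOf g) :
    ∃ ρ : Matrix (Fin n) (Fin n) P.integralAdeles, L.IsAttachedTo g ρ := by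
  classical
  choose Y hY using fun (i : Fin n) (x : K) => L.exists_apply_eq_mk (Pi.single i x)
  have hmem (y : Fin n → K) :
      y ∈ L.Λ ↔ ∀ j, (P.embVec y ᵥ* g.val) j ∈ P.integralAdeles := by
    rw [hg, mem_latticeOf_iff, mem_adelicLattice_iff]
  have hsingle (i : Fin n) (x : K) : (fun k => Submodule.Quotient.mk ((Pi.single i x : Fin n → K) k)) =
      (Pi.single i (Submodule.Quotient.mk x) : Fin n → P.KModA) :=
    funext fun k => Pi.apply_single (fun _ (x : K) => (Submodule.Quotient.mk x : P.KModA))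
      (fun _ => Submodule.Quotient.mk_zero _) i x k
  -- The `j`-th coordinate of `φ` on the `i`-th factor, read through `g`, is homogeneous modulo `R`
  -- and sends `A` to `R`, so it is multiplication by some `ρ i j ∈ R`.
  have hρ (i j) : ∃ r : P.integralAdeles, ∀ x,
      (P.embVec (Y i x) ᵥ* g.val) j - algebraMap K P.FiniteAdele x * r ∈ P.integralAdeles := by
    refine exists_multiplier _ (fun a ha x => ?_) fun a ha => ?_
    · have h1 : (Submodule.Quotient.mk (Y i (a * x)) : RatQuotient L.Λ) =
          Submodule.Quotient.mk ((⟨a, ha⟩ : P.regularRing) • Y i x) := by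
        rw [Submodule.Quotient.mk_smul, ← hY, ← hY, ← map_smul, hsingle, hsingle, ← Pi.single_smul]
        rfl
      rw [ratQuotient_mk_eq_iff] at h1
      have h2 := (hmem _).1 h1 j
      have h3 : P.embVec ((Y i (a * x) : Fin n → K) -
          (((⟨a, ha⟩ : P.regularRing) • Y i x : ratSpan L.Λ) : Fin n → K)) =
          P.embVec (Y i (a * x) : Fin n → K) -
            algebraMap K P.FiniteAdele a • P.embVec (Y i x : Fin n → K) := by
        rw [embVec_sub, ← embVec_smul]
        rfl
      rw [h3, Matrix.sub_vecMul, Matrix.smul_vecMul] at h2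
      exact h2
    · have h1 : (Submodule.Quotient.mk (Y i a) : RatQuotient L.Λ) = Submodule.Quotient.mk 0 := by
        have : (Submodule.Quotient.mk a : P.KModA) = 0 :=
          (Submodule.Quotient.mk_eq_zero _).2 ⟨⟨a, ha⟩, rfl⟩
        rw [← hY, hsingle, this, Pi.single_zero, map_zero, Submodule.Quotient.mk_zero]
      rw [ratQuotient_mk_eq_iff] at h1
      have h2 := (hmem _).1 h1 j
      simpa using h2
  choose ρ hρ using hρ
  refine ⟨Matrix.of ρ, hg, fun x y => ?_⟩
  have hsum : L.φ (fun i => Submodule.Quotient.mk (x i)) =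
      Submodule.Quotient.mk (∑ i, Y i (x i)) := by
    have h1 : (fun i => Submodule.Quotient.mk (x i) : Fin n → P.KModA) =
        ∑ i, Pi.single i (Submodule.Quotient.mk (x i)) :=
      (Finset.univ_sum_single _).symm
    rw [h1, map_sum, ← Submodule.mkQ_apply, map_sum]
    refine Finset.sum_congr rfl fun i _ => ?_
    rw [← hsingle, hY, Submodule.mkQ_apply]
  rw [hsum, ratQuotient_mk_eq_iff, sub_embVec_mem_adelicLattice_iff, hmem]
  refine forall_congr' fun j => ?_
  -- The two membership conditions concern adeles that differ by an element of `R`.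
  have h2 : (P.embVec (((∑ i, Y i (x i) : ratSpan L.Λ) : Fin n → K) - (y : Fin n → K)) ᵥ* g.val) j -
      (P.embVec x ᵥ* (Matrix.of ρ).map P.integralAdeles.subtype - P.embVec y ᵥ* g.val) j ∈
        P.integralAdeles := by
    have h3 : (P.embVec (((∑ i, Y i (x i) : ratSpan L.Λ) : Fin n → K) - (y : Fin n → K)) ᵥ* g.val) j -
      (P.embVec x ᵥ* (Matrix.of ρ).map P.integralAdeles.subtype - P.embVec y ᵥ* g.val) j =
        ∑ i, ((P.embVec (Y i (x i)) ᵥ* g.val) j - algebraMap K P.FiniteAdele (x i) * ρ i j) := by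
      have h4 : P.embVec ((∑ i, Y i (x i) : ratSpan L.Λ) : Fin n → K) =
          ∑ i, P.embVec (Y i (x i) : Fin n → K) := by
        funext k
        simp [embVec]
      rw [embVec_sub, Matrix.sub_vecMul, h4, Matrix.sum_vecMul, Pi.sub_apply, Pi.sub_apply,
        sub_sub_sub_cancel_right, Finset.sum_apply, Finset.sum_sub_distrib]
      rfl
    rw [h3]
    exact sum_mem fun i _ => hρ i j (x i)
  constructor
  · intro h
    have := sub_mem h h2
    rwa [sub_sub_cancel] at this
  · intro h
    have := add_mem h2 h
    rwa [sub_add_cancel] at this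

/-- `Rⁿ m⁻¹ = Rⁿ` for `m ∈ GL_n(R)`, and `m` cancels in `(ρ m) (g m)⁻¹`. -/
theorem mul_map {L : RatPair P n (Fin n → K)} {g : GL (Fin n) P.FiniteAdele}
    {ρ : Matrix (Fin n) (Fin n) P.integralAdeles} (h : L.IsAttachedTo g ρ)
    (m : GL (Fin n) P.integralAdeles) :
    L.IsAttachedTo (g * Matrix.GeneralLinearGroup.map P.integralAdeles.subtype m)
      (ρ * m.val) := by
  set m' := Matrix.GeneralLinearGroup.map P.integralAdeles.subtype m with hm'
  have hval : m'.val = m.val.map P.integralAdeles.subtype := rfl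
  have hmem : ∀ y, (∀ i, y i ∈ P.integralAdeles) ↔ ∀ i, (y ᵥ* m'.val) i ∈ P.integralAdeles := by
    refine fun y => ⟨fun hy i => vecMul_mem_integralAdeles hy (fun i j => (m.val i j).2) i,
      fun hy => ?_⟩
    have h1 (i) := vecMul_mem_integralAdeles hy (M := (m'⁻¹).val) (fun i j => ((m⁻¹).val i j).2) i
    rwa [Matrix.vecMul_vecMul, ← Units.val_mul, mul_inv_cancel, Units.val_one,
      Matrix.vecMul_one] at h1
  have hlat (y) : y ∈ adelicLattice (g * m') ↔ y ∈ adelicLattice g := by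
    rw [mem_adelicLattice_iff, mem_adelicLattice_iff, hmem (y ᵥ* g.val), Matrix.vecMul_vecMul,
      Units.val_mul]
  refine ⟨?_, fun x y => ?_⟩
  · rw [h.1]
    ext x
    exact (hlat _).symm
  · rw [h.2, hlat, Matrix.map_mul, mul_inv_rev, Units.val_mul, ← hval, mul_assoc,
      ← mul_assoc m'.val, ← Units.val_mul, mul_inv_cancel, Units.val_one, one_mul]

end IsAttachedTo
end RatPair

section transport
open Matrix.GeneralLinearGroup

theorem embVec_vecMulInv_vecMul (γ : GL (Fin n) K) (g : GL (Fin n) P.FiniteAdele) (x : Fin n → K) :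
    P.embVec (vecMulInv γ x) ᵥ* (map (algebraMap K P.FiniteAdele) γ * g).val =
      P.embVec x ᵥ* g.val := by
  rw [vecMulInv_apply, embVec_vecMul, Matrix.vecMul_vecMul, Units.val_mul, ← mul_assoc]
  change P.embVec x ᵥ* ((map (algebraMap K P.FiniteAdele) γ⁻¹).val *
    (map (algebraMap K P.FiniteAdele) γ).val * g.val) = _
  rw [← Units.val_mul, ← map_mul, inv_mul_cancel, map_one, Units.val_one, one_mul]

/-- Both conditions are tested after multiplication by the matrix of the pair, and `(x γ⁻¹) (γ g) =
x g`. -/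
theorem RatPair.IsAttachedTo.mapsTo {L L' : RatPair P n (Fin n → K)}
    {g : GL (Fin n) P.FiniteAdele} {ρ : Matrix (Fin n) (Fin n) P.integralAdeles}
    {γ : GL (Fin n) K} (h : L.IsAttachedTo g ρ)
    (h' : L'.IsAttachedTo (map (algebraMap K P.FiniteAdele) γ * g) ρ) :
    L.MapsTo (vecMulInv γ : (Fin n → K) →ₗ[K] (Fin n → K)) L' := by
  have hmem (x) : vecMulInv γ x ∈ L'.Λ ↔ x ∈ L.Λ := by
    rw [h.1, h'.1, mem_latticeOf_iff, mem_latticeOf_iff, mem_adelicLattice_iff,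
      mem_adelicLattice_iff, embVec_vecMulInv_vecMul]
  refine RatPair.mapsTo_of_forall (le_antisymm ?_ fun x hx => ?_) fun x y y' hy hxy => ?_
  · rintro _ ⟨x, hx, rfl⟩
    exact (hmem x).2 hx
  · refine ⟨(vecMulInv γ).symm x, (hmem _).1 ?_, (vecMulInv γ).apply_symm_apply x⟩
    rwa [(vecMulInv γ).apply_symm_apply x]
  · rw [h.2, sub_embVec_mem_adelicLattice_iff] at hxy
    rw [h'.2, sub_embVec_mem_adelicLattice_iff, hy]
    change ∀ i, (_ - P.embVec (vecMulInv γ y) ᵥ* _) i ∈ P.integralAdeles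
    rwa [embVec_vecMulInv_vecMul]

/-- The pair attached to `(γ g, ρ)` is also an image of `L`, and images are unique. -/
theorem RatPair.IsAttachedTo.of_mapsTo {L L' : RatPair P n (Fin n → K)}
    {g : GL (Fin n) P.FiniteAdele} {ρ : Matrix (Fin n) (Fin n) P.integralAdeles}
    {γ : GL (Fin n) K} (h : L.IsAttachedTo g ρ)
    (h' : L.MapsTo (vecMulInv γ : (Fin n → K) →ₗ[K] (Fin n → K)) L') :
    L'.IsAttachedTo (map (algebraMap K P.FiniteAdele) γ * g) ρ := by
  obtain ⟨L'', hL''⟩ := RatPair.exists_isAttachedTo (map (algebraMap K P.FiniteAdele) γ * g) ρ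
  rwa [h'.right_unique (h.mapsTo hL'')]

/-- Two data with the same attached pair differ by an element of `GL_n(R)`. -/
theorem RatPair.IsAttachedTo.exists_eq_mul {L : RatPair P n (Fin n → K)}
    {g g' : GL (Fin n) P.FiniteAdele} {ρ ρ' : Matrix (Fin n) (Fin n) P.integralAdeles}
    (h : L.IsAttachedTo g ρ) (h' : L.IsAttachedTo g' ρ') :
    ∃ m : GL (Fin n) P.integralAdeles, g' = g * map P.integralAdeles.subtype m ∧
      ρ' = ρ * m.val := by
  obtain ⟨m, rfl⟩ := exists_eq_mul_map_of_latticeOf_eq (h.1.symm.trans h'.1)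
  exact ⟨m, rfl, h'.right_unique (h.mul_map m)⟩

theorem KRationalLattice.exists_isAttachedTo (L : KRationalLattice P n) :
    ∃ g ρ, L.toRatPair.IsAttachedTo g ρ := by
  have := L.isLattice
  obtain ⟨g, hg⟩ := exists_latticeOf_eq L.Λ
  exact ⟨g, RatPair.IsAttachedTo.exists_of_latticeOf_eq hg.symm⟩

end transport
end attached

/-! ### The first bijection -/

section rational
variable {K : Type*} [Field K] [IsGlobalFunctionField K] {P : Place K} {n : ℕ}

/-- One direction yields well-definedness of the map on classes, the other its injectivity. -/
theorem iso_iff_of_isAttachedTo {L L' : KRationalLattice P n} {g g' : GL (Fin n) P.FiniteAdele}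
    {ρ ρ' : Matrix (Fin n) (Fin n) P.integralAdeles} (h : L.toRatPair.IsAttachedTo g ρ)
    (h' : L'.toRatPair.IsAttachedTo g' ρ') :
    KRationalLattice.isoSetoid L L' ↔ adelicSetoid P n (g, ρ) (g', ρ') := by
  constructor
  · rintro ⟨e, he⟩
    obtain ⟨γ, rfl⟩ := exists_vecMulInv_eq e
    obtain ⟨m, hm⟩ := (h.of_mapsTo he).exists_eq_mul h'
    exact ⟨γ, m, hm⟩
  · rintro ⟨γ, m, hg, hρ⟩
    dsimp only at hg hρ
    subst hg hρ
    obtain ⟨L'', hL''⟩ := RatPair.exists_isAttachedTo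
      (Matrix.GeneralLinearGroup.map (algebraMap K P.FiniteAdele) γ * g) ρ
    have := h.mapsTo hL''
    rw [(hL''.mul_map m).left_unique h'] at this
    exact ⟨vecMulInv γ, this⟩

theorem exists_equiv_kRationalLatticeClasses (P : Place K) (n : ℕ) :
    ∃ F : AdelicClasses P n ≃ KRationalLatticeClasses P n,
      ∀ (g : GL (Fin n) P.FiniteAdele) (ρ : Matrix (Fin n) (Fin n) P.integralAdeles),
        ∃ L : KRationalLattice P n, L.toRatPair.IsAttachedTo g ρ ∧
          F (Quotient.mk (adelicSetoid P n) (g, ρ)) = Quotient.mk KRationalLattice.isoSetoid L := by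
  choose L hL using fun (g : GL (Fin n) P.FiniteAdele)
    (ρ : Matrix (Fin n) (Fin n) P.integralAdeles) => RatPair.exists_isAttachedTo g ρ
  let F : AdelicClasses P n → KRationalLatticeClasses P n :=
    Quotient.lift (fun p => Quotient.mk KRationalLattice.isoSetoid (L p.1 p.2)) fun p q hpq =>
      Quotient.sound ((iso_iff_of_isAttachedTo (hL _ _) (hL _ _)).2 hpq)
  refine ⟨Equiv.ofBijective F ⟨fun p q => ?_, fun l => ?_⟩, fun g ρ => ⟨L g ρ, hL g ρ, rfl⟩⟩
  · induction p, q using Quotient.inductionOn₂ with | _ p q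
    exact fun h => Quotient.sound
      ((iso_iff_of_isAttachedTo (hL _ _) (hL _ _)).1 (Quotient.exact h))
  · induction l using Quotient.inductionOn with | _ l
    obtain ⟨g, ρ, h⟩ := l.exists_isAttachedTo
    exact ⟨Quotient.mk _ (g, ρ),
      Quotient.sound ((iso_iff_of_isAttachedTo (hL _ _) h).2 ((adelicSetoid P n).refl _))⟩

end rational

/-! ### The embeddings `ι_ω` -/

section iota
variable {K : Type*} [Field K] {P : Place K} {n : ℕ}

namespace OmegaTilde
variable (ω : OmegaTilde P n)

theorem iota_apply (x : Fin n → K) : ω.iota x = ∑ i, x i • ω.1 i := rfl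

theorem iota_eq_linearCombination (x : Fin n → K) :
    ω.iota x = Fintype.linearCombination P.completion ω.1 fun i => algebraMap K P.completion (x i) := by
  rw [iota_apply, Fintype.linearCombination_apply]
  exact Finset.sum_congr rfl fun i _ => (algebraMap_smul P.completion (x i) (ω.1 i)).symm

theorem iota_injective : Function.Injective ω.iota := by
  have h := ω.2.fintypeLinearCombination_injective
  intro x y hxy
  rw [iota_eq_linearCombination, iota_eq_linearCombination] at hxy
  exact funext fun i => (algebraMap K P.completion).injective (congrFun (h hxy) i)

theorem iota_single (i : Fin n) : ω.iota (Pi.single i 1) = ω.1 i := by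
  classical
  rw [iota, Fintype.linearCombination_apply_single, one_smul]

theorem range_iota : LinearMap.range ω.iota = Submodule.span K (Set.range ω.1) :=
  Fintype.range_linearCombination K ω.1

theorem iota_smul_vecMulInv (γ : GL (Fin n) K) (x : Fin n → K) :
    (γ • ω).iota (vecMulInv γ x) = ω.iota x := by
  have h (y : Fin n → K) : (γ • ω).iota y = ω.iota (y ᵥ* γ.val) := by
    simp only [iota_apply, smul_apply, Matrix.vecMul, dotProduct, Finset.smul_sum, Finset.sum_smul,
      smul_smul]
    exact Finset.sum_comm
  rw [h, vecMulInv_apply, Matrix.vecMul_vecMul, ← Units.val_mul, inv_mul_cancel, Units.val_one,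
    Matrix.vecMul_one]

end OmegaTilde

theorem RatPair.MapsTo.range_eq {V V' : Type*} [AddCommGroup V] [Module K V] [AddCommGroup V']
    [Module K V'] {f : V →ₗ[K] V'} {L : RatPair P n V} {L' : RatPair P n V'} (h : L.MapsTo f L')
    (hL : Submodule.span K (L.Λ : Set V) = ⊤) :
    LinearMap.range f = Submodule.span K (L'.Λ : Set V') := by
  rw [LinearMap.range_eq_map, ← hL, Submodule.map_span, ← h.1]
  rfl

theorem RatPair.MapsTo.of_comp_left {V V' V'' : Type*} [AddCommGroup V] [Module K V]
    [AddCommGroup V'] [Module K V'] [AddCommGroup V''] [Module K V''] {f : V →ₗ[K] V'}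
    {f' : V' →ₗ[K] V''} {L : RatPair P n V} {L' : RatPair P n V'} {L'' : RatPair P n V''}
    (h : L.MapsTo f L') (h' : L.MapsTo (f'.comp f) L'') : L'.MapsTo f' L'' := by
  obtain ⟨M, hM⟩ := L'.mapsTo_map f'
  rwa [h'.right_unique (hM.comp h)]

theorem norm_algebraMap_le_iff {x y : K} :
    ‖algebraMap K P.completion x‖ ≤ ‖algebraMap K P.completion y‖ ↔ P.val x ≤ P.val y := by
  rw [← Place.valued_algebraMap, ← Place.valued_algebraMap]
  exact Valued.toNormedField.norm_le_iff

end iota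

/-! ### Discreteness in `C_∞` -/

section discrete
variable {K : Type*} [Field K] [IsGlobalFunctionField K] {P : Place K} {n : ℕ}

instance infinite_regularRing : Infinite P.regularRing := by
  obtain ⟨t, ht, htv⟩ := P.exists_unique_pole
  have htv : t ∈ P.regularRing := htv
  refine Infinite.of_injective (fun k : ℕ => (⟨t, htv⟩ : P.regularRing) ^ k) fun k l hkl => ?_
  have h := congrArg (fun a : P.regularRing => P.val (a : K)) hkl
  dsimp only at h
  rw [SubmonoidClass.coe_pow, SubmonoidClass.coe_pow, map_pow, map_pow] at h
  exact (pow_right_strictMono₀ ht).injective h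

/-- After clearing denominators, a nonzero coordinate lies in `A` and so has norm at least `1` at
`∞`. An injective linear map on the finite-dimensional space `K_∞ⁿ` is bounded below. -/
theorem exists_pos_le_norm_iota (Λ : Submodule P.regularRing (Fin n → K)) [Λ.IsLattice K]
    (ω : OmegaTilde P n) : ∃ ε > 0, ∀ x ∈ Λ, x ≠ 0 → ε ≤ ‖ω.iota x‖ := by
  obtain ⟨d, hdA, hd, hdΛ⟩ := exists_smul_regular_of_isLattice Λ
  obtain ⟨C, hC, hanti⟩ := (Fintype.linearCombination P.completion ω.1).exists_antilipschitzWith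
    (LinearMap.ker_eq_bot.2 (ω.2.fintypeLinearCombination_injective))
  have hd' : 0 < ‖algebraMap K P.completion d‖ :=
    norm_pos_iff.2 ((map_ne_zero _).2 hd)
  have hC' : (0 : ℝ) < C := hC
  refine ⟨((C : ℝ) * ‖algebraMap K P.completion d‖)⁻¹, inv_pos.2 (mul_pos hC' hd'), fun x hx hx0 => ?_⟩
  obtain ⟨i, hi⟩ := Function.ne_iff.1 hx0
  have h1 : 1 ≤ ‖algebraMap K P.completion (d * x i)‖ := by
    rw [← norm_one (α := P.completion), ← map_one (algebraMap K P.completion),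
      norm_algebraMap_le_iff, map_one]
    by_contra! h
    exact mul_ne_zero hd hi (P.eq_zero_of_mem_regularRing (hdΛ x hx i) h)
  have h2 := hanti.le_mul_dist (fun i => algebraMap K P.completion (x i)) 0
  rw [map_zero, dist_zero_right, dist_zero_right, ← ω.iota_eq_linearCombination] at h2
  have h3 := (norm_le_pi_norm (fun i => algebraMap K P.completion (x i)) i).trans h2
  rw [map_mul, norm_mul] at h1
  rw [inv_le_iff_one_le_mul₀ (mul_pos hC' hd')]
  refine h1.trans ((mul_le_mul_of_nonneg_left h3 hd'.le).trans_eq ?_)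
  ring

theorem exists_mapsTo_iota (L : KRationalLattice P n) (ω : OmegaTilde P n) :
    ∃ L' : KRationalCLattice P n, L.toRatPair.MapsTo ω.iota L'.toRatPair := by
  have := L.isLattice
  obtain ⟨L', h⟩ := L.toRatPair.mapsTo_map ω.iota
  obtain ⟨ε, hε, hmin⟩ := exists_pos_le_norm_iota L.Λ ω
  refine ⟨⟨L', h.1 ▸ L.fg.map _, ?_, ?_⟩, h⟩
  · refine DiscreteTopology.of_forall_le_norm (r := ε) hε fun y hy => ?_
    obtain ⟨y, hy'⟩ := y
    obtain ⟨x, hx, rfl⟩ := h.1.ge hy'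
    refine hmin x hx ?_
    rintro rfl
    exact hy (Subtype.ext (map_zero ω.iota))
  · have h1 : Submodule.span P.completion (L'.Λ : Set P.CInfty) =
        Submodule.span P.completion (Set.range ω.1) := by
      have h2 := h.range_eq Submodule.IsLattice.span_eq_top
      rw [ω.range_iota] at h2
      rw [← Submodule.span_span_of_tower K, ← h2, Submodule.span_span_of_tower]
    rw [h1, finrank_span_eq_card ω.2, Fintype.card_fin]

theorem exists_regular_norm_sub_le (P : Place K) :
    ∃ C : ℝ, ∀ a : P.completion, ∃ x : P.regularRing, ‖a - algebraMap K P.completion x‖ ≤ C := by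
  obtain ⟨C, hC⟩ := P.exists_regular_sub_le
  obtain ⟨y, hy⟩ := P.surjective C
  refine ⟨max 1 ‖algebraMap K P.completion y‖, fun a => ?_⟩
  obtain ⟨b, hb⟩ := P.exists_valued_sub_lt a 1 one_ne_zero
  obtain ⟨x, hx, hbx⟩ := hC b
  refine ⟨⟨x, hx⟩, ?_⟩
  rw [← sub_add_sub_cancel a (algebraMap K P.completion b)]
  refine (IsUltrametricDist.norm_add_le_max _ _).trans (max_le_max ?_ ?_)
  · rw [← norm_one (α := P.completion)]
    refine Valued.toNormedField.norm_le_iff.2 ?_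
    rw [map_one]
    exact hb.le
  · rw [← map_sub, norm_algebraMap_le_iff, hy]
    exact hbx

/-- In a discrete `A`-submodule of `C_∞`, linear independence over `K` and over `K_∞` agree. -/
theorem linearIndependent_completion {ι : Type*} [Finite ι] (Λ : Submodule P.regularRing P.CInfty)
    [DiscreteTopology Λ] {l : ι → P.CInfty} (hl : ∀ i, l i ∈ Λ) (hli : LinearIndependent K l) :
    LinearIndependent P.completion l := by
  have := Fintype.ofFinite ι
  rw [Fintype.linearIndependent_iff]
  intro c hc j
  by_contra hj
  obtain ⟨C, hC⟩ := exists_regular_norm_sub_le P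
  have hC0 : 0 ≤ C := by
    obtain ⟨x, hx⟩ := hC 0
    exact (norm_nonneg _).trans hx
  choose q hq using hC
  classical
  -- The relation is rescaled to have coefficient `a` at `j`, and its other coefficients are rounded
  -- to `A`. Then `Φ a ∈ Λ` is the combination of the rounding errors alone and stays in a compact
  -- set, while its coefficient `a` at `j` makes `Φ` injective.
  let u (a : P.regularRing) (i : ι) : P.completion := algebraMap K P.completion a * ((c j)⁻¹ * c i)
  let b (a : P.regularRing) : ι → P.regularRing := Function.update (fun i => q (u a i)) j a
  have hb (a i) : ‖u a i - algebraMap K P.completion (b a i)‖ ≤ C := by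
    rcases eq_or_ne i j with rfl | hij
    · simpa [u, b, inv_mul_cancel₀ hj] using hC0
    · simpa only [b, Function.update_of_ne hij] using hq (u a i)
  let Φ (a : P.regularRing) : P.CInfty := ∑ i, (b a i : K) • l i
  have hΦΛ (a) : Φ a ∈ Λ := sum_mem fun i _ => Λ.smul_mem (b a i) (hl i)
  have hΦC (a) : Φ a ∈ Fintype.linearCombination P.completion l '' Metric.closedBall 0 C := by
    refine ⟨fun i => algebraMap K P.completion (b a i) - u a i, ?_, ?_⟩
    · rw [mem_closedBall_zero_iff, pi_norm_le_iff_of_nonneg hC0]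
      exact fun i => (norm_sub_rev _ _).trans_le (hb a i)
    · rw [Fintype.linearCombination_apply]
      simp only [sub_smul, u, mul_smul, Finset.sum_sub_distrib, ← Finset.smul_sum, hc, smul_zero,
        sub_zero, algebraMap_smul]
      rfl
  have hinj : Function.Injective Φ := fun a a' h => by
    have h1 := congrFun (hli.fintypeLinearCombination_injective h) j
    simpa [b] using h1
  -- A discrete subgroup is closed, so it meets a compact set in a finite set; but `A` is infinite.
  have hfin : ((Λ : Set P.CInfty) ∩
      Fintype.linearCombination P.completion l '' Metric.closedBall 0 C).Finite := by
    have hclosed : IsClosed (Λ : Set P.CInfty) :=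
      AddSubgroup.isClosed_of_discrete (H := Λ.toAddSubgroup)
    have hdisc : IsDiscrete (Λ : Set P.CInfty) := ⟨‹_›⟩
    exact (((isCompact_closedBall _ _).image
      (LinearMap.continuous_of_finiteDimensional _)).inter_left hclosed).finite
        (hdisc.mono Set.inter_subset_left)
  exact Set.infinite_range_of_injective hinj
    (hfin.subset (Set.range_subset_iff.2 fun a => ⟨hΦΛ a, hΦC a⟩))

end discrete

/-! ### The second bijection -/

section transcendental
variable {K : Type*} [Field K] [IsGlobalFunctionField K] {P : Place K} {n : ℕ}

namespace KRationalCLattice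

/-- A `K`-basis of `KΛ` chosen inside `Λ` remains independent over `K_∞` by discreteness, hence has
exactly `n` elements and serves as `ω`. -/
theorem exists_span_range_eq (L : KRationalCLattice P n) :
    ∃ ω : OmegaTilde P n, Submodule.span K (Set.range ω.1) =
      Submodule.span K (L.Λ : Set P.CInfty) := by
  obtain ⟨b, hbΛ, hb, hli⟩ := exists_linearIndependent K (L.Λ : Set P.CInfty)
  have hfin : Finite b := by
    obtain ⟨s, hs⟩ := L.fg
    have : FiniteDimensional K (Submodule.span K b) := by
      rw [hb, ← hs, Submodule.span_span_of_tower]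
      exact FiniteDimensional.span_finset K s
    have hli' : LinearIndependent K fun x : b =>
        (⟨x, Submodule.subset_span x.2⟩ : Submodule.span K b) :=
      LinearIndependent.of_comp (Submodule.span K b).subtype hli
    exact hli'.finite
  have := L.discrete
  have hli' := linearIndependent_completion L.Λ (fun x : b => hbΛ x.2) hli
  have := Fintype.ofFinite b
  have hcard : Fintype.card b = n := by
    rw [← finrank_span_eq_card hli', Subtype.range_coe, ← L.rank, ← Submodule.span_span_of_tower K,
      hb, Submodule.span_span_of_tower]
  let e : Fin n ≃ b := (finCongr hcard.symm).trans (Fintype.equivFin b).symm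
  refine ⟨⟨fun i => e i, hli'.comp e e.injective⟩, ?_⟩
  rw [← hb]
  congr 1
  exact (e.surjective.range_comp _).trans Subtype.range_coe

/-- `ι_ω` identifies `Kⁿ` with `KΛ`, so the pair is pulled back along a left inverse of `ι_ω`. -/
theorem exists_mapsTo_iota (L' : KRationalCLattice P n) :
    ∃ (ω : OmegaTilde P n) (L : KRationalLattice P n),
      L.toRatPair.MapsTo ω.iota L'.toRatPair := by
  obtain ⟨ω, hω⟩ := L'.exists_span_range_eq
  obtain ⟨f, hf⟩ := ω.iota.exists_leftInverse_of_injective (LinearMap.ker_eq_bot.2 ω.iota_injective)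
  have hf (x) : f (ω.iota x) = x := congrArg (fun f => f x) hf
  have hf' {y : P.CInfty} (hy : y ∈ ratSpan L'.Λ) : ω.iota (f y) = y := by
    have hy' : y ∈ Submodule.span K (L'.Λ : Set P.CInfty) := hy
    rw [← hω, ← ω.range_iota] at hy'
    obtain ⟨x, rfl⟩ := hy'
    rw [hf]
  obtain ⟨L, hL⟩ := L'.toRatPair.mapsTo_map f
  have : L.Λ.IsLattice K := by
    refine ⟨hL.1 ▸ L'.fg.map _, ?_⟩
    rw [← hL.1]
    have h := Submodule.map_span f (L'.Λ : Set P.CInfty)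
    refine h.symm.trans (eq_top_iff.2 fun x _ => ⟨ω.iota x, ?_, hf x⟩)
    rw [← hω, ← ω.range_iota]
    exact LinearMap.mem_range_self _ x
  obtain ⟨L, rfl⟩ := exists_kRationalLattice_of_ratPair L
  refine ⟨ω, L, hL.of_comp_left (RatPair.mapsTo_of_forall ?_ fun x y y' hy hxy => ?_)⟩
  · refine le_antisymm ?_ fun y hy => ⟨y, hy, hf' (Submodule.subset_span hy)⟩
    rintro _ ⟨y, hy, rfl⟩
    change ω.iota (f y) ∈ L'.Λ
    rwa [hf' (Submodule.subset_span hy)]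
  · rwa [show y' = y from Subtype.ext (hy.trans (hf' y.2))]

end KRationalCLattice

/-- If `c` carries one lattice to the other, then `ι_{ω₂}⁻¹ ∘ c ∘ ι_{ω₁}` is an automorphism of
`Kⁿ`, so it equals `x ↦ x γ⁻¹`. It matches the rational pairs, and evaluation on basis vectors gives
`ω₂ = c γ ω₁`. -/
theorem iso_iff_of_mapsTo_iota {L₁ L₂ : KRationalLattice P n} {L₁' L₂' : KRationalCLattice P n}
    {ω₁ ω₂ : OmegaTilde P n} {g₁ g₂ : GL (Fin n) P.FiniteAdele}
    {ρ₁ ρ₂ : Matrix (Fin n) (Fin n) P.integralAdeles} (h₁ : L₁.toRatPair.IsAttachedTo g₁ ρ₁)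
    (h₂ : L₂.toRatPair.IsAttachedTo g₂ ρ₂) (h₁' : L₁.toRatPair.MapsTo ω₁.iota L₁'.toRatPair)
    (h₂' : L₂.toRatPair.MapsTo ω₂.iota L₂'.toRatPair) :
    KRationalCLattice.isoSetoid L₁' L₂' ↔
      adelicOmegaSetoid P n (g₁, Quotient.mk OmegaTilde.scaleSetoid ω₁, ρ₁)
        (g₂, Quotient.mk OmegaTilde.scaleSetoid ω₂, ρ₂) := by
  constructor
  · rintro ⟨c, hc⟩
    have h := hc.comp h₁'
    have hinj : Function.Injective ((LinearMap.mulLeft K (c : P.CInfty)).comp ω₁.iota) :=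
      (mul_right_injective₀ c.ne_zero).comp ω₁.iota_injective
    have hrange := (h.range_eq L₁.isLattice.span_eq_top).trans
      (h₂'.range_eq L₂.isLattice.span_eq_top).symm
    let e := (LinearEquiv.ofInjective _ hinj).trans ((LinearEquiv.ofEq _ _ hrange).trans
      (LinearEquiv.ofInjective _ ω₂.iota_injective).symm)
    have he (x) : ω₂.iota (e x) = c * ω₁.iota x :=
      congrArg Subtype.val ((LinearEquiv.ofInjective _ ω₂.iota_injective).apply_symm_apply _)
    have he' : ω₂.iota.comp (e : (Fin n → K) →ₗ[K] (Fin n → K)) =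
        (LinearMap.mulLeft K (c : P.CInfty)).comp ω₁.iota := LinearMap.ext he
    rw [← he'] at h
    have hL := h.of_comp ω₂.iota_injective h₂'
    obtain ⟨γ, hγ⟩ := exists_vecMulInv_eq e
    rw [← hγ] at hL he
    obtain ⟨m, hg, hρ⟩ := (h₁.of_mapsTo hL).exists_eq_mul h₂
    refine ⟨γ, m, hg, Eq.symm (Quotient.sound ⟨c, funext fun i => ?_⟩), hρ⟩
    rw [← ω₂.iota_single, ← (vecMulInv γ).apply_symm_apply (Pi.single i 1), he,
      ← (γ • ω₁).iota_single, ← ω₁.iota_smul_vecMulInv γ, (vecMulInv γ).apply_symm_apply]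
  · rintro ⟨γ, m, hg, hω, hρ⟩
    dsimp only at hg hω hρ
    obtain ⟨c, hc⟩ : OmegaTilde.scaleSetoid (γ • ω₁) ω₂ := Quotient.exact hω.symm
    subst hg hρ
    obtain ⟨L, hL⟩ := RatPair.exists_isAttachedTo
      (Matrix.GeneralLinearGroup.map (algebraMap K P.FiniteAdele) γ * g₁) ρ₁
    have h := h₁.mapsTo hL
    rw [(hL.mul_map m).left_unique h₂] at h
    refine ⟨c, h₁'.of_comp_left ?_⟩
    convert h₂'.comp h using 1
    refine LinearMap.ext fun x => ?_
    change c * ω₁.iota x = ω₂.iota (vecMulInv γ x)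
    rw [← ω₁.iota_smul_vecMulInv γ, OmegaTilde.iota_apply, OmegaTilde.iota_apply, hc,
      Finset.mul_sum]
    simp only [mul_smul_comm]

theorem exists_equiv_kRationalCLatticeClasses (P : Place K) (n : ℕ) :
    ∃ F : AdelicOmegaClasses P n ≃ KRationalCLatticeClasses P n,
      ∀ (g : GL (Fin n) P.FiniteAdele) (ω : OmegaTilde P n)
        (ρ : Matrix (Fin n) (Fin n) P.integralAdeles),
        ∃ (L : KRationalLattice P n) (L' : KRationalCLattice P n),
          L.toRatPair.IsAttachedTo g ρ ∧ RatPair.MapsTo ω.iota L.toRatPair L'.toRatPair ∧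
          F (Quotient.mk (adelicOmegaSetoid P n)
              (g, Quotient.mk OmegaTilde.scaleSetoid ω, ρ)) =
            Quotient.mk KRationalCLattice.isoSetoid L' := by
  choose L hL using fun (g : GL (Fin n) P.FiniteAdele)
    (ρ : Matrix (Fin n) (Fin n) P.integralAdeles) => RatPair.exists_isAttachedTo g ρ
  choose L' hL' using fun g ρ ω => exists_mapsTo_iota (L g ρ) ω
  -- The map is defined through a chosen representative of `z`; `hF` then shows that any
  -- representative `ω` gives the same class.
  have key (p q : GL (Fin n) P.FiniteAdele × Omega P n × Matrix (Fin n) (Fin n) P.integralAdeles) :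
      KRationalCLattice.isoSetoid (L' p.1 p.2.2 p.2.1.out) (L' q.1 q.2.2 q.2.1.out) ↔
        adelicOmegaSetoid P n p q := by
    have := iso_iff_of_mapsTo_iota (hL p.1 p.2.2) (hL q.1 q.2.2) (hL' _ _ p.2.1.out)
      (hL' _ _ q.2.1.out)
    rwa [Quotient.out_eq, Quotient.out_eq] at this
  let F : AdelicOmegaClasses P n → KRationalCLatticeClasses P n :=
    Quotient.lift (fun p => Quotient.mk KRationalCLattice.isoSetoid (L' p.1 p.2.2 p.2.1.out))
      fun p q hpq => Quotient.sound ((key p q).2 hpq)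
  have hF {g ω ρ} {l : KRationalLattice P n} {l' : KRationalCLattice P n}
      (h : l.toRatPair.IsAttachedTo g ρ) (h' : l.toRatPair.MapsTo ω.iota l'.toRatPair) :
      F (Quotient.mk _ (g, Quotient.mk OmegaTilde.scaleSetoid ω, ρ)) = Quotient.mk _ l' := by
    refine Quotient.sound ((iso_iff_of_mapsTo_iota (hL _ _) h (hL' _ _ _) h').2 ?_)
    rw [Quotient.out_eq]
  refine ⟨Equiv.ofBijective F ⟨fun p q => ?_, fun l => ?_⟩, fun g ω ρ =>
    ⟨L g ρ, L' g ρ ω, hL g ρ, hL' g ρ ω, hF (hL g ρ) (hL' g ρ ω)⟩⟩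
  · induction p, q using Quotient.inductionOn₂ with | _ p q
    exact fun h => Quotient.sound ((key p q).1 (Quotient.exact h))
  · induction l using Quotient.inductionOn with | _ l'
    obtain ⟨ω, l, h'⟩ := l'.exists_mapsTo_iota
    obtain ⟨g, ρ, h⟩ := l.exists_isAttachedTo
    exact ⟨_, hF h h'⟩

end transcendental

end

theorem proposition3p6 {K : Type*} [Field K] [IsGlobalFunctionField K] (P : Place K) (n : ℕ) :
    (∃ F : AdelicClasses P n ≃ KRationalLatticeClasses P n,
      ∀ (g : GL (Fin n) P.FiniteAdele) (ρ : Matrix (Fin n) (Fin n) P.integralAdeles),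
        ∃ L : KRationalLattice P n,
          L.toRatPair.IsAttachedTo g ρ ∧
          F (Quotient.mk (adelicSetoid P n) (g, ρ)) =
            Quotient.mk KRationalLattice.isoSetoid L) ∧
    (∃ F : AdelicOmegaClasses P n ≃ KRationalCLatticeClasses P n,
      ∀ (g : GL (Fin n) P.FiniteAdele) (ω : OmegaTilde P n)
        (ρ : Matrix (Fin n) (Fin n) P.integralAdeles),
        ∃ (L : KRationalLattice P n) (L' : KRationalCLattice P n),
          L.toRatPair.IsAttachedTo g ρ ∧
          RatPair.MapsTo ω.iota L.toRatPair L'.toRatPair ∧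
          F (Quotient.mk (adelicOmegaSetoid P n)
              (g, Quotient.mk OmegaTilde.scaleSetoid ω, ρ)) =
            Quotient.mk KRationalCLattice.isoSetoid L') :=
  ⟨exists_equiv_kRationalLatticeClasses P n, exists_equiv_kRationalCLatticeClasses P n⟩
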